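/- Let $\mathbb K$ be $\mathbb R$ or $\mathbb C$, and for a matrix $x$ let $x^\tau$ denote its transpose. Let $\tilde H_2=\{1,\tau\}\ltimes \mathrm{GL}_2(\mathbb K)$ be the semidirect product in which $\tau$ (of order two) acts on $\mathrm{GL}_2(\mathbb K)$ by $\tau(g)=(g^{-1})^\tau$, and let $\tilde\chi_2$ be the character of $\tilde H_2$ with $\tilde\chi_2|_{\mathrm{GL}_2(\mathbb K)}=1$ and $\tilde\chi_2(\tau)=-1$. Let $\tilde H_2$ act on $M_2=\mathrm{GL}_2(\mathbb K)\times\mathrm{GL}_2(\mathbb K)$ by $$g(x,y)=(gxg^{-1},gyg^{-1})\quad (g\in \mathrm{GL}_2(\mathbb K)),\qquad \tau(x,y)=(x^\tau,y^\tau).$$ Regard $M_2$ as an open semialgebraic subset of the real vector space $\mathfrak{gl}_2(\mathbb K)\times\mathfrak{gl}_2(\mathbb K)$. A Nash function on $M_2$ is a smooth complex-valued function with semialgebraic graph; a Nash differential operator on $M_2$ is a differential operator whose coefficients (in linear coordinates) are Nash functions. The Schwartz space $\mathcal S(M_2)$ consists of the smooth functions $\varphi:M_2\to\mathbb C$ such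 that $D\varphi$ is bounded for every Nash differential operator $D$, with the topology given by the seminorms $\sup_{M_2}|D\varphi|$. A tempered generalized function on $M_2$ is a continuous linear functional on the space of Schwartz densities $\varphi\,dx$, where $\varphi\in\mathcal S(M_2)$ and $dx$ is Lebesgue measure. Then every tempered generalized function $f$ on $M_2$ that satisfies $f(hx)=\tilde\chi_2(h)f(x)$ for all $h\in\tilde H_2$ is zero. Here the equality is one of generalized functions: $\langle f,h_*\mu\rangle=\tilde\chi_2(h)\langle f,\mu\rangle$ for all compactly supported smooth densities $\mu$ on $M_2$, where $h_*$ is push-forward along $x\mapsto hx$. -/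

import Mathlib

open scoped ContDiff Matrix

attribute [local instance] Matrix.normedAddCommGroup Matrix.normedSpace

noncomputable section

namespace Nash

/-! ### Semialgebraic sets and Nash functions in a finite dimensional real vector space -/

section Semialgebraic

variable (E : Type*) [AddCommGroup E] [Module ℝ E]

/-- Real polynomial functions on a real vector space: the algebra of functions generated by the
linear functionals. -/
def polynomialFunctions : Subalgebra ℝ (E → ℝ) :=
  Algebra.adjoin ℝ (Set.range fun l : Module.Dual ℝ E => (l : E → ℝ))

variable {E}

/-- Semialgebraic subsets: the smallest collection of sets that contains all `{x | 0 < p x}`, `p` a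
real polynomial function, and is closed under intersections and complements. -/
inductive IsSemialgebraic : Set E → Prop
  | pos (p : E → ℝ) (hp : p ∈ polynomialFunctions E) : IsSemialgebraic {x | 0 < p x}
  | inter (s t : Set E) (hs : IsSemialgebraic s) (ht : IsSemialgebraic t) : IsSemialgebraic (s ∩ t)
  | compl (s : Set E) (hs : IsSemialgebraic s) : IsSemialgebraic sᶜ

variable {F : Type*} [AddCommGroup F] [Module ℝ F]

lemma polynomialFunctions.comp_linear {p : F → ℝ} (hp : p ∈ polynomialFunctions F)
    (L : E →ₗ[ℝ] F) : (fun x => p (L x)) ∈ polynomialFunctions E := by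
  induction hp using Algebra.adjoin_induction with
  | mem p hp =>
    obtain ⟨l, rfl⟩ := hp
    exact Algebra.subset_adjoin ⟨l.comp L, rfl⟩
  | algebraMap r => exact (polynomialFunctions E).algebraMap_mem r
  | add p q _ _ h₁ h₂ => exact (polynomialFunctions E).add_mem h₁ h₂
  | mul p q _ _ h₁ h₂ => exact (polynomialFunctions E).mul_mem h₁ h₂

lemma IsSemialgebraic.preimage_linear {s : Set F} (hs : IsSemialgebraic s) (L : E →ₗ[ℝ] F) :
    IsSemialgebraic (L ⁻¹' s) := by
  induction hs with
  | pos p hp => exact .pos _ (polynomialFunctions.comp_linear hp L)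
  | inter s t _ _ h₁ h₂ => exact .inter _ _ h₁ h₂
  | compl s _ h => exact .compl _ h

end Semialgebraic

section Schwartz

/-- An open semialgebraic subset of a real vector space, viewed as a Nash manifold. -/
structure OpenSet (E : Type*) [NormedAddCommGroup E] [NormedSpace ℝ E] where
  carrier : Set E
  isOpen : IsOpen carrier
  semialgebraic : IsSemialgebraic carrier

variable {E : Type*} [NormedAddCommGroup E] [NormedSpace ℝ E]

/-- Nash functions on `U`: smooth complex functions on `U` with semialgebraic graph. (The values
of `a` outside `U` are irrelevant.) -/
def IsNashFunction (U : OpenSet E) (a : E → ℂ) : Prop :=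
  ContDiffOn ℝ ∞ a U.carrier ∧ IsSemialgebraic {q : E × ℂ | q.1 ∈ U.carrier ∧ q.2 = a q.1}

/-- The data of a differential operator `a ∂_{v₁} ⋯ ∂_{vₖ}` on `U`, where `a` is a Nash function
on `U` and the `vᵢ` are directions. Nash differential operators on `U`, that is, differential
operators with Nash coefficients, are exactly the finite sums of these. -/
def Monomial (U : OpenSet E) : Type _ :=
  Σ k : ℕ, {a : E → ℂ // IsNashFunction U a} × (Fin k → E)

/-- The function `a ∂_{v₁} ⋯ ∂_{vₖ} f`. -/
def Monomial.apply {U : OpenSet E} (D : Monomial U) (f : E → ℂ) (x : E) : ℂ :=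
  D.2.1.1 x * iteratedFDeriv ℝ D.1 f x D.2.2

lemma Monomial.apply_add {U : OpenSet E} (D : Monomial U) {f g : E → ℂ}
    (hf : ContDiffOn ℝ ∞ f U.carrier) (hg : ContDiffOn ℝ ∞ g U.carrier) {x : E}
    (hx : x ∈ U.carrier) : D.apply (f + g) x = D.apply f x + D.apply g x := by
  have h : ∀ {u : E → ℂ}, ContDiffOn ℝ ∞ u U.carrier → ContDiffAt ℝ D.1 u x := fun hu =>
    (hu.contDiffAt (U.isOpen.mem_nhds hx)).of_le (by exact_mod_cast le_top)
  simp only [Monomial.apply]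
  rw [iteratedFDeriv_add_apply (h hf) (h hg)]
  simp [mul_add]

lemma Monomial.apply_smul {U : OpenSet E} (D : Monomial U) (c : ℂ) {f : E → ℂ}
    (hf : ContDiffOn ℝ ∞ f U.carrier) {x : E} (hx : x ∈ U.carrier) :
    D.apply (c • f) x = c * D.apply f x := by
  have h : ContDiffAt ℝ D.1 f x :=
    (hf.contDiffAt (U.isOpen.mem_nhds hx)).of_le (by exact_mod_cast le_top)
  simp only [Monomial.apply]
  rw [iteratedFDeriv_const_smul_apply h]
  simp only [smul_apply, smul_eq_mul]
  ring

/-- The Schwartz functions on `U`: smooth functions `f` on `U` such that `D f` is bounded on `U` for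
every Nash differential operator `D` on `U`. A function on `U` is represented by its extension by
zero to `E`. -/
def schwartzSubmodule (U : OpenSet E) : Submodule ℂ (E → ℂ) where
  carrier := {f | (∀ x, x ∉ U.carrier → f x = 0) ∧ ContDiffOn ℝ ∞ f U.carrier ∧
    ∀ D : Monomial U, ∃ C : ℝ, ∀ x ∈ U.carrier, ‖D.apply f x‖ ≤ C}
  zero_mem' := by
    refine ⟨fun _ _ => rfl, contDiffOn_const, fun D => ⟨0, fun x hx => ?_⟩⟩
    have := D.apply_smul (U := U) 0 (f := 0) contDiffOn_const hx
    simp only [smul_zero, zero_mul] at this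
    simp [this]
  add_mem' := by
    rintro f g ⟨hf0, hf, hfb⟩ ⟨hg0, hg, hgb⟩
    refine ⟨fun x hx => by simp [hf0 x hx, hg0 x hx], hf.add hg, fun D => ?_⟩
    obtain ⟨A, hA⟩ := hfb D
    obtain ⟨B, hB⟩ := hgb D
    refine ⟨A + B, fun x hx => ?_⟩
    rw [D.apply_add hf hg hx]
    exact (norm_add_le _ _).trans (add_le_add (hA x hx) (hB x hx))
  smul_mem' := by
    rintro c f ⟨hf0, hf, hfb⟩
    refine ⟨fun x hx => by simp [hf0 x hx], hf.const_smul c, fun D => ?_⟩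
    obtain ⟨A, hA⟩ := hfb D
    refine ⟨‖c‖ * A, fun x hx => ?_⟩
    rw [D.apply_smul c hf hx, norm_mul]
    exact mul_le_mul_of_nonneg_left (hA x hx) (norm_nonneg c)

/-- The Schwartz space `𝓢(U)`. -/
def SchwartzSpace (U : OpenSet E) : Type _ := schwartzSubmodule U

namespace SchwartzSpace

variable {U : OpenSet E}

instance : AddCommGroup (SchwartzSpace U) := inferInstanceAs (AddCommGroup (schwartzSubmodule U))

instance : Module ℂ (SchwartzSpace U) := inferInstanceAs (Module ℂ (schwartzSubmodule U))

instance : CoeFun (SchwartzSpace U) (fun _ => E → ℂ) := ⟨fun f => f.1⟩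

lemma bddAbove (D : Monomial U) (f : SchwartzSpace U) :
    BddAbove (Set.range fun x : U.carrier => ‖D.apply f x‖) := by
  obtain ⟨C, hC⟩ := f.2.2.2 D
  exact ⟨C, by rintro _ ⟨x, rfl⟩; exact hC x x.2⟩

/-- The seminorm `f ↦ sup_U |D f|`. -/
def seminorm (D : Monomial U) : Seminorm ℂ (SchwartzSpace U) :=
  Seminorm.of (fun f => ⨆ x : U.carrier, ‖D.apply f x‖)
    (by
      intro f g
      refine Real.iSup_le (fun x => ?_) (add_nonneg (Real.iSup_nonneg fun _ => norm_nonneg _)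
        (Real.iSup_nonneg fun _ => norm_nonneg _))
      change ‖D.apply ((f : E → ℂ) + (g : E → ℂ)) x‖ ≤ _
      rw [D.apply_add f.2.2.1 g.2.2.1 x.2]
      exact (norm_add_le _ _).trans
        (add_le_add (le_ciSup (bddAbove D f) x) (le_ciSup (bddAbove D g) x)))
    (by
      intro c f
      rw [Real.mul_iSup_of_nonneg (norm_nonneg c)]
      refine congrArg iSup (funext fun x => ?_)
      change ‖D.apply (c • (f : E → ℂ)) x‖ = _
      rw [D.apply_smul c f.2.2.1 x.2, norm_mul])

/-- The topology of `𝓢(U)`, generated by the seminorms `sup_U |D f|`. -/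
instance : TopologicalSpace (SchwartzSpace U) :=
  haveI : Nonempty (Monomial U) := ⟨⟨0, ⟨0, contDiffOn_const, by
    have h : IsSemialgebraic {z : ℂ | z = 0} := by
      have h1 : IsSemialgebraic {z : ℂ | 0 < z.re * z.re + z.im * z.im} :=
        .pos _ ((polynomialFunctions ℂ).add_mem
          ((polynomialFunctions ℂ).mul_mem (Algebra.subset_adjoin ⟨Complex.reLm, rfl⟩)
            (Algebra.subset_adjoin ⟨Complex.reLm, rfl⟩))
          ((polynomialFunctions ℂ).mul_mem (Algebra.subset_adjoin ⟨Complex.imLm, rfl⟩)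
            (Algebra.subset_adjoin ⟨Complex.imLm, rfl⟩)))
      convert h1.compl using 1
      ext z
      have := Complex.normSq_pos (z := z)
      rw [Complex.normSq_apply] at this
      simp [this]
    exact .inter _ _ (U.semialgebraic.preimage_linear (LinearMap.fst ℝ E ℂ))
      (h.preimage_linear (LinearMap.snd ℝ E ℂ))⟩, Fin.elim0⟩⟩
  (SeminormFamily.moduleFilterBasis (𝕜 := ℂ)
    (seminorm : SeminormFamily ℂ (SchwartzSpace U) (Monomial U))).topology

end SchwartzSpace

/-- Tempered generalized functions on `U`: continuous linear functionals on the space of Schwartz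
densities on `U`. A Schwartz density is written as `f dx` with `f ∈ 𝓢(U)` and `dx` a fixed Lebesgue
measure on the vector space `E`. -/
abbrev TemperedGeneralizedFunction (U : OpenSet E) : Type _ := SchwartzSpace U →L[ℂ] ℂ

variable [FiniteDimensional ℝ E]

lemma IsNashFunction.comp_linearEquiv {U : OpenSet E} {a : E → ℂ} (ha : IsNashFunction U a)
    (L : E ≃ₗ[ℝ] E) (hL : ∀ x, L x ∈ U.carrier ↔ x ∈ U.carrier) :
    IsNashFunction U (fun x => a (L x)) := by
  refine ⟨ha.1.comp L.toContinuousLinearEquiv.contDiff.contDiffOn fun x hx => (hL x).2 hx, ?_⟩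
  convert ha.2.preimage_linear (L.toLinearMap.prodMap (LinearMap.id : ℂ →ₗ[ℝ] ℂ)) using 1
  ext q
  simp [hL]

/-- The function part of the push-forward of the density `f dx` under an invertible linear map `L`
of `E` that preserves `U`: `L_* (f dx) = |det L|⁻¹ f(L⁻¹ y) dy`. -/
def pushforward {U : OpenSet E} (L : E ≃ₗ[ℝ] E) (hL : ∀ x, L x ∈ U.carrier ↔ x ∈ U.carrier)
    (f : SchwartzSpace U) : SchwartzSpace U :=
  ⟨fun y => ((|LinearMap.det (L : E →ₗ[ℝ] E)|⁻¹ : ℝ) : ℂ) * f (L.symm y), by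
    have hL' : ∀ x, L.symm x ∈ U.carrier ↔ x ∈ U.carrier := fun x => by
      rw [← hL (L.symm x), L.apply_symm_apply]
    have key : (fun y => f (L.symm y)) ∈ schwartzSubmodule U := by
      obtain ⟨h0, hs, hb⟩ := f.2
      refine ⟨fun x hx => h0 _ (mt (hL' x).1 hx),
        hs.comp L.symm.toContinuousLinearEquiv.contDiff.contDiffOn fun x hx => (hL' x).2 hx, ?_⟩
      rintro ⟨k, ⟨a, ha⟩, v⟩
      obtain ⟨C, hC⟩ := hb ⟨k, ⟨_, ha.comp_linearEquiv L hL⟩, fun i => L.symm (v i)⟩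
      refine ⟨C, fun x hx => ?_⟩
      have h1 := hC (L.symm x) ((hL' x).2 hx)
      have h2 := L.symm.toContinuousLinearEquiv.iteratedFDerivWithin_comp_right (f := f.1)
        (s := Set.univ) uniqueDiffOn_univ (x := x) (Set.mem_univ _) k
      simp only [Set.preimage_univ, iteratedFDerivWithin_univ] at h2
      simp only [Monomial.apply, L.apply_symm_apply] at h1 ⊢
      convert h1 using 3
      change iteratedFDeriv ℝ k ((f : E → ℂ) ∘ L.symm.toContinuousLinearEquiv) x v = _
      rw [h2]
      rfl
    exact (schwartzSubmodule U).smul_mem _ key⟩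

/-- The space of tempered generalized functions `T` on `U` with `T(h x) = χ(h) T(x)` for all `h` in
a group `H` that acts on `E` linearly, preserving `U`. The left-hand side is the pull-back of `T`
under `x ↦ h x`, whose value on a compactly supported smooth density is the value of `T` on its
push-forward. -/
def temperedEquivariant {H : Type*} [Group H] (U : OpenSet E) (ρ : H →* (E ≃ₗ[ℝ] E))
    (hρ : ∀ h x, ρ h x ∈ U.carrier ↔ x ∈ U.carrier) (χ : H →* ℂˣ) :
    Submodule ℂ (TemperedGeneralizedFunction U) where
  carrier := {T | ∀ h : H, ∀ f : SchwartzSpace U, HasCompactSupport (f : E → ℂ) →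
    tsupport (f : E → ℂ) ⊆ U.carrier → T (pushforward (ρ h) (hρ h) f) = (χ h : ℂ) * T f}
  zero_mem' := by intro h f _ _; simp
  add_mem' := by
    intro S T hS hT h f h1 h2
    simp [hS h f h1 h2, hT h f h1 h2, mul_add]
  smul_mem' := by
    intro c T hT h f h1 h2
    simp [hT h f h1 h2, mul_left_comm]

end Schwartz

end Nash

/-! ### The group `{1, τ} ⋉ GL₂(𝕂)` and its action on `GL₂(𝕂) × GL₂(𝕂)` -/

namespace GL2Pair

variable (K : Type*) [RCLike K]

/-- The ambient real vector space `gl₂(𝕂) × gl₂(𝕂)`. -/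
abbrev Ambient : Type _ := Matrix (Fin 2) (Fin 2) K × Matrix (Fin 2) (Fin 2) K

instance : FiniteDimensional ℝ (Ambient K) :=
  haveI : FiniteDimensional ℝ (Matrix (Fin 2) (Fin 2) K) :=
    inferInstanceAs (FiniteDimensional ℝ (Fin 2 → Fin 2 → K))
  Module.Finite.prod

/-- The automorphism `g ↦ g^{-τ}` (inverse transpose) of `GL₂(𝕂)`. -/
def invTranspose : MulAut (GL (Fin 2) K) where
  toFun g := ⟨(↑g⁻¹ : Matrix (Fin 2) (Fin 2) K)ᵀ, (g : Matrix (Fin 2) (Fin 2) K)ᵀ,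
    by rw [← Matrix.transpose_mul]; simp, by rw [← Matrix.transpose_mul]; simp⟩
  invFun g := ⟨(↑g⁻¹ : Matrix (Fin 2) (Fin 2) K)ᵀ, (g : Matrix (Fin 2) (Fin 2) K)ᵀ,
    by rw [← Matrix.transpose_mul]; simp, by rw [← Matrix.transpose_mul]; simp⟩
  left_inv g := by ext; rfl
  right_inv g := by ext; rfl
  map_mul' g h := by
    apply Units.ext
    change ((↑(g * h)⁻¹ : Matrix (Fin 2) (Fin 2) K))ᵀ
      = (↑g⁻¹ : Matrix (Fin 2) (Fin 2) K)ᵀ * (↑h⁻¹ : Matrix (Fin 2) (Fin 2) K)ᵀ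
    rw [← Matrix.transpose_mul, mul_inv_rev, Units.val_mul]

lemma invTranspose_mul_self : invTranspose K * invTranspose K = 1 := by
  ext g : 1
  exact (invTranspose K).left_inv g

/-- The homomorphism from `{1, τ}`, realized as `{1, -1} = ℤˣ`, to a group that sends `τ` to a given
involution. -/
def ofInvolution {A : Type*} [Group A] (a : A) (ha : a * a = 1) : ℤˣ →* A where
  toFun e := if e = 1 then 1 else a
  map_one' := by simp
  map_mul' e e' := by
    rcases Int.units_eq_one_or e with rfl | rfl <;> rcases Int.units_eq_one_or e' with rfl | rfl <;>
      simp [ha]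

/-- The semidirect product `{1, τ} ⋉ GL₂(𝕂)`, where `τ` acts by `g ↦ g^{-τ}`. -/
abbrev HTilde : Type _ :=
  GL (Fin 2) K ⋊[ofInvolution (invTranspose K) (invTranspose_mul_self K)] ℤˣ

/-- The element `τ`. -/
def tau : HTilde K := SemidirectProduct.inr (-1)

/-- The character that is trivial on `GL₂(𝕂)` and takes the value `-1` at `τ`. -/
def chi : HTilde K →* ℂˣ :=
  (Units.map (Int.castRingHom ℂ : ℤ →* ℂ)).comp SemidirectProduct.rightHom

/-- `(x, y) ↦ (g x g⁻¹, g y g⁻¹)`. -/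
def conj : GL (Fin 2) K →* (Ambient K ≃ₗ[ℝ] Ambient K) where
  toFun g :=
    { toFun := fun p => (g.1 * p.1 * (g⁻¹).1, g.1 * p.2 * (g⁻¹).1)
      invFun := fun p => ((g⁻¹).1 * p.1 * g.1, (g⁻¹).1 * p.2 * g.1)
      map_add' := fun p q => by simp [mul_add, add_mul]
      map_smul' := fun c p => by simp
      left_inv := fun p => by
        ext1 <;> simp only [mul_assoc, Units.inv_mul, mul_one, Units.inv_mul_cancel_left]
      right_inv := fun p => by
        ext1 <;> simp only [mul_assoc, Units.mul_inv, mul_one, Units.mul_inv_cancel_left] }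
  map_one' := by
    apply LinearEquiv.ext
    intro p
    simp
  map_mul' g h := by
    apply LinearEquiv.ext
    intro p
    change (_, _) = (_, _)
    simp [mul_assoc]

/-- `(x, y) ↦ (xᵀ, yᵀ)`. -/
def transpose : Ambient K ≃ₗ[ℝ] Ambient K where
  toFun p := (p.1ᵀ, p.2ᵀ)
  invFun p := (p.1ᵀ, p.2ᵀ)
  map_add' p q := by simp
  map_smul' c p := by simp
  left_inv p := by simp
  right_inv p := by simp

lemma transpose_mul_self : transpose K * transpose K = 1 := by
  apply LinearEquiv.ext
  intro p
  exact (transpose K).left_inv p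

/-- The action of `{1, τ} ⋉ GL₂(𝕂)` on `gl₂(𝕂) × gl₂(𝕂)`: elements of `GL₂(𝕂)` act by simultaneous
conjugation and `τ` by simultaneous transposition. -/
def action : HTilde K →* (Ambient K ≃ₗ[ℝ] Ambient K) :=
  SemidirectProduct.lift (conj K) (ofInvolution (transpose K) (transpose_mul_self K)) (by
    intro e
    rcases Int.units_eq_one_or e with rfl | rfl
    · ext1 g; simp
    · ext1 g
      apply LinearEquiv.ext
      intro p
      have h : (transpose K)⁻¹ = transpose K := rfl
      simp only [ofInvolution, MonoidHom.coe_comp, Function.comp_apply, MonoidHom.coe_mk,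
        OneHom.coe_mk, MulEquiv.coe_toMonoidHom, MulAut.conj_apply]
      rw [if_neg (by decide), if_neg (by decide), h]
      change ((↑g⁻¹ : Matrix (Fin 2) (Fin 2) K)ᵀ * p.1 * (g : Matrix (Fin 2) (Fin 2) K)ᵀ,
          (↑g⁻¹ : Matrix (Fin 2) (Fin 2) K)ᵀ * p.2 * (g : Matrix (Fin 2) (Fin 2) K)ᵀ)
        = (((g : Matrix (Fin 2) (Fin 2) K) * p.1ᵀ * (↑g⁻¹ : Matrix (Fin 2) (Fin 2) K))ᵀ,
          ((g : Matrix (Fin 2) (Fin 2) K) * p.2ᵀ * (↑g⁻¹ : Matrix (Fin 2) (Fin 2) K))ᵀ)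
      simp [mul_assoc])

lemma action_inl (g : GL (Fin 2) K) (p : Ambient K) :
    action K (SemidirectProduct.inl g) p
      = ((g : Matrix (Fin 2) (Fin 2) K) * p.1 * (↑g⁻¹ : Matrix (Fin 2) (Fin 2) K),
        (g : Matrix (Fin 2) (Fin 2) K) * p.2 * (↑g⁻¹ : Matrix (Fin 2) (Fin 2) K)) := by
  rw [action, SemidirectProduct.lift_inl]
  rfl

lemma action_tau (p : Ambient K) : action K (tau K) p = (p.1ᵀ, p.2ᵀ) := by
  rw [action, tau, SemidirectProduct.lift_inr]
  rfl

lemma chi_inl (g : GL (Fin 2) K) : chi K (SemidirectProduct.inl g) = 1 := by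
  simp [chi]

lemma chi_tau : chi K (tau K) = -1 := by
  apply Units.ext
  simp [chi, tau]

lemma polynomial_det (q : Ambient K →ₗ[ℝ] Matrix (Fin 2) (Fin 2) K) :
    (fun p : Ambient K => RCLike.normSq (q p).det) ∈ Nash.polynomialFunctions (Ambient K) := by
  have hre : ∀ i j, (fun p : Ambient K => RCLike.re (q p i j))
      ∈ Nash.polynomialFunctions (Ambient K) := fun i j =>
    Algebra.subset_adjoin
      ⟨(RCLike.reLm : K →ₗ[ℝ] ℝ).comp ((Matrix.entryLinearMap ℝ K i j).comp q), rfl⟩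
  have him : ∀ i j, (fun p : Ambient K => RCLike.im (q p i j))
      ∈ Nash.polynomialFunctions (Ambient K) := fun i j =>
    Algebra.subset_adjoin
      ⟨(RCLike.imLm : K →ₗ[ℝ] ℝ).comp ((Matrix.entryLinearMap ℝ K i j).comp q), rfl⟩
  have h1 := sub_mem (sub_mem (mul_mem (hre 0 0) (hre 1 1)) (mul_mem (him 0 0) (him 1 1)))
    (sub_mem (mul_mem (hre 0 1) (hre 1 0)) (mul_mem (him 0 1) (him 1 0)))
  have h2 := sub_mem (add_mem (mul_mem (hre 0 0) (him 1 1)) (mul_mem (him 0 0) (hre 1 1)))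
    (add_mem (mul_mem (hre 0 1) (him 1 0)) (mul_mem (him 0 1) (hre 1 0)))
  convert add_mem (mul_mem h1 h1) (mul_mem h2 h2) using 1
  funext p
  simp [RCLike.normSq_apply, Matrix.det_fin_two]

lemma isSemialgebraic_det (q : Ambient K →ₗ[ℝ] Matrix (Fin 2) (Fin 2) K) :
    Nash.IsSemialgebraic {p : Ambient K | (q p).det ≠ 0} := by
  convert Nash.IsSemialgebraic.pos _ (polynomial_det K q) using 1
  ext p
  simp only [Set.mem_ofPred_eq]
  exact ⟨fun h => (RCLike.normSq_nonneg _).lt_of_ne fun h' => h (RCLike.normSq_eq_zero.1 h'.symm),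
    fun h h' => by simp [h'] at h⟩

/-- `GL₂(𝕂) × GL₂(𝕂)` as an open semialgebraic subset of `gl₂(𝕂) × gl₂(𝕂)`. -/
def M2 : Nash.OpenSet (Ambient K) where
  carrier := {p | p.1.det ≠ 0 ∧ p.2.det ≠ 0}
  isOpen := by
    refine IsOpen.and ?_ ?_
    · exact isOpen_ne_fun (Continuous.matrix_det continuous_fst) continuous_const
    · exact isOpen_ne_fun (Continuous.matrix_det continuous_snd) continuous_const
  semialgebraic := .inter _ _ (isSemialgebraic_det K (LinearMap.fst ℝ _ _))
    (isSemialgebraic_det K (LinearMap.snd ℝ _ _))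

lemma action_mem_M2_iff (h : HTilde K) (p : Ambient K) :
    action K h p ∈ (M2 K).carrier ↔ p ∈ (M2 K).carrier := by
  have key : ∀ (g : GL (Fin 2) K) (x : Matrix (Fin 2) (Fin 2) K),
      ((g : Matrix (Fin 2) (Fin 2) K) * x * (↑g⁻¹ : Matrix (Fin 2) (Fin 2) K)).det = x.det :=
    fun g x => Matrix.det_units_conj g x
  rw [← SemidirectProduct.inl_left_mul_inr_right h, map_mul, LinearEquiv.mul_apply, action_inl]
  rcases Int.units_eq_one_or h.right with e | e <;> rw [e]
  · simp only [M2, Set.mem_ofPred_eq, key, map_one, LinearEquiv.coe_one, id_eq]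
  · change (_ ∧ _) ↔ (_ ∧ _)
    simp only [key]
    rw [show (SemidirectProduct.inr (-1) : HTilde K) = tau K from rfl, action_tau]
    simp [Matrix.det_transpose]

end GL2Pair

end

/-! Subtract from `x` and `y` their scalar parts and write the hermitian and skew-hermitian parts of
what remains in the Pauli basis. This gives a real 3×4 matrix `V = pauli p`. Unitary matrices act on
`V` from the left by rotations (for `K = ℝ`, by those that come from O(2) and preserve the middle
axis), transposition acts by the reflection diag(1, -1, 1), and the scalar parts are invariant.

Test functions `F(V) ψ(|p|²) h(p)` suffice, where `F` is a polynomial, `ψ` a cutoff and `h` a smooth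
invariant weight supported away from singular matrices. Indeed a compactly supported function is a
limit of polynomials times one fixed `ψ(|p|²) h(p)` (`exists_complexPowers_approx`), and polynomials
in the scalar parts can be absorbed into `h` (`pair_complexPowers_eq_zero`). Pairings with these
functions vanish by induction on the degree of `F` (`pair_polynomial_eq_zero`), by two mechanisms.

Compact symmetry. By polarization `F` may be taken to be `(tr N)^k` with `N = V cᵀ` for a constant
matrix `c`. Averaging over the unitary group and antisymmetrizing under transposition only doubles
the pairing, and it produces a polynomial `Φ(N)` that vanishes whenever `N` is fixed by an element
of the nontrivial coset (`exists_odd_average`). Every singular `N` is fixed in this way, by the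
reflection along a vector of its left kernel (`exists_unitary_fixing`), so `Φ` is divisible by `det
N` (`exists_det_factor`). By Cauchy-Binet `det (V cᵀ)` lies in the ideal generated by the three
components of `v₁ × v₂ + v₃ × v₄`, the `vᵢ` being the columns of `V` (`det_mul_transpose`).

Noncompact symmetry. Up to the factor 16, these components are the derivatives of `|p|²` along the
vector fields `p ↦ [σⱼ, p]` (`moment_sigma`). Differentiating the invariance of `T` on `F Ψ(|p|²)
h`, where `Ψ' = ψ`, trades the component times `F ψ h` for a polynomial of degree at most `deg F`
times `Ψ h` (`pair_crossSum_eq_zero`). After division by the determinant the cofactors of the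
components have degree at most `deg Φ - 2`, so the induction hypothesis applies to them.

Finally, temperedness makes compactly supported densities sufficient: cutoffs `χ n` with `χ n f → f`
in the Schwartz topology exist because Nash weights absorb the growth of their derivatives
(`eq_zero_of_pair_eq_zero`). -/

namespace Nash

/-! ### Pairing of tempered generalized functions with compactly supported functions -/

section Pairing

variable {E : Type*} [NormedAddCommGroup E] [NormedSpace ℝ E] {U : OpenSet E}

/-- Compactly supported smooth functions on `U`, extended by zero. -/
structure IsTest (U : OpenSet E) (g : E → ℂ) : Prop where
  contDiff : ContDiff ℝ ∞ g
  compact : HasCompactSupport g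
  subset : tsupport g ⊆ U.carrier

lemma IsTest.of_tsupport_subset {g : E → ℂ} (hg : ContDiff ℝ ∞ g) {S : Set E} (hS : IsCompact S)
    (hSU : S ⊆ U.carrier) (h : tsupport g ⊆ S) : IsTest U g :=
  ⟨hg, hS.of_isClosed_subset (isClosed_tsupport g) h, h.trans hSU⟩

lemma IsTest.add {f g : E → ℂ} (hf : IsTest U f) (hg : IsTest U g) :
    IsTest U (fun x => f x + g x) :=
  ⟨hf.contDiff.add hg.contDiff, hf.compact.add hg.compact,
    (tsupport_add f g).trans (Set.union_subset hf.subset hg.subset)⟩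

lemma IsTest.mul_left {g : E → ℂ} (hg : IsTest U g) {a : E → ℂ} (ha : ContDiff ℝ ∞ a) :
    IsTest U (fun x => a x * g x) :=
  ⟨ha.mul hg.contDiff, hg.compact.mul_left, (tsupport_mul_subset_right (f := a)).trans hg.subset⟩

lemma IsTest.const_mul {g : E → ℂ} (hg : IsTest U g) (c : ℂ) : IsTest U (fun x => c * g x) :=
  hg.mul_left contDiff_const

lemma IsTest.zero : IsTest U (fun _ => 0) :=
  ⟨contDiff_const, HasCompactSupport.zero, by
    rw [show tsupport (fun _ : E => (0 : ℂ)) = ∅ from tsupport_eq_empty_iff.2 rfl]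
    exact Set.empty_subset _⟩

lemma IsTest.sum {ι : Type*} (s : Finset ι) {f : ι → E → ℂ} (h : ∀ i ∈ s, IsTest U (f i)) :
    IsTest U (fun x => ∑ i ∈ s, f i x) := by
  classical
  induction s using Finset.induction_on with
  | empty => simpa using IsTest.zero
  | insert i s hi ih =>
    simp only [Finset.sum_insert hi]
    exact (h i (by simp)).add (ih fun j hj => h j (by simp [hj]))

lemma IsTest.mem_schwartz {g : E → ℂ} (hg : IsTest U g) : g ∈ schwartzSubmodule U := by
  refine ⟨fun x hx => image_eq_zero_of_notMem_tsupport fun h => hx (hg.subset h),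
    hg.contDiff.contDiffOn, fun D => ?_⟩
  have hc : ContinuousOn (fun x => D.apply g x) (tsupport g) := by
    refine (D.2.1.2.1.continuousOn.mono hg.subset).mul ?_
    have h := hg.contDiff.continuous_iteratedFDeriv (m := D.1) (by exact_mod_cast le_top)
    exact ((ContinuousMultilinearMap.apply ℝ (fun _ : Fin D.1 => E) ℂ D.2.2).continuous.comp
      h).continuousOn
  obtain ⟨C, hC⟩ := (hg.compact : IsCompact (tsupport g)).exists_bound_of_continuousOn hc
  refine ⟨max C 0, fun x _ => ?_⟩
  by_cases hx : x ∈ tsupport g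
  · exact (hC x hx).trans (le_max_left _ _)
  · have : iteratedFDeriv ℝ D.1 g x = 0 := by
      by_contra h
      exact hx (support_iteratedFDeriv_subset D.1 h)
    simp [Monomial.apply, this]

/-- A compactly supported smooth function as a Schwartz function. -/
noncomputable def IsTest.toSchwartz {g : E → ℂ} (hg : IsTest U g) : SchwartzSpace U :=
  ⟨g, hg.mem_schwartz⟩

open Classical in
/-- The value of `T` on `g dx`; zero if `g` is not smooth and compactly supported in `U`. -/
noncomputable def pair (T : TemperedGeneralizedFunction U) (g : E → ℂ) : ℂ :=
  if h : IsTest U g then T h.toSchwartz else 0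

variable (T : TemperedGeneralizedFunction U)

lemma pair_eq {g : E → ℂ} (hg : IsTest U g) : pair T g = T hg.toSchwartz := dif_pos hg

lemma pair_add {f g : E → ℂ} (hf : IsTest U f) (hg : IsTest U g) :
    pair T (fun x => f x + g x) = pair T f + pair T g := by
  rw [pair_eq T hf, pair_eq T hg, pair_eq T (hf.add hg), ← map_add]
  rfl

lemma pair_const_mul {g : E → ℂ} (hg : IsTest U g) (c : ℂ) :
    pair T (fun x => c * g x) = c * pair T g := by
  rw [pair_eq T hg, pair_eq T (hg.const_mul c), ← smul_eq_mul, ← map_smul]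
  rfl

lemma pair_zero : pair T (fun _ => 0) = 0 := by
  have := pair_const_mul T (IsTest.zero (U := U)) 0
  simpa using this

lemma pair_sub {f g : E → ℂ} (hf : IsTest U f) (hg : IsTest U g) :
    pair T (fun x => f x - g x) = pair T f - pair T g := by
  have h := pair_add T hf (hg.const_mul (-1))
  rw [pair_const_mul T hg] at h
  have e : (fun x => f x - g x) = fun x => f x + -1 * g x := by ext; ring
  rw [e, h]; ring

lemma pair_sum {ι : Type*} (s : Finset ι) {f : ι → E → ℂ} (h : ∀ i ∈ s, IsTest U (f i)) :
    pair T (fun x => ∑ i ∈ s, f i x) = ∑ i ∈ s, pair T (f i) := by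
  classical
  induction s using Finset.induction_on with
  | empty => simpa using pair_zero T
  | insert i s hi ih =>
    simp only [Finset.sum_insert hi]
    rw [pair_add T (h i (by simp)) (.sum s fun j hj => h j (by simp [hj])),
      ih fun j hj => h j (by simp [hj])]

lemma SchwartzSpace.withSeminorms [Nonempty (Monomial U)] :
    WithSeminorms (SchwartzSpace.seminorm : SeminormFamily ℂ (SchwartzSpace U) (Monomial U)) :=
  ⟨rfl⟩

lemma nonempty_monomial : Nonempty (Monomial U) := by
  refine ⟨⟨0, ⟨0, contDiffOn_const, ?_⟩, Fin.elim0⟩⟩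
  have h1 : IsSemialgebraic {z : ℂ | 0 < z.re * z.re + z.im * z.im} :=
    .pos _ ((polynomialFunctions ℂ).add_mem
      ((polynomialFunctions ℂ).mul_mem (Algebra.subset_adjoin ⟨Complex.reLm, rfl⟩)
        (Algebra.subset_adjoin ⟨Complex.reLm, rfl⟩))
      ((polynomialFunctions ℂ).mul_mem (Algebra.subset_adjoin ⟨Complex.imLm, rfl⟩)
        (Algebra.subset_adjoin ⟨Complex.imLm, rfl⟩)))
  convert IsSemialgebraic.inter _ _ (U.semialgebraic.preimage_linear (LinearMap.fst ℝ E ℂ))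
    (h1.compl.preimage_linear (LinearMap.snd ℝ E ℂ)) using 1
  ext q
  have := Complex.normSq_pos (z := q.2)
  rw [Complex.normSq_apply] at this
  simp [this]

/-- A tempered generalized function is bounded by finitely many of the seminorms `sup_U |D f|`. -/
lemma exists_seminorm_bound : ∃ s : Finset (Monomial U), ∃ C : ℝ, 0 ≤ C ∧
    ∀ f : SchwartzSpace U, ∀ B : ℝ, 0 ≤ B →
      (∀ D ∈ s, ∀ x ∈ U.carrier, ‖D.apply f x‖ ≤ B) → ‖T f‖ ≤ C * B := by
  have := nonempty_monomial (U := U)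
  obtain ⟨s, C, -, hC⟩ := Seminorm.bound_of_continuous SchwartzSpace.withSeminorms
    ((normSeminorm ℂ ℂ).comp (T : SchwartzSpace U →ₗ[ℂ] ℂ)) (continuous_norm.comp T.continuous)
  refine ⟨s, C, C.2, fun f B hB h => (hC f).trans ?_⟩
  rw [smul_apply, NNReal.smul_def, smul_eq_mul]
  refine mul_le_mul_of_nonneg_left (Seminorm.finset_sup_apply_le hB fun D hD => ?_) C.2
  exact Real.iSup_le (fun x => h D hD x x.2) hB

/-- A tempered generalized function has finite order on compact sets. -/
lemma exists_pair_bound {S : Set E} (hS : IsCompact S) (hSU : S ⊆ U.carrier) :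
    ∃ C : ℝ, 0 ≤ C ∧ ∃ m : ℕ, ∀ g : E → ℂ, ContDiff ℝ ∞ g → tsupport g ⊆ S → ∀ B : ℝ, 0 ≤ B →
      (∀ j ≤ m, ∀ x ∈ S, ‖iteratedFDeriv ℝ j g x‖ ≤ B) → ‖pair T g‖ ≤ C * B := by
  obtain ⟨s, C, hC, h⟩ := exists_seminorm_bound T
  have hb : ∀ D : Monomial U, ∃ A : ℝ, 0 ≤ A ∧ ∀ x ∈ S, ‖D.2.1.1 x‖ * ∏ i, ‖D.2.2 i‖ ≤ A := by
    intro D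
    obtain ⟨A, hA⟩ := hS.exists_bound_of_continuousOn (D.2.1.2.1.continuousOn.mono hSU)
    refine ⟨max A 0 * ∏ i, ‖D.2.2 i‖, by positivity, fun x hx => ?_⟩
    gcongr
    exact (hA x hx).trans (le_max_left _ _)
  choose A hA0 hA using hb
  refine ⟨C * ∑ D ∈ s, A D, mul_nonneg hC (Finset.sum_nonneg fun D _ => hA0 D), s.sup Sigma.fst,
    fun g hg hgS B hB hgB => ?_⟩
  have ht : IsTest U g := .of_tsupport_subset hg hS hSU hgS
  rw [pair_eq T ht, mul_assoc]
  refine h _ _ (mul_nonneg (Finset.sum_nonneg fun D _ => hA0 D) hB) fun D hD x _ => ?_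
  change ‖D.apply g x‖ ≤ _
  have hle : A D ≤ ∑ D ∈ s, A D := Finset.single_le_sum (fun D _ => hA0 D) hD
  refine le_trans ?_ (mul_le_mul_of_nonneg_right hle hB)
  by_cases hx : x ∈ S
  · rw [Monomial.apply, norm_mul]
    calc ‖D.2.1.1 x‖ * ‖iteratedFDeriv ℝ D.1 g x D.2.2‖
        ≤ ‖D.2.1.1 x‖ * (‖iteratedFDeriv ℝ D.1 g x‖ * ∏ i, ‖D.2.2 i‖) := by
          gcongr; exact ContinuousMultilinearMap.le_opNorm _ _
      _ = (‖D.2.1.1 x‖ * ∏ i, ‖D.2.2 i‖) * ‖iteratedFDeriv ℝ D.1 g x‖ := by ring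
      _ ≤ A D * B := by
          gcongr
          · exact hA0 D
          · exact hA D x hx
          · exact hgB D.1 (Finset.le_sup (f := Sigma.fst) hD) x hx
  · have : iteratedFDeriv ℝ D.1 g x = 0 := by
      by_contra h
      exact hx (hgS (support_iteratedFDeriv_subset D.1 h))
    simp only [Monomial.apply, this]
    simpa using mul_nonneg (hA0 D) hB

end Pairing

end Nash

namespace Nash

/-! ### Differentiation with respect to a parameter -/

section Parameter

/-- Each inductive step is the symmetry of the second derivative of `iteratedFDeriv ℝ j Q`. With `e
= (1, 0)` this lets a derivative in the parameter pass through derivatives in the space variable. -/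
lemma fderiv_iteratedFDeriv_apply {X F : Type*} [NormedAddCommGroup X] [NormedSpace ℝ X]
    [NormedAddCommGroup F] [NormedSpace ℝ F] {Q : X → F} (hQ : ContDiff ℝ ∞ Q) (e : X) (j : ℕ) :
    ∀ q, fderiv ℝ (iteratedFDeriv ℝ j Q) q e = iteratedFDeriv ℝ j (fun q => fderiv ℝ Q q e) q := by
  induction j with
  | zero =>
    intro q
    ext V
    have h : iteratedFDeriv ℝ 0 Q
        = (continuousMultilinearCurryFin0 ℝ X F).symm.toContinuousLinearEquiv ∘ Q := rfl
    rw [h, ContinuousLinearEquiv.comp_fderiv]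
    rfl
  | succ j ih =>
    intro q
    ext V
    have hs : ContDiff ℝ ∞ (iteratedFDeriv ℝ j Q) :=
      hQ.iteratedFDeriv_right (m := ∞) (by exact_mod_cast le_top)
    have hd : Differentiable ℝ (fderiv ℝ (iteratedFDeriv ℝ j Q)) :=
      (hs.fderiv_right (m := ∞) (by exact_mod_cast le_top)).differentiable (by simp)
    have hd' : DifferentiableAt ℝ (iteratedFDeriv ℝ (j + 1) Q) q :=
      (hQ.iteratedFDeriv_right (m := ∞) (i := j + 1) (by exact_mod_cast le_top)).differentiable
        (by simp) q
    have hsym : IsSymmSndFDerivAt ℝ (iteratedFDeriv ℝ j Q) q :=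
      hs.contDiffAt.isSymmSndFDerivAt (by
        rw [minSmoothness_of_isRCLikeNormedField]
        exact WithTop.coe_le_coe.2 (le_top : (2 : ℕ∞) ≤ ⊤))
    have e1 : fderiv ℝ (iteratedFDeriv ℝ (j + 1) Q) q e V
        = fderiv ℝ (fun q => iteratedFDeriv ℝ (j + 1) Q q V) q e := by
      have := ((ContinuousMultilinearMap.apply ℝ (fun _ : Fin (j + 1) => X) F V).hasFDerivAt.comp q
        hd'.hasFDerivAt).fderiv
      rw [show (fun q => iteratedFDeriv ℝ (j + 1) Q q V) =
        (ContinuousMultilinearMap.apply ℝ (fun _ : Fin (j + 1) => X) F V) ∘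
          iteratedFDeriv ℝ (j + 1) Q from rfl, this]
      rfl
    have e2 : fderiv ℝ (fun q => iteratedFDeriv ℝ (j + 1) Q q V) q e
        = fderiv ℝ (fderiv ℝ (iteratedFDeriv ℝ j Q)) q e (V 0) (Fin.tail V) := by
      have h2 : HasFDerivAt (fun q => fderiv ℝ (iteratedFDeriv ℝ j Q) q (V 0)) _ q :=
        (hd q).hasFDerivAt.clm_apply (hasFDerivAt_const (V 0) q)
      have := ((ContinuousMultilinearMap.apply ℝ (fun _ : Fin j => X) F
        (Fin.tail V)).hasFDerivAt.comp q h2).fderiv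
      rw [show (fun q => iteratedFDeriv ℝ (j + 1) Q q V) =
        (ContinuousMultilinearMap.apply ℝ (fun _ : Fin j => X) F (Fin.tail V)) ∘
          fun q => fderiv ℝ (iteratedFDeriv ℝ j Q) q (V 0) from rfl, this]
      simp
    rw [e1, e2, hsym e (V 0), iteratedFDeriv_succ_apply_left]
    rw [← funext ih]
    have h2 : HasFDerivAt (fun q => fderiv ℝ (iteratedFDeriv ℝ j Q) q e) _ q :=
      (hd q).hasFDerivAt.clm_apply (hasFDerivAt_const e q)
    rw [h2.fderiv]
    simp

variable {E : Type*} [NormedAddCommGroup E] [NormedSpace ℝ E] {U : OpenSet E}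

lemma iteratedFDeriv_slice {Q : ℝ × E → ℂ} (hQ : ContDiff ℝ ∞ Q) (j : ℕ) (t : ℝ) (x : E)
    (V : Fin j → E) : iteratedFDeriv ℝ j (fun y => Q (t, y)) x V
      = iteratedFDeriv ℝ j Q (t, x) (fun i => (0, V i)) := by
  have h : (fun y => Q (t, y))
      = (fun q => Q ((t, (0 : E)) + q)) ∘ ContinuousLinearMap.inr ℝ ℝ E := by
    funext y; simp
  have hQ' : ContDiff ℝ ∞ (fun q => Q ((t, (0 : E)) + q)) :=
    hQ.comp (contDiff_const.add contDiff_id)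
  rw [h, ContinuousLinearMap.iteratedFDeriv_comp_right _ hQ' x (by exact_mod_cast le_top),
    iteratedFDeriv_comp_add_left]
  simp only [ContinuousMultilinearMap.compContinuousLinearMap_apply,
    ContinuousLinearMap.inr_apply, Prod.mk_add_mk, add_zero, zero_add]

lemma hasDerivAt_iteratedFDeriv_slice {Q : ℝ × E → ℂ} (hQ : ContDiff ℝ ∞ Q) (j : ℕ) (t : ℝ)
    (x : E) (V : Fin j → E) :
    HasDerivAt (fun s => iteratedFDeriv ℝ j (fun y => Q (s, y)) x V)
      (iteratedFDeriv ℝ j (fun y => fderiv ℝ Q (t, y) (1, 0)) x V) t := by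
  have hd : ContDiff ℝ ∞ (fun q => fderiv ℝ Q q (1, 0)) :=
    (hQ.fderiv_right (m := ∞) (by exact_mod_cast le_top)).clm_apply contDiff_const
  simp only [iteratedFDeriv_slice hQ]
  rw [iteratedFDeriv_slice hd, ← fderiv_iteratedFDeriv_apply hQ]
  have h1 : HasDerivAt (fun s : ℝ => (s, x)) (1, 0) t :=
    (hasDerivAt_id t).prodMk (hasDerivAt_const t x)
  have h2 := ((hQ.iteratedFDeriv_right (m := ∞) (i := j) (by exact_mod_cast le_top)).differentiable
    (by simp) (t, x)).hasFDerivAt.comp_hasDerivAt t h1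
  exact (ContinuousMultilinearMap.apply ℝ (fun _ : Fin j => ℝ × E) ℂ
    fun i => (0, V i)).hasFDerivAt.comp_hasDerivAt t h2

/-- The mean value inequality is applied twice on the interval of radius `|t|`. The factor 1/2 of
Taylor's formula is lost, which is harmless. -/
lemma norm_le_sq_of_hasDerivAt {f f' f'' : ℝ → ℂ} {M : ℝ} (h0 : f 0 = 0) (h0' : f' 0 = 0)
    (hf : ∀ t, HasDerivAt f (f' t) t) (hf' : ∀ t, HasDerivAt f' (f'' t) t)
    (hM : ∀ t, |t| ≤ 1 → ‖f'' t‖ ≤ M) {t : ℝ} (ht : |t| ≤ 1) : ‖f t‖ ≤ M * t ^ 2 := by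
  have conv : Convex ℝ (Metric.closedBall (0 : ℝ) |t|) := convex_closedBall _ _
  have m0 : (0 : ℝ) ∈ Metric.closedBall (0 : ℝ) |t| := by simp
  have mt : t ∈ Metric.closedBall (0 : ℝ) |t| := by simp
  have h1 : ∀ s ∈ Metric.closedBall (0 : ℝ) |t|, ‖f' s‖ ≤ M * |t| := by
    intro s hs
    have hs' : |s| ≤ |t| := by simpa using hs
    have := conv.norm_image_sub_le_of_norm_hasDerivWithin_le (f := f') (f' := f'') (C := M)
      (fun x _ => (hf' x).hasDerivWithinAt)
      (fun x hx => hM x ((by simpa using hx : |x| ≤ |t|).trans ht)) m0 hs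
    rw [h0', sub_zero, sub_zero] at this
    refine this.trans (mul_le_mul_of_nonneg_left hs' ?_)
    exact (norm_nonneg _).trans (hM 0 (by simp))
  have := conv.norm_image_sub_le_of_norm_hasDerivWithin_le (f := f) (f' := f') (C := M * |t|)
      (fun x _ => (hf x).hasDerivWithinAt) h1 m0 mt
  rw [h0, sub_zero, sub_zero, Real.norm_eq_abs] at this
  rwa [mul_assoc, abs_mul_abs_self, ← sq] at this

/-- If `⟨T, H(t, ·)⟩` does not depend on `t`, then `⟨T, ∂ₜH(0, ·)⟩ = 0`. -/
lemma pair_deriv_eq_zero (T : TemperedGeneralizedFunction U) {S : Set E} (hS : IsCompact S)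
    (hSU : S ⊆ U.carrier) {H : ℝ × E → ℂ} (hH : ContDiff ℝ ∞ H)
    (hsupp : ∀ t, |t| ≤ 1 → ∀ x, x ∉ S → H (t, x) = 0)
    (hT : ∀ t, |t| ≤ 1 → pair T (fun x => H (t, x)) = pair T (fun x => H (0, x))) :
    pair T (fun x => fderiv ℝ H (0, x) (1, 0)) = 0 := by
  have sub : ∀ {g : E → ℂ}, (∀ x, x ∉ S → g x = 0) → tsupport g ⊆ S := fun h =>
    closure_minimal (fun x hx => by_contra fun hx' => hx (h x hx')) hS.isClosed
  have hGs : ContDiff ℝ ∞ (fun q => fderiv ℝ H q (1, 0)) :=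
    (hH.fderiv_right (m := ∞) (by exact_mod_cast le_top)).clm_apply contDiff_const
  set G : E → ℂ := fun x => fderiv ℝ H (0, x) (1, 0) with hG
  have hG1 : ContDiff ℝ ∞ G := hGs.comp (contDiff_const.prodMk contDiff_id)
  have der : ∀ {Q : ℝ × E → ℂ}, ContDiff ℝ ∞ Q → ∀ t x,
      HasDerivAt (fun s => Q (s, x)) (fderiv ℝ Q (t, x) (1, 0)) t := fun hQ t x =>
    (hQ.differentiable (by simp) (t, x)).hasFDerivAt.comp_hasDerivAt t
      ((hasDerivAt_id t).prodMk (hasDerivAt_const t x))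
  have hG0 : ∀ x, x ∉ S → G x = 0 := by
    intro x hx
    refine (der hH 0 x).unique ?_
    refine (hasDerivAt_const (0 : ℝ) (0 : ℂ)).congr_of_eventuallyEq ?_
    filter_upwards [Metric.closedBall_mem_nhds (0 : ℝ) one_pos] with t ht
    exact hsupp t (by simpa using ht) x hx
  -- The first-order Taylor remainder in `t`. Its derivatives in `x` are `O(t²)` uniformly on `S`,
  -- and `T` has finite order there, so its pairing is `O(t²)`. By constancy of the pairing of `H`
  -- it also equals `-t ⟨T, G⟩`, hence `⟨T, G⟩ = 0`.
  set Q : ℝ × E → ℂ := fun q => H q - H (0, q.2) - q.1 * G q.2 with hQdef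
  have hQ : ContDiff ℝ ∞ Q := by
    refine (hH.sub (hH.comp (contDiff_const.prodMk contDiff_snd))).sub
      (ContDiff.mul ?_ (hG1.comp contDiff_snd))
    exact Complex.ofRealCLM.contDiff.comp contDiff_fst
  have hQ1 : ContDiff ℝ ∞ (fun q => fderiv ℝ Q q (1, 0)) :=
    (hQ.fderiv_right (m := ∞) (by exact_mod_cast le_top)).clm_apply contDiff_const
  have hQ2 : ContDiff ℝ ∞ (fun q => fderiv ℝ (fun q => fderiv ℝ Q q (1, 0)) q (1, 0)) :=
    (hQ1.fderiv_right (m := ∞) (by exact_mod_cast le_top)).clm_apply contDiff_const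
  have hQ00 : (fun y => Q (0, y)) = fun _ => 0 := by funext y; simp [hQdef]
  have hQ10 : (fun y => fderiv ℝ Q (0, y) (1, 0)) = fun _ => 0 := by
    funext y
    refine (der hQ 0 y).unique ?_
    have h1 := ((der hH 0 y).sub_const (H (0, y))).sub
      ((hasDerivAt_id (0 : ℝ)).ofReal_comp.mul_const (G y))
    exact HasDerivAt.congr_deriv (f := fun s => Q (s, y)) h1 (by simp [hG])
  have test : ∀ {g : E → ℂ}, ContDiff ℝ ∞ g → (∀ x, x ∉ S → g x = 0) → IsTest U g :=
    fun h1 h2 => .of_tsupport_subset h1 hS hSU (sub h2)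
  have hHt : ∀ t, |t| ≤ 1 → IsTest U (fun x => H (t, x)) := fun t ht =>
    test (hH.comp (contDiff_const.prodMk contDiff_id)) (hsupp t ht)
  obtain ⟨C, hC, m, hb⟩ := exists_pair_bound T hS hSU
  have hM : ∀ j : ℕ, ∃ M : ℝ, 0 ≤ M ∧ ∀ t, |t| ≤ 1 → ∀ x ∈ S,
      ‖iteratedFDeriv ℝ j (fun q => fderiv ℝ (fun q => fderiv ℝ Q q (1, 0)) q (1, 0)) (t, x)‖
        ≤ M := by
    intro j
    have hK : IsCompact (Metric.closedBall (0 : ℝ) 1 ×ˢ S) := (isCompact_closedBall _ _).prod hS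
    obtain ⟨M, hM⟩ := hK.exists_bound_of_continuousOn
      (hQ2.continuous_iteratedFDeriv (m := j) (by exact_mod_cast le_top)).continuousOn
    exact ⟨max M 0, le_max_right _ _, fun t ht x hx =>
      (hM (t, x) ⟨by simpa using ht, hx⟩).trans (le_max_left _ _)⟩
  choose M hM0 hM using hM
  set M' := ∑ j ∈ Finset.range (m + 1), M j
  have hM'0 : 0 ≤ M' := Finset.sum_nonneg fun j _ => hM0 j
  have key : ∀ t, |t| ≤ 1 → |t| * ‖pair T G‖ ≤ C * M' * t ^ 2 := by
    intro t ht
    have e1 : pair T (fun x => Q (t, x)) = -(t * pair T G) := by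
      have h1 := pair_sub T (hHt t ht) (hHt 0 (by simp))
      have ht0 : IsTest U (fun x => H (t, x) - H (0, x)) :=
        test ((hHt t ht).contDiff.sub (hHt 0 (by simp)).contDiff) fun x hx => by
          simp [hsupp t ht x hx, hsupp 0 (by simp) x hx]
      have hGt := test hG1 hG0
      have h2 := pair_sub T ht0 (hGt.const_mul t)
      rw [h1, hT t ht, sub_self, pair_const_mul T hGt] at h2
      simpa [hQdef] using h2
    have e2 : ‖pair T (fun x => Q (t, x))‖ ≤ C * (M' * t ^ 2) := by
      refine hb _ (hQ.comp (contDiff_const.prodMk contDiff_id)) (sub fun x hx => ?_) _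
        (by positivity) fun j hj x hx => ?_
      · simp [hQdef, hsupp t ht x hx, hsupp 0 (by simp) x hx, hG0 x hx]
      · have hle : M j ≤ M' := Finset.single_le_sum (fun j _ => hM0 j) (by simp; omega)
        refine le_trans ?_ (mul_le_mul_of_nonneg_right hle (sq_nonneg t))
        refine ContinuousMultilinearMap.opNorm_le_bound (mul_nonneg (hM0 j) (sq_nonneg t)) fun V => ?_
        have := norm_le_sq_of_hasDerivAt (M := M j * ∏ i, ‖V i‖)
          (f := fun s => iteratedFDeriv ℝ j (fun y => Q (s, y)) x V)
          (by simp [hQ00]) (by simp [hQ10])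
          (fun t => hasDerivAt_iteratedFDeriv_slice hQ j t x V)
          (fun t => hasDerivAt_iteratedFDeriv_slice hQ1 j t x V) (fun s hs => by
            rw [iteratedFDeriv_slice hQ2]
            refine (ContinuousMultilinearMap.le_opNorm _ _).trans ?_
            have : ∀ i, ‖((0 : ℝ), V i)‖ = ‖V i‖ := fun i => by simp
            simp only [this]
            gcongr
            exact hM j s hs x hx) ht
        calc _ ≤ _ := this
          _ = _ := by ring
    rw [e1, norm_neg, norm_mul, Complex.norm_real, Real.norm_eq_abs] at e2
    linarith
  by_contra hne
  have hp : 0 < ‖pair T G‖ := norm_pos_iff.2 hne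
  set K := C * M'
  have hK : 0 ≤ K := mul_nonneg hC hM'0
  -- Small enough that `‖pair T G‖ ≤ K t` is contradictory.
  set t : ℝ := min 1 (‖pair T G‖ / (2 * (K + 1)))
  have ht0 : 0 < t := lt_min one_pos (by positivity)
  have ht1 : |t| ≤ 1 := by rw [abs_of_pos ht0]; exact min_le_left _ _
  have h := key t ht1
  rw [abs_of_pos ht0, sq, ← mul_assoc, mul_comm t, mul_le_mul_iff_left₀ ht0] at h
  have ht2 : t ≤ ‖pair T G‖ / (2 * (K + 1)) := min_le_right _ _
  rw [le_div_iff₀ (by positivity)] at ht2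
  nlinarith

end Parameter

end Nash

namespace Nash

/-! ### Approximation by powers of linear functionals -/

section Approximation

open MeasureTheory ContinuousLinearMap
open scoped Convolution

variable (E : Type*) [NormedAddCommGroup E] [NormedSpace ℝ E]

/-- The span of the powers of real linear functionals. -/
def realPowers : Submodule ℝ (E → ℝ) :=
  Submodule.span ℝ (Set.range fun p : (E →L[ℝ] ℝ) × ℕ => fun x => p.1 x ^ p.2)

/-- The complex span of the powers of real linear functionals. -/
def complexPowers : Submodule ℂ (E → ℂ) :=
  Submodule.span ℂ (Set.range fun p : (E →L[ℝ] ℝ) × ℕ => fun x => ((p.1 x : ℝ) : ℂ) ^ p.2)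

variable {E}

lemma realPowers.continuous {q : E → ℝ} (hq : q ∈ realPowers E) : Continuous q := by
  induction hq using Submodule.span_induction with
  | mem q hq => obtain ⟨⟨l, n⟩, rfl⟩ := hq; fun_prop
  | zero => exact continuous_const
  | add f g _ _ hf hg => exact hf.add hg
  | smul c f _ hf => exact hf.const_smul c

lemma complexPowers.contDiff {q : E → ℂ} (hq : q ∈ complexPowers E) : ContDiff ℝ ∞ q := by
  induction hq using Submodule.span_induction with
  | mem q hq =>
    obtain ⟨⟨l, n⟩, rfl⟩ := hq
    exact (Complex.ofRealCLM.contDiff.comp l.contDiff).pow n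
  | zero => exact contDiff_const
  | add f g _ _ hf hg => exact hf.add hg
  | smul c f _ hf => exact hf.const_smul c

variable [FiniteDimensional ℝ E]

/-- The exponentials `exp l` are closed under multiplication and separate points, so their span is
an algebra to which Stone-Weierstrass applies. The exponential series puts each of them into the
closure of the span of the powers of `l`. Thus no product of powers of different functionals has to
be expanded. -/
lemma exists_realPowers_approx {κ : E → ℝ} (hκ : Continuous κ) (R : ℝ) {ε : ℝ} (hε : 0 < ε) :
    ∃ q ∈ realPowers E, ∀ x, ‖x‖ ≤ R → |q x - κ x| ≤ ε := by
  let K : Set E := Metric.closedBall 0 R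
  have : ProperSpace E := FiniteDimensional.proper_real E
  have : CompactSpace K := isCompact_iff_compactSpace.1 (isCompact_closedBall _ _)
  let r : (E →L[ℝ] ℝ) → C(K, ℝ) := fun l => ⟨fun x => l x, by fun_prop⟩
  let W : Submodule ℝ C(K, ℝ) := Submodule.span ℝ (Set.range fun p : (E →L[ℝ] ℝ) × ℕ => r p.1 ^ p.2)
  have hexp : ∀ l, NormedSpace.exp (r l) ∈ W.topologicalClosure := fun l => by
    have hs := NormedSpace.exp_series_hasSum_exp' (𝕂 := ℝ) (r l)
    exact W.isClosed_topologicalClosure.mem_of_tendsto hs (Filter.Eventually.of_forall fun s =>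
      Submodule.sum_mem _ fun n _ => Submodule.smul_mem _ _
        (W.le_topologicalClosure (Submodule.subset_span ⟨(l, n), rfl⟩)))
  have hev : ∀ l x, NormedSpace.exp (r l) x = Real.exp (l x) := fun l x => by
    have := NormedSpace.map_exp (ContinuousMap.evalAlgHom ℝ ℝ x)
      (continuous_eval_const x) (r l)
    rw [Real.exp_eq_exp_ℝ]
    exact this
  let M : Submonoid C(K, ℝ) :=
    { carrier := Set.range fun l => NormedSpace.exp (r l)
      one_mem' := ⟨0, by ext x; rw [hev]; simp⟩
      mul_mem' := by
        rintro _ _ ⟨l, rfl⟩ ⟨l', rfl⟩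
        refine ⟨l + l', ?_⟩
        ext x
        simp only [hev, ContinuousMap.mul_apply, add_apply, Real.exp_add] }
  let A : Subalgebra ℝ C(K, ℝ) := Algebra.adjoin ℝ M
  have hAW : ∀ f ∈ A, f ∈ W.topologicalClosure := by
    intro f hf
    have hf' : f ∈ Submodule.span ℝ (M : Set C(K, ℝ)) := by
      rw [← Submonoid.closure_eq M, ← Algebra.adjoin_eq_span]
      exact hf
    refine Submodule.span_le.2 ?_ hf'
    rintro _ ⟨l, rfl⟩
    exact hexp l
  have hA : A.topologicalClosure = ⊤ := by
    refine ContinuousMap.subalgebra_topologicalClosure_eq_top_of_separatesPoints A ?_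
    intro x y hxy
    obtain ⟨l, hl⟩ := SeparatingDual.exists_separating_of_ne (R := ℝ)
      (fun h => hxy (Subtype.ext h) : (x : E) ≠ y)
    refine ⟨_, ⟨NormedSpace.exp (r l), Algebra.subset_adjoin ⟨l, rfl⟩, rfl⟩, ?_⟩
    change NormedSpace.exp (r l) x ≠ NormedSpace.exp (r l) y
    rw [hev, hev]
    exact fun h => hl (Real.exp_injective h)
  let κ' : C(K, ℝ) := ⟨fun x => κ x, by fun_prop⟩
  have hmem : κ' ∈ closure (W : Set C(K, ℝ)) := by
    have h1 : κ' ∈ A.topologicalClosure := hA ▸ Algebra.mem_top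
    have h2 : closure (A : Set C(K, ℝ)) ⊆ W.topologicalClosure :=
      closure_minimal hAW W.isClosed_topologicalClosure
    exact h2 h1
  obtain ⟨w, hw, hd⟩ := Metric.mem_closure_iff.1 hmem ε hε
  have lift : ∀ w ∈ W, ∃ q ∈ realPowers E, ∀ x : K, q x = w x := by
    intro w hw
    induction hw using Submodule.span_induction with
    | mem q hq =>
      obtain ⟨⟨l, n⟩, rfl⟩ := hq
      exact ⟨_, Submodule.subset_span ⟨(l, n), rfl⟩, fun x => rfl⟩
    | zero => exact ⟨0, Submodule.zero_mem _, fun x => rfl⟩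
    | add f g _ _ hf hg =>
      obtain ⟨a, ha, ha'⟩ := hf
      obtain ⟨b, hb, hb'⟩ := hg
      exact ⟨a + b, Submodule.add_mem _ ha hb, fun x => by simp [ha', hb']⟩
    | smul c f _ hf =>
      obtain ⟨a, ha, ha'⟩ := hf
      exact ⟨c • a, Submodule.smul_mem _ c ha, fun x => by simp [ha']⟩
  obtain ⟨q, hq, hqw⟩ := lift w hw
  refine ⟨q, hq, fun x hx => ?_⟩
  have hxK : x ∈ K := by simpa [K] using hx
  have h1 := (ContinuousMap.dist_apply_le_dist (f := κ') (g := w) ⟨x, hxK⟩).trans hd.le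
  rw [dist_comm, Real.dist_eq, ← hqw] at h1
  exact h1

/-! ### Convolution with powers of linear functionals -/

section Convolution

variable [MeasurableSpace E] [BorelSpace E] (μ : Measure E) [μ.IsAddHaarMeasure]

/-- All derivatives fall on the compactly supported factor. Hence uniform approximation of a
mollifier by `q` already controls every derivative of the convolution. -/
lemma iteratedFDeriv_convolution {q : E → ℝ} (hq : Continuous q) {f : E → ℂ} (hf : ContDiff ℝ ∞ f)
    (hc : HasCompactSupport f) (j : ℕ) :
    iteratedFDeriv ℝ j (q ⋆[lsmul ℝ ℝ, μ] f) = q ⋆[lsmul ℝ ℝ, μ] iteratedFDeriv ℝ j f := by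
  have hl : LocallyIntegrable q μ := hq.locallyIntegrable
  induction j with
  | zero =>
    funext x
    ext V
    have : iteratedFDeriv ℝ 0 f
      = (continuousMultilinearCurryFin0 ℝ E ℂ).symm.toContinuousLinearEquiv ∘ f := rfl
    rw [this, iteratedFDeriv_zero_apply]
    simp only [convolution, lsmul_apply, Function.comp_apply]
    have h := ((continuousMultilinearCurryFin0 ℝ E ℂ).symm.toContinuousLinearEquiv).integral_comp_comm
      (μ := μ) (fun t => q t • f (x - t))
    simp only [map_smul] at h
    rw [h]
    rfl
  | succ j ih =>
    rw [iteratedFDeriv_succ_eq_comp_left, iteratedFDeriv_succ_eq_comp_left, ih]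
    have hs : ContDiff ℝ ∞ (iteratedFDeriv ℝ j f) :=
      hf.iteratedFDeriv_right (m := ∞) (by exact_mod_cast le_top)
    funext x
    have hcj : HasCompactSupport (iteratedFDeriv ℝ j f) := hc.iteratedFDeriv j
    have hd := (hcj.hasFDerivAt_convolution_right (lsmul ℝ ℝ) hl
      (hs.of_le (by exact_mod_cast le_top)) x (μ := μ)).fderiv
    simp only [Function.comp_apply]
    rw [hd]
    simp only [convolution]
    let c : (E →L[ℝ] E [×j]→L[ℝ] ℂ) ≃L[ℝ] (E [×(j + 1)]→L[ℝ] ℂ) :=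
      (continuousMultilinearCurryLeftEquiv ℝ (fun _ : Fin (j + 1) => E)
        ℂ).symm.toContinuousLinearEquiv
    have h := ContinuousLinearEquiv.integral_comp_comm (𝕜 := ℝ) (E := E →L[ℝ] E [×j]→L[ℝ] ℂ)
      (F := E [×(j + 1)]→L[ℝ] ℂ) (μ := μ) c
      (fun t => q t • fderiv ℝ (iteratedFDeriv ℝ j f) (x - t))
    simp only [map_smul] at h
    exact h.symm

/-- Approximate identities consisting of powers of linear functionals. -/
lemma exists_approximate_identity : ∃ q : ℕ → E → ℝ, (∀ n, q n ∈ realPowers E) ∧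
    ∀ {F : Type _} [NormedAddCommGroup F] [NormedSpace ℝ F] [CompleteSpace F] (g : E → F),
      Continuous g → HasCompactSupport g → ∀ R ε : ℝ, 0 < ε → ∃ N, ∀ n ≥ N, ∀ x, ‖x‖ ≤ R →
        ‖(q n ⋆[lsmul ℝ ℝ, μ] g) x - g x‖ ≤ ε := by
  let φ : ℕ → ContDiffBump (0 : E) := fun n =>
    ⟨1 / (2 * (n + 1 : ℝ)), 1 / (n + 1 : ℝ), by positivity, by
      apply one_div_lt_one_div_of_lt <;> linarith [(Nat.cast_nonneg n : (0 : ℝ) ≤ n)]⟩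
  have hφ : ∀ n, Continuous ((φ n).normed μ) := fun n => (φ n).continuous_normed
  -- `q n` is close to the bump of radius `1 / (n + 1)` only on the ball of radius `n`. This is
  -- enough: for `‖x‖ ≤ R` and `g` supported in the ball of radius `R₁`, the convolution at `x` only
  -- sees `‖t‖ ≤ R + R₁`.
  choose q hq hqφ using fun n : ℕ => exists_realPowers_approx (hφ n) n
    (by positivity : (0 : ℝ) < 1 / (n + 1))
  refine ⟨q, hq, fun g hg hc R ε hε => ?_⟩
  have hu := hc.uniformContinuous_of_continuous hg
  obtain ⟨δ, hδ, hu⟩ := Metric.uniformContinuous_iff.1 hu (ε / 2) (half_pos hε)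
  obtain ⟨R₁, hR₁⟩ := hc.isBounded.subset_closedBall (0 : E)
  have hI : Integrable (fun t => ‖g t‖) μ := (hg.integrable_of_hasCompactSupport hc).norm
  set I := ∫ t, ‖g t‖ ∂μ
  have hI0 : 0 ≤ I := integral_nonneg fun _ => norm_nonneg _
  obtain ⟨N₁, hN₁⟩ := exists_nat_gt (1 / δ)
  obtain ⟨N₂, hN₂⟩ := exists_nat_gt (R + R₁)
  obtain ⟨N₃, hN₃⟩ := exists_nat_gt (2 * I / ε)
  refine ⟨max N₁ (max N₂ N₃), fun n hn x hx => ?_⟩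
  have c1 : (N₁ : ℝ) ≤ n := by exact_mod_cast (le_max_left _ _).trans hn
  have c2 : (N₂ : ℝ) ≤ n := by
    exact_mod_cast ((le_max_left _ _).trans (le_max_right _ _)).trans hn
  have c3 : (N₃ : ℝ) ≤ n := by
    exact_mod_cast ((le_max_right _ _).trans (le_max_right _ _)).trans hn
  have h1 : ‖((φ n).normed μ ⋆[lsmul ℝ ℝ, μ] g) x - g x‖ ≤ ε / 2 := by
    rw [← dist_eq_norm]
    refine (φ n).dist_normed_convolution_le hg.aestronglyMeasurable fun y hy => (hu ?_).le
    refine (Metric.mem_ball.1 hy).trans_le ?_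
    change 1 / (n + 1 : ℝ) ≤ δ
    rw [div_le_iff₀ (by positivity)]
    rw [div_lt_iff₀ hδ] at hN₁
    nlinarith
  have hex : ∀ k : E → ℝ, Continuous k → Integrable (fun t => k t • g (x - t)) μ := fun k hk =>
    hc.convolutionExists_right (lsmul ℝ ℝ) hk.locallyIntegrable hg x
  have h2 : ‖(q n ⋆[lsmul ℝ ℝ, μ] g) x - ((φ n).normed μ ⋆[lsmul ℝ ℝ, μ] g) x‖ ≤ ε / 2 := by
    simp only [convolution, lsmul_apply]
    rw [← integral_sub (hex _ (realPowers.continuous (hq n))) (hex _ (hφ n))]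
    have hI' : Integrable (fun t => 1 / (n + 1 : ℝ) * ‖g (x - t)‖) μ :=
      (hI.comp_sub_left x).const_mul _
    refine (norm_integral_le_of_norm_le hI' (Filter.Eventually.of_forall fun t => ?_)).trans ?_
    · rw [← sub_smul, norm_smul]
      by_cases hg0 : g (x - t) = 0
      · simp [hg0]
      · refine mul_le_mul_of_nonneg_right (hqφ n t ?_) (norm_nonneg _)
        have h3 : ‖x - t‖ ≤ R₁ := by simpa using hR₁ (subset_tsupport g hg0)
        have h4 : ‖t‖ ≤ ‖x‖ + ‖x - t‖ := by
          simpa using norm_sub_le x (x - t)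
        linarith
    · rw [integral_const_mul, integral_sub_left_eq_self (fun t => ‖g t‖) μ x]
      rw [div_lt_iff₀ hε] at hN₃
      rw [one_div, inv_mul_le_iff₀ (by positivity)]
      change I ≤ _
      nlinarith
  calc _ = ‖((q n ⋆[lsmul ℝ ℝ, μ] g) x - ((φ n).normed μ ⋆[lsmul ℝ ℝ, μ] g) x)
        + (((φ n).normed μ ⋆[lsmul ℝ ℝ, μ] g) x - g x)‖ := by congr 1; abel
    _ ≤ _ := (norm_add_le _ _).trans (by linarith)

/-- The binomial expansion of `l (x - t) ^ n` separates `x` from `t`; the integrals over `t` become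
coefficients. -/
lemma convolution_mem_complexPowers {q : E → ℝ} (hq : q ∈ realPowers E) {f : E → ℂ}
    (hf : Continuous f) (hc : HasCompactSupport f) :
    (q ⋆[lsmul ℝ ℝ, μ] f) ∈ complexPowers E := by
  have hex : ∀ (k : E → ℝ), Continuous k → ConvolutionExists k f (lsmul ℝ ℝ) μ := fun k hk =>
    hc.convolutionExists_right (lsmul ℝ ℝ) hk.locallyIntegrable hf
  induction hq using Submodule.span_induction with
  | mem q hq =>
    obtain ⟨⟨l, n⟩, rfl⟩ := hq
    have e : ((fun x => l x ^ n) ⋆[lsmul ℝ ℝ, μ] f)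
        = ∑ k ∈ Finset.range (n + 1), (∫ t, (((-l t) ^ (n - k) * n.choose k : ℝ) : ℂ) * f t ∂μ) •
          fun x => ((l x : ℝ) : ℂ) ^ k := by
      funext x
      rw [convolution_eq_swap]
      simp only [lsmul_apply, Finset.sum_apply, Pi.smul_apply, smul_eq_mul]
      have e2 : ∀ t, (l (x - t)) ^ n • f t = ∑ k ∈ Finset.range (n + 1),
          ((((-l t) ^ (n - k) * n.choose k : ℝ) : ℂ) * f t) * ((l x : ℝ) : ℂ) ^ k := by
        intro t
        rw [map_sub, sub_eq_add_neg, add_pow, Complex.real_smul, Complex.ofReal_sum, Finset.sum_mul]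
        refine Finset.sum_congr rfl fun k _ => ?_
        push_cast
        ring
      simp only [e2]
      rw [integral_finsetSum]
      · simp only [integral_mul_const]
      · intro k _
        refine Continuous.integrable_of_hasCompactSupport (by fun_prop) ?_
        exact (hc.mul_left (f := fun t => (((-l t) ^ (n - k) * n.choose k : ℝ) : ℂ))).mul_right
    simp only
    rw [e]
    exact Submodule.sum_mem _ fun k _ => Submodule.smul_mem _ _ (Submodule.subset_span ⟨(l, k), rfl⟩)
  | zero => simp
  | add a b ha hb iha ihb =>
    rw [(hex a (realPowers.continuous ha)).add_distrib (hex b (realPowers.continuous hb))]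
    exact Submodule.add_mem _ iha ihb
  | smul c a ha iha =>
    rw [smul_convolution]
    have : c • (a ⋆[lsmul ℝ ℝ, μ] f) = (c : ℂ) • (a ⋆[lsmul ℝ ℝ, μ] f) := by
      ext x; simp
    rw [this]
    exact Submodule.smul_mem _ _ iha

end Convolution

/-- Linear combinations of powers of linear functionals are dense in the space of smooth functions,
with uniform convergence of all derivatives on bounded sets. -/
lemma exists_complexPowers_approx {f : E → ℂ} (hf : ContDiff ℝ ∞ f) (hc : HasCompactSupport f)
    (m : ℕ) (R : ℝ) {ε : ℝ} (hε : 0 < ε) : ∃ P ∈ complexPowers E,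
      ∀ j ≤ m, ∀ x, ‖x‖ ≤ R → ‖iteratedFDeriv ℝ j (fun x => f x - P x) x‖ ≤ ε := by
  let _ : MeasurableSpace E := borel E
  have : BorelSpace E := ⟨rfl⟩
  let μ : Measure E := Measure.addHaar
  obtain ⟨q, hq, h⟩ := exists_approximate_identity μ
  have key : ∀ j, ∃ N, ∀ n ≥ N, ∀ x, ‖x‖ ≤ R →
      ‖iteratedFDeriv ℝ j (fun x => f x - (q n ⋆[lsmul ℝ ℝ, μ] f) x) x‖ ≤ ε := by
    intro j
    obtain ⟨N, hN⟩ := h (iteratedFDeriv ℝ j f) (hf.continuous_iteratedFDeriv (by exact_mod_cast le_top))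
      (hc.iteratedFDeriv j) R ε hε
    refine ⟨N, fun n hn x hx => ?_⟩
    have h1 : ContDiff ℝ ∞ (q n ⋆[lsmul ℝ ℝ, μ] f) :=
      complexPowers.contDiff (convolution_mem_complexPowers μ (hq n) hf.continuous hc)
    have h2 := iteratedFDeriv_sub_apply (x := x) (i := j)
      (hf.contDiffAt.of_le (by exact_mod_cast le_top)) (h1.contDiffAt.of_le (by exact_mod_cast le_top))
    change ‖iteratedFDeriv ℝ j (f - (q n ⋆[lsmul ℝ ℝ, μ] f)) x‖ ≤ ε
    rw [h2, iteratedFDeriv_convolution μ (realPowers.continuous (hq n)) hf hc, norm_sub_rev]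
    exact hN n hn x hx
  choose N hN using key
  refine ⟨_, convolution_mem_complexPowers μ (hq ((Finset.range (m + 1)).sup N)) hf.continuous hc,
    fun j hj x hx => hN j _ (Finset.le_sup (by simp; omega)) x hx⟩

end Approximation

end Nash

namespace Nash

/-! ### Products of Nash functions with powers of a positive rational function -/

section Rational

variable {E : Type*} [NormedAddCommGroup E] [NormedSpace ℝ E]

lemma polynomialFunctions.clear_denominators {α β : E → ℝ} (hα : α ∈ polynomialFunctions E)
    (hβ : β ∈ polynomialFunctions E) (hβ0 : ∀ x, 0 < β x) {p : E × ℂ → ℝ}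
    (hp : p ∈ polynomialFunctions (E × ℂ)) :
    ∃ N : ℕ, ∃ P ∈ polynomialFunctions (E × ℂ),
      ∀ q, P q = β q.1 ^ N * p (q.1, ((α q.1 / β q.1 : ℝ) : ℂ) * q.2) := by
  have hα' := polynomialFunctions.comp_linear hα (LinearMap.fst ℝ E ℂ)
  have hβ' := polynomialFunctions.comp_linear hβ (LinearMap.fst ℝ E ℂ)
  induction hp using Algebra.adjoin_induction with
  | mem p hp =>
    obtain ⟨l, rfl⟩ := hp
    refine ⟨1, _, add_mem (mul_mem hβ' (Algebra.subset_adjoin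
      ⟨l.comp ((LinearMap.inl ℝ E ℂ).comp (LinearMap.fst ℝ E ℂ)), rfl⟩)) (mul_mem hα'
      (Algebra.subset_adjoin ⟨l.comp ((LinearMap.inr ℝ E ℂ).comp (LinearMap.snd ℝ E ℂ)), rfl⟩)),
      fun q => ?_⟩
    have h : (q.1, ((α q.1 / β q.1 : ℝ) : ℂ) * q.2)
        = (q.1, (0 : ℂ)) + (α q.1 / β q.1) • ((0 : E), q.2) := by
      simp [Complex.real_smul]
    change β q.1 * l (q.1, 0) + α q.1 * l (0, q.2) = β q.1 ^ 1 * l (q.1, _)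
    rw [h, map_add, map_smul, smul_eq_mul]
    have := (hβ0 q.1).ne'
    field_simp
  | algebraMap r =>
    exact ⟨0, _, (polynomialFunctions (E × ℂ)).algebraMap_mem r, fun q => by simp⟩
  | add p p' _ _ h h' =>
    obtain ⟨N, P, hP, h⟩ := h
    obtain ⟨N', P', hP', h'⟩ := h'
    refine ⟨N + N', _, add_mem (mul_mem (pow_mem hβ' N') hP) (mul_mem (pow_mem hβ' N) hP'),
      fun q => ?_⟩
    simp only [Pi.add_apply, Pi.mul_apply, Pi.pow_apply, h, h', LinearMap.fst_apply]
    ring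
  | mul p p' _ _ h h' =>
    obtain ⟨N, P, hP, h⟩ := h
    obtain ⟨N', P', hP', h'⟩ := h'
    refine ⟨N + N', _, mul_mem hP hP', fun q => ?_⟩
    simp only [Pi.mul_apply, h, h']
    ring

/-- Multiplying a sign condition by a power of the positive polynomial `β` clears the denominators
without changing the set. -/
lemma IsSemialgebraic.preimage_scale {α β : E → ℝ} (hα : α ∈ polynomialFunctions E)
    (hβ : β ∈ polynomialFunctions E) (hβ0 : ∀ x, 0 < β x) {S : Set (E × ℂ)}
    (hS : IsSemialgebraic S) :
    IsSemialgebraic {q : E × ℂ | (q.1, ((α q.1 / β q.1 : ℝ) : ℂ) * q.2) ∈ S} := by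
  induction hS with
  | pos p hp =>
    obtain ⟨N, P, hP, h⟩ := polynomialFunctions.clear_denominators hα hβ hβ0 hp
    convert IsSemialgebraic.pos P hP using 1
    ext q
    simp only [Set.mem_ofPred_eq, h]
    exact (mul_pos_iff_of_pos_left (pow_pos (hβ0 q.1) N)).symm
  | inter s t _ _ h₁ h₂ => exact .inter _ _ h₁ h₂
  | compl s _ h => exact .compl _ h

lemma polynomialFunctions.hasTemperateGrowth {p : E → ℝ} [FiniteDimensional ℝ E]
    (hp : p ∈ polynomialFunctions E) : p.HasTemperateGrowth := by
  induction hp using Algebra.adjoin_induction with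
  | mem p hp =>
    obtain ⟨l, rfl⟩ := hp
    exact (LinearMap.toContinuousLinearMap l).hasTemperateGrowth
  | algebraMap r => exact Function.HasTemperateGrowth.const r
  | add p q _ _ h₁ h₂ => exact h₁.add h₂
  | mul p q _ _ h₁ h₂ => exact h₁.mul h₂

/-- The product of a Nash function on `{d > 0}` with a power of `2 / d + ν`. -/
lemma IsNashFunction.weight_mul [FiniteDimensional ℝ E] {U : OpenSet E} {d ν : E → ℝ}
    (hd : d ∈ polynomialFunctions E)
    (hν : ν ∈ polynomialFunctions E) (hd0 : ∀ x, 0 ≤ d x) (hν1 : ∀ x, 1 ≤ ν x)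
    (hU : U.carrier = {x | 0 < d x}) {a : E → ℂ} (ha : IsNashFunction U a) (M : ℕ) :
    IsNashFunction U (fun x => (((2 / d x + ν x) ^ M : ℝ) : ℂ) * a x) := by
  have hdU : ∀ x ∈ U.carrier, 0 < d x := fun x hx => by rw [hU] at hx; exact hx
  have hds := (polynomialFunctions.hasTemperateGrowth hd).1
  have hνs := (polynomialFunctions.hasTemperateGrowth hν).1
  refine ⟨ContDiffOn.mul ?_ ha.1, ?_⟩
  · refine Complex.ofRealCLM.contDiff.comp_contDiffOn (ContDiffOn.pow ?_ M)
    exact (contDiffOn_const.div hds.contDiffOn fun x hx => (hdU x hx).ne').add hνs.contDiffOn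
  -- The weight `W = 2 / d + ν` has a pole where `d = 0`, but its inverse `d / (2 + d ν)` has a
  -- positive denominator everywhere. So the graph of `W ^ M * a` is described as the set where `W⁻ᴹ
  -- z = a x`, a scaled preimage of the graph of `a`.
  · have hQ : ∀ x, 0 < 2 + d x * ν x := fun x => by nlinarith [hd0 x, hν1 x]
    have hQp : (fun x => 2 + d x * ν x) ∈ polynomialFunctions E :=
      add_mem ((polynomialFunctions E).algebraMap_mem 2) (mul_mem hd hν)
    convert ha.2.preimage_scale (pow_mem hd M) (pow_mem hQp M)
      (fun x => by simpa using pow_pos (hQ x) M) using 1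
    ext q
    simp only [Set.mem_ofPred_eq, Pi.pow_apply]
    refine and_congr_right fun hq => ?_
    have h1 := hdU _ hq
    have h2 : ((d q.1 ^ M / (2 + d q.1 * ν q.1) ^ M : ℝ) : ℂ)
        * (((2 / d q.1 + ν q.1) ^ M : ℝ) : ℂ) = 1 := by
      rw [← Complex.ofReal_mul, ← div_pow, ← mul_pow]
      have : d q.1 / (2 + d q.1 * ν q.1) * (2 / d q.1 + ν q.1) = 1 := by
        have := (hQ q.1).ne'
        field_simp
      rw [this]; simp
    constructor
    · intro h
      rw [h, ← mul_assoc, h2, one_mul]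
    · intro h
      rw [← h, ← mul_assoc, mul_comm _ ((_ : ℝ) : ℂ), h2, one_mul]

end Rational

/-! ### Compactly supported functions suffice -/

section Cutoff

variable {E : Type*} [NormedAddCommGroup E] [NormedSpace ℝ E] [FiniteDimensional ℝ E]

/-- A multilinear map is determined by its values on tuples of basis vectors. This turns the
Schwartz bounds along fixed directions into bounds on the operator norm of the derivative. -/
lemma exists_multilinear_bound (j : ℕ) : ∃ s : Finset (Fin j → E), ∃ C : ℝ, 0 ≤ C ∧
    ∀ φ : E [×j]→L[ℝ] ℂ, ∀ B : ℝ, (∀ v ∈ s, ‖φ v‖ ≤ B) → ‖φ‖ ≤ C * B := by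
  classical
  let b := Module.finBasis ℝ E
  let c := fun i => LinearMap.toContinuousLinearMap (b.coord i)
  refine ⟨Finset.univ.image fun r : Fin j → Fin (Module.finrank ℝ E) => fun i => b (r i),
    ∑ r : Fin j → Fin (Module.finrank ℝ E), ∏ i, ‖c (r i)‖, by positivity, fun φ B h => ?_⟩
  by_cases hr : Nonempty (Fin j → Fin (Module.finrank ℝ E))
  · obtain ⟨r0⟩ := hr
    have hB : 0 ≤ B := (norm_nonneg _).trans (h (fun i => b (r0 i)) (by simp))
    refine φ.opNorm_le_bound (by positivity) fun v => ?_
    have hv : v = fun i => ∑ k, c k (v i) • b k := by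
      funext i
      exact (b.sum_repr (v i)).symm
    have e : φ v = ∑ r : Fin j → Fin (Module.finrank ℝ E),
        (∏ i, c (r i) (v i)) • φ fun i => b (r i) := by
      conv_lhs => rw [hv]
      rw [φ.map_sum]
      refine Finset.sum_congr rfl fun r _ => ?_
      exact φ.map_smul_univ _ _
    rw [e, Finset.sum_mul, Finset.sum_mul]
    refine (norm_sum_le _ _).trans (Finset.sum_le_sum fun r _ => ?_)
    rw [norm_smul, norm_prod]
    have h1 : ∏ i, ‖c (r i) (v i)‖ ≤ ∏ i, (‖c (r i)‖ * ‖v i‖) :=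
      Finset.prod_le_prod (fun _ _ => norm_nonneg _) fun i _ => (c (r i)).le_opNorm _
    rw [Finset.prod_mul_distrib] at h1
    have h2 := h (fun i => b (r i)) (by simp)
    calc _ ≤ ((∏ i, ‖c (r i)‖) * ∏ i, ‖v i‖) * B := by gcongr
      _ = _ := by ring
  · have hE : IsEmpty (Fin j → Fin (Module.finrank ℝ E)) := not_nonempty_iff.1 hr
    have : φ = 0 := by
      ext v
      have hv : v = fun i => ∑ k, c k (v i) • b k := by
        funext i
        exact (b.sum_repr (v i)).symm
      rw [hv, φ.map_sum]
      simp
    simp [this]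

lemma SchwartzSpace.exists_bound {U : OpenSet E} (f : SchwartzSpace U) {a : E → ℂ}
    (ha : IsNashFunction U a) (j : ℕ) :
    ∃ B : ℝ, 0 ≤ B ∧ ∀ x ∈ U.carrier, ‖a x‖ * ‖iteratedFDeriv ℝ j f x‖ ≤ B := by
  obtain ⟨s, C, hC, h⟩ := exists_multilinear_bound (E := E) j
  choose B hB using fun v => f.2.2.2 ⟨j, ⟨a, ha⟩, v⟩
  have hB0 : ∀ v ∈ s, B v ≤ ∑ v ∈ s, max (B v) 0 := fun v hv =>
    (le_max_left _ _).trans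
      (Finset.single_le_sum (f := fun v => max (B v) 0) (fun v _ => le_max_right _ _) hv)
  refine ⟨C * ∑ v ∈ s, max (B v) 0,
    mul_nonneg hC (Finset.sum_nonneg fun v _ => le_max_right _ _), fun x hx => ?_⟩
  rw [← norm_smul]
  refine h _ _ fun v hv => ((?_ : _ = _).trans_le (hB v x hx)).trans (hB0 v hv)
  simp [Monomial.apply]

lemma exists_norm_le_polynomial : ∃ ν ∈ polynomialFunctions E, ∀ x, 1 ≤ ν x ∧ ‖x‖ ≤ ν x := by
  let b := Module.finBasis ℝ E
  refine ⟨fun x => 1 + ∑ i, ‖b i‖ * (1 + b.coord i x * b.coord i x), ?_, fun x => ?_⟩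
  · refine add_mem ((polynomialFunctions E).algebraMap_mem 1) ?_
    have : (fun x => ∑ i, ‖b i‖ * (1 + b.coord i x * b.coord i x))
        = ∑ i, fun x => ‖b i‖ * (1 + b.coord i x * b.coord i x) := by
      ext x; simp
    rw [this]
    refine sum_mem fun i _ => mul_mem ((polynomialFunctions E).algebraMap_mem ‖b i‖)
      (add_mem ((polynomialFunctions E).algebraMap_mem 1) (mul_mem ?_ ?_)) <;>
    exact Algebra.subset_adjoin ⟨b.coord i, rfl⟩
  · have h0 : 0 ≤ ∑ i, ‖b i‖ * (1 + b.coord i x * b.coord i x) :=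
      Finset.sum_nonneg fun i _ => mul_nonneg (norm_nonneg _) (by nlinarith [mul_self_nonneg (b.coord i x)])
    refine ⟨by linarith, ?_⟩
    have h1 : ‖x‖ ≤ ∑ i, ‖b i‖ * (1 + b.coord i x * b.coord i x) := by
      conv_lhs => rw [← b.sum_repr x]
      refine (norm_sum_le _ _).trans (Finset.sum_le_sum fun i _ => ?_)
      rw [norm_smul, mul_comm]
      refine mul_le_mul_of_nonneg_left ?_ (norm_nonneg _)
      rw [Module.Basis.coord_apply, Real.norm_eq_abs]
      nlinarith [abs_mul_abs_self (b.repr x i), sq_nonneg (|b.repr x i| - 1)]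
    linarith

/-- The function is constant off the unit interval, so only a compact set matters. -/
lemma exists_smoothTransition_bound (j : ℕ) : ∃ A : ℝ, 0 ≤ A ∧
    ∀ s : ℝ, ‖iteratedFDeriv ℝ j Real.smoothTransition s‖ ≤ A := by
  have hs : ContDiff ℝ ∞ Real.smoothTransition := Real.smoothTransition.contDiff
  obtain ⟨A, hA⟩ := (isCompact_closedBall (0 : ℝ) 2).exists_bound_of_continuousOn
    (hs.continuous_iteratedFDeriv (m := j) (by exact_mod_cast le_top)).continuousOn
  have hc : ∀ c : ℝ, ‖c‖ ≤ 1 → ∀ s : ℝ, ‖iteratedFDeriv ℝ j (fun _ : ℝ => c) s‖ ≤ 1 := by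
    intro c hc s
    rcases j with _ | j
    · simpa using hc
    · simp [iteratedFDeriv_const_of_ne (Nat.succ_ne_zero j)]
  refine ⟨max A 1, le_max_of_le_right zero_le_one, fun s => ?_⟩
  by_cases h : |s| ≤ 2
  · exact (hA s (by simpa using h)).trans (le_max_left _ _)
  · refine le_trans ?_ (le_max_right _ _)
    rcases lt_abs.1 (not_le.1 h) with h | h
    · have : Real.smoothTransition =ᶠ[nhds s] fun _ => 1 := by
        filter_upwards [lt_mem_nhds (show 1 < s by linarith)] with t ht
        exact Real.smoothTransition.one_of_one_le ht.le
      rw [(this.iteratedFDeriv ℝ j).eq_of_nhds]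
      exact hc 1 (by simp) s
    · have : Real.smoothTransition =ᶠ[nhds s] fun _ => 0 := by
        filter_upwards [gt_mem_nhds (show s < 0 by linarith)] with t ht
        exact Real.smoothTransition.zero_of_nonpos ht.le
      rw [(this.iteratedFDeriv ℝ j).eq_of_nhds]
      exact hc 0 (by simp) s

/-- The estimate for derivatives of a composition: each order of differentiation costs at most one
factor `n`, from `c`, and a polynomial in `‖x‖`, which a power of `ν` dominates. -/
lemma exists_cutoff_factor_bound {p ν : E → ℝ} (hp : p ∈ polynomialFunctions E)
    (hν : ∀ x, 1 ≤ ν x ∧ ‖x‖ ≤ ν x) (j : ℕ) : ∃ C : ℝ, 0 ≤ C ∧ ∃ M : ℕ,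
    ∀ n : ℝ, 1 ≤ n → ∀ c a : ℝ, |c| ≤ n → ∀ x,
      ‖iteratedFDeriv ℝ j (fun x => Real.smoothTransition (c * p x + a)) x‖
        ≤ C * n ^ j * ν x ^ M := by
  have hpg := polynomialFunctions.hasTemperateGrowth hp
  choose k D hkD using hpg.2
  choose A hA0 hA using exists_smoothTransition_bound
  let A' := ∑ i ∈ Finset.range (j + 1), A i
  let k' := ∑ i ∈ Finset.range (j + 1), k i
  let D' := 1 + ∑ i ∈ Finset.range (j + 1), |D i|
  have hD' : 1 ≤ D' := le_add_of_nonneg_right (Finset.sum_nonneg fun _ _ => abs_nonneg _)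
  have hA'0 : 0 ≤ A' := Finset.sum_nonneg fun i _ => hA0 i
  refine ⟨j.factorial * A' * (D' * 2 ^ k') ^ j, by positivity, k' * j, fun n hn c a hc x => ?_⟩
  have hν1 := (hν x).1
  have h := norm_iteratedFDeriv_comp_le (g := Real.smoothTransition) (f := fun x => c * p x + a)
    (n := j) (N := ∞) Real.smoothTransition.contDiff
    ((contDiff_const.mul hpg.1).add contDiff_const) (by exact_mod_cast le_top) x (C := A')
    (D := n * (D' * (2 * ν x) ^ k')) (fun i hi => (hA i _).trans
      (Finset.single_le_sum (f := A) (fun i _ => hA0 i) (by simp; omega))) (by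
      intro i hi1 hi
      have hge : 1 ≤ n * (D' * (2 * ν x) ^ k') := by
        have : 1 ≤ (2 * ν x) ^ k' := one_le_pow₀ (by linarith)
        nlinarith [mul_le_mul hD' this zero_le_one (by linarith)]
      refine le_trans ?_ (le_self_pow₀ hge (by omega))
      have e : iteratedFDeriv ℝ i (fun x => c * p x + a) x = c • iteratedFDeriv ℝ i p x := by
        have hpi : ContDiffAt ℝ i p x := hpg.1.contDiffAt.of_le (by exact_mod_cast le_top)
        have h1 := iteratedFDeriv_add_apply (x := x) (i := i) (f := c • p) (g := fun _ => a)
          (hpi.const_smul c) contDiffAt_const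
        rw [iteratedFDeriv_const_smul_apply hpi,
          iteratedFDeriv_const_of_ne (by omega : i ≠ 0)] at h1
        change iteratedFDeriv ℝ i (c • p + fun _ => a) x = _
        simpa using h1
      rw [e, norm_smul, Real.norm_eq_abs]
      refine mul_le_mul hc ((hkD i x).trans ?_) (norm_nonneg _) (by linarith)
      have h2 : D i ≤ D' := (le_abs_self _).trans ((Finset.single_le_sum (f := fun i => |D i|)
        (fun i _ => abs_nonneg _) (by simp; omega : i ∈ Finset.range (j + 1))).trans
          (le_add_of_nonneg_left zero_le_one))
      have h3 : k i ≤ k' := Finset.single_le_sum (f := k) (fun i _ => Nat.zero_le _)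
        (by simp; omega : i ∈ Finset.range (j + 1))
      have h4 : (1 + ‖x‖) ^ k i ≤ (2 * ν x) ^ k' :=
        (pow_le_pow_left₀ (by positivity) (by linarith [(hν x).2]) _).trans
          (pow_le_pow_right₀ (by linarith) h3)
      exact mul_le_mul h2 h4 (by positivity) (by linarith))
  refine h.trans (le_of_eq ?_)
  rw [mul_pow n, mul_pow 2, ← mul_assoc D', mul_pow (D' * _), ← pow_mul (ν x)]
  ring

/-- A tempered generalized function on `{d > 0}`, `d` a nonnegative polynomial, that vanishes on all
compactly supported smooth densities is zero. -/
theorem eq_zero_of_pair_eq_zero {U : OpenSet E} {d : E → ℝ} (hd : d ∈ polynomialFunctions E)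
    (hd0 : ∀ x, 0 ≤ d x) (hU : U.carrier = {x | 0 < d x}) (T : TemperedGeneralizedFunction U)
    (hT : ∀ g, IsTest U g → pair T g = 0) : T = 0 := by
  obtain ⟨ν, hνp, hν⟩ := exists_norm_le_polynomial (E := E)
  have hds := (polynomialFunctions.hasTemperateGrowth hd).1
  have hνs := (polynomialFunctions.hasTemperateGrowth hνp).1
  have hdU : ∀ x ∈ U.carrier, 0 < d x := fun x hx => by rw [hU] at hx; exact hx
  have : ProperSpace E := FiniteDimensional.proper_real E
  -- Equal to 1 where `2 ≤ n d` and `ν ≤ n`; zero where `n d ≤ 1` or `2 n ≤ ν`. Its support is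
  -- compact in `U`, the first factor keeping it away from `d = 0` and the second bounding it.
  let χ : ℝ → E → ℝ := fun n x =>
    Real.smoothTransition (n * d x + -1) * Real.smoothTransition (-(1 / n) * ν x + 2)
  have hχ1 : ∀ n, ContDiff ℝ ∞ (fun x => Real.smoothTransition (n * d x + -1)) := fun n =>
    Real.smoothTransition.contDiff.comp ((contDiff_const.mul hds).add contDiff_const)
  have hχ2 : ∀ n, ContDiff ℝ ∞ (fun x => Real.smoothTransition (-(1 / n) * ν x + 2)) := fun n =>
    Real.smoothTransition.contDiff.comp ((contDiff_const.mul hνs).add contDiff_const)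
  have hχs : ∀ n, ContDiff ℝ ∞ (χ n) := fun n => (hχ1 n).mul (hχ2 n)
  have hθ : ∀ j, ∃ C : ℝ, 0 ≤ C ∧ ∃ M : ℕ, ∀ n : ℝ, 1 ≤ n → ∀ x,
      ‖iteratedFDeriv ℝ j (fun x => ((1 - χ n x : ℝ) : ℂ)) x‖ ≤ C * n ^ j * ν x ^ M := by
    intro j
    choose C₁ hC₁ M₁ h₁ using exists_cutoff_factor_bound hd hν
    choose C₂ hC₂ M₂ h₂ using exists_cutoff_factor_bound hνp hν
    let M := ∑ i ∈ Finset.range (j + 1), (M₁ i + M₂ (j - i))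
    refine ⟨1 + ∑ i ∈ Finset.range (j + 1), (j.choose i : ℝ) * C₁ i * C₂ (j - i),
      add_nonneg zero_le_one (Finset.sum_nonneg fun i _ =>
        mul_nonneg (mul_nonneg (Nat.cast_nonneg _) (hC₁ i)) (hC₂ _)), M, fun n hn x => ?_⟩
    have hν1 := (hν x).1
    have hpos : 1 ≤ n ^ j * ν x ^ M := one_le_mul_of_one_le_of_one_le (one_le_pow₀ hn) (one_le_pow₀ hν1)
    have e : ‖iteratedFDeriv ℝ j (fun x => ((1 - χ n x : ℝ) : ℂ)) x‖
        = ‖iteratedFDeriv ℝ j (fun x => 1 - χ n x) x‖ :=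
      Complex.ofRealLI.norm_iteratedFDeriv_comp_left (f := fun x => 1 - χ n x) (n := ∞)
        ((contDiff_const.sub (hχs n)).contDiffAt) (by exact_mod_cast le_top)
    have e2 := iteratedFDeriv_sub_apply (x := x) (i := j) (f := fun _ : E => (1 : ℝ)) (g := χ n)
      contDiffAt_const ((hχs n).contDiffAt.of_le (by exact_mod_cast le_top))
    have e3 : ‖iteratedFDeriv ℝ j (fun _ : E => (1 : ℝ)) x‖ ≤ 1 := by
      rcases j with _ | j
      · simp
      · simp [iteratedFDeriv_const_of_ne (Nat.succ_ne_zero j)]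
    have e4 : ‖iteratedFDeriv ℝ j (χ n) x‖ ≤
        (∑ i ∈ Finset.range (j + 1), (j.choose i : ℝ) * C₁ i * C₂ (j - i)) * (n ^ j * ν x ^ M) := by
      refine (norm_iteratedFDeriv_mul_le (hχ1 n) (hχ2 n) x (n := j)
        (by exact_mod_cast le_top)).trans ?_
      rw [Finset.sum_mul]
      refine Finset.sum_le_sum fun i hi => ?_
      have hi' : i ≤ j := by simpa [Nat.lt_succ_iff] using hi
      have a₁ := h₁ i n hn n (-1) (by rw [abs_of_nonneg (by linarith)]) x
      have a₂ := h₂ (j - i) n hn (-(1 / n)) 2 (by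
        rw [abs_neg, abs_of_nonneg (by positivity), div_le_iff₀ (by linarith)]; nlinarith) x
      have hM : M₁ i + M₂ (j - i) ≤ M := Finset.single_le_sum
        (f := fun i => M₁ i + M₂ (j - i)) (fun i _ => Nat.zero_le _) hi
      calc (j.choose i : ℝ) * ‖_‖ * ‖_‖
          ≤ (j.choose i : ℝ) * (C₁ i * n ^ i * ν x ^ M₁ i)
            * (C₂ (j - i) * n ^ (j - i) * ν x ^ M₂ (j - i)) := by
              have := hC₁ i
              gcongr
        _ = (j.choose i : ℝ) * C₁ i * C₂ (j - i) * (n ^ j * ν x ^ (M₁ i + M₂ (j - i))) := by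
              rw [← Nat.add_sub_cancel' hi', pow_add n, pow_add (ν x), Nat.add_sub_cancel_left]
              ring
        _ ≤ _ := by
              have := hC₁ i
              have := hC₂ (j - i)
              gcongr
    rw [e]
    change ‖iteratedFDeriv ℝ j ((fun _ => (1 : ℝ)) - χ n) x‖ ≤ _
    rw [e2]
    refine (norm_sub_le _ _).trans ?_
    rw [mul_assoc, add_mul, one_mul]
    exact add_le_add (e3.trans hpos) e4
  have hχsupp : ∀ n : ℝ, 1 ≤ n → ∀ x, χ n x ≠ 0 → 1 / n ≤ d x ∧ ‖x‖ ≤ 2 * n := by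
    intro n hn x hx
    have hn0 : 0 < n := by linarith
    constructor
    · by_contra h
      refine hx (mul_eq_zero_of_left (Real.smoothTransition.zero_of_nonpos ?_) _)
      rw [not_le, lt_div_iff₀ hn0] at h
      linarith
    · by_contra h
      refine hx (mul_eq_zero_of_right _ (Real.smoothTransition.zero_of_nonpos ?_))
      have h1 : 2 * n ≤ ν x := (not_le.1 h).le.trans (hν x).2
      have h2 : 1 / n * (2 * n) ≤ 1 / n * ν x := by gcongr
      have h3 : 1 / n * (2 * n) = 2 := by field_simp
      linarith
  have hf : ∀ f : SchwartzSpace U, ∀ n : ℝ, 1 ≤ n → IsTest U (fun x => ((χ n x : ℝ) : ℂ) * f x) := by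
    intro f n hn
    have hn0 : 0 < n := by linarith
    let S : Set E := {x | 1 / n ≤ d x} ∩ Metric.closedBall 0 (2 * n)
    have hS : IsCompact S := (isCompact_closedBall _ _).inter_left
      (isClosed_le continuous_const hds.continuous)
    have hSU : S ⊆ U.carrier := fun x hx => by
      rw [hU]; exact lt_of_lt_of_le (by positivity : (0 : ℝ) < 1 / n) hx.1
    have hsub : ∀ x, x ∉ S → ((χ n x : ℝ) : ℂ) * f x = 0 := fun x hx => by
      by_contra h
      have := hχsupp n hn x fun h0 => h (by simp [h0])
      exact hx ⟨this.1, by simpa using this.2⟩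
    have hts : tsupport (fun x => ((χ n x : ℝ) : ℂ) * f x) ⊆ S :=
      closure_minimal (fun x hx => by_contra fun h => hx (hsub x h)) hS.isClosed
    refine .of_tsupport_subset (contDiff_iff_contDiffAt.2 fun x => ?_) hS hSU hts
    by_cases hx : x ∈ S
    · exact (Complex.ofRealCLM.contDiff.comp (hχs n)).contDiffAt.mul
        (f.2.2.1.contDiffAt (U.isOpen.mem_nhds (hSU hx)))
    · refine (contDiffAt_const (𝕜 := ℝ) (E := E) (c := (0 : ℂ))).congr_of_eventuallyEq ?_
      filter_upwards [hS.isClosed.isOpen_compl.mem_nhds hx] with y hy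
      exact hsub y hy
  have hest : ∀ (f : SchwartzSpace U) (D : Monomial U), ∃ K : ℝ, 0 ≤ K ∧ ∀ n : ℝ, 1 ≤ n →
      ∀ x ∈ U.carrier, ‖D.apply (fun x => ((1 - χ n x : ℝ) : ℂ) * f x) x‖ ≤ K / n := by
    rintro f ⟨k, ⟨a, ha⟩, v⟩
    choose C hC M hM using hθ
    -- Where `1 - χ n` is not locally zero, `n ≤ W = 2 / d + ν`. There an `i`-th derivative of `1 -
    -- χ n` costs at most a constant times `W ^ (i + M i)`. The extra power of `W` in the weight
    -- pays for a factor `n`, which gives the decay `K / n`.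
    choose B hB0 hB using fun i => f.exists_bound
      (ha.weight_mul hd hνp hd0 (fun x => (hν x).1) hU (i + M i + 1)) (k - i)
    let K := ∑ i ∈ Finset.range (k + 1), (k.choose i : ℝ) * C i * B i
    have hK : 0 ≤ K := Finset.sum_nonneg fun i _ =>
      mul_nonneg (mul_nonneg (Nat.cast_nonneg _) (hC i)) (hB0 i)
    refine ⟨K * ∏ i, ‖v i‖, by positivity, fun n hn x hx => ?_⟩
    have hn0 : 0 < n := by linarith
    have hdx := hdU x hx
    have hν1 := (hν x).1
    by_cases hcase : 2 < n * d x ∧ ν x < n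
    · have h0 : (fun x => ((1 - χ n x : ℝ) : ℂ) * f x) =ᶠ[nhds x] fun _ => 0 := by
        filter_upwards [(isOpen_lt continuous_const (continuous_const.mul hds.continuous)).mem_nhds
          hcase.1, (isOpen_lt hνs.continuous continuous_const).mem_nhds hcase.2] with y h1 h2
        have h1' : 2 < n * d y := h1
        have h2' : ν y < n := h2
        have h3 : 1 / n * ν y ≤ 1 := by
          rw [one_div, inv_mul_le_iff₀ hn0]; linarith
        simp only [χ]
        rw [Real.smoothTransition.one_of_one_le (by linarith),
          Real.smoothTransition.one_of_one_le (by linarith)]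
        simp
      simp only [Monomial.apply]
      rw [(h0.iteratedFDeriv ℝ k).eq_of_nhds]
      have : iteratedFDeriv ℝ k (fun _ : E => (0 : ℂ)) x = 0 := by
        exact congrFun (iteratedFDeriv_fun_zero (n := k)) x
      rw [this]
      simp only [zero_apply, mul_zero, norm_zero]
      positivity
    · have hW : n ≤ 2 / d x + ν x := by
        rcases not_and_or.1 hcase with h | h
        · have : n ≤ 2 / d x := by rw [le_div_iff₀ hdx]; linarith
          linarith
        · have : 0 ≤ 2 / d x := by positivity
          linarith
      have hW1 : ν x ≤ 2 / d x + ν x := le_add_of_nonneg_left (by positivity)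
      set W := 2 / d x + ν x
      have hW0 : 0 < W := by linarith
      have hmul := norm_iteratedFDerivWithin_mul_le (s := U.carrier) (n := k) (N := ∞)
        (f := fun x => ((1 - χ n x : ℝ) : ℂ)) (g := f)
        (Complex.ofRealCLM.contDiff.comp (contDiff_const.sub (hχs n))).contDiffOn f.2.2.1
        U.isOpen.uniqueDiffOn hx (by exact_mod_cast le_top)
      simp only [iteratedFDerivWithin_of_isOpen _ U.isOpen hx] at hmul
      have hsum : n * (‖a x‖ * ‖iteratedFDeriv ℝ k (fun x => ((1 - χ n x : ℝ) : ℂ) * f x) x‖)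
          ≤ K := by
        refine (mul_le_mul_of_nonneg_left (mul_le_mul_of_nonneg_left hmul (norm_nonneg _))
          hn0.le).trans ?_
        rw [Finset.mul_sum, Finset.mul_sum]
        refine Finset.sum_le_sum fun i _ => ?_
        have b1 := hB i x hx
        rw [norm_mul, Complex.norm_real, Real.norm_eq_abs, abs_of_nonneg (by positivity)] at b1
        have c0 := hC i
        calc n * (‖a x‖ * ((k.choose i : ℝ) * ‖_‖ * ‖iteratedFDeriv ℝ (k - i) f x‖))
            ≤ W * (‖a x‖ * ((k.choose i : ℝ) * (C i * W ^ i * W ^ M i)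
              * ‖iteratedFDeriv ℝ (k - i) f x‖)) := by
                have := (hM i n hn x)
                gcongr
                refine this.trans ?_
                gcongr
          _ = (k.choose i : ℝ) * C i * (W ^ (i + M i + 1) * ‖a x‖
              * ‖iteratedFDeriv ℝ (k - i) f x‖) := by
                rw [pow_add, pow_add]; ring
          _ ≤ _ := by gcongr
      rw [le_div_iff₀ hn0]
      change ‖a x * iteratedFDeriv ℝ k (fun x => ((1 - χ n x : ℝ) : ℂ) * f x) x v‖ * n ≤ _
      rw [norm_mul]
      calc _ ≤ ‖a x‖ * (‖iteratedFDeriv ℝ k (fun x => ((1 - χ n x : ℝ) : ℂ) * f x) x‖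
            * ∏ i, ‖v i‖) * n := by
            gcongr
            exact ContinuousMultilinearMap.le_opNorm _ _
        _ = n * (‖a x‖ * ‖iteratedFDeriv ℝ k (fun x => ((1 - χ n x : ℝ) : ℂ) * f x) x‖)
            * ∏ i, ‖v i‖ := by ring
        _ ≤ _ := by gcongr
  obtain ⟨s, C, hC, hb⟩ := exists_seminorm_bound T
  ext f
  choose K hK0 hK using hest f
  set K' := ∑ D ∈ s, K D
  have hK'0 : 0 ≤ K' := Finset.sum_nonneg fun D _ => hK0 D
  have key : ∀ n : ℝ, 1 ≤ n → ‖T f‖ ≤ C * K' / n := by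
    intro n hn
    have h1 : T f = T (f - (hf f n hn).toSchwartz) := by
      rw [map_sub, ← pair_eq T (hf f n hn), hT _ (hf f n hn), sub_zero]
    rw [h1, mul_div_assoc]
    refine hb _ _ (by positivity) fun D hD x hx => ?_
    have h2 : ((f - (hf f n hn).toSchwartz : SchwartzSpace U) : E → ℂ)
        = fun x => ((1 - χ n x : ℝ) : ℂ) * f x := by
      funext y
      change f y - ((χ n y : ℝ) : ℂ) * f y = _
      push_cast; ring
    rw [h2]
    refine (hK D n hn x hx).trans ?_
    gcongr
    exact Finset.single_le_sum (fun D _ => hK0 D) hD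
  have h0 : ‖T f‖ ≤ 0 := by
    have h1 : Filter.Tendsto (fun n : ℝ => C * K' / n) Filter.atTop (nhds 0) :=
      tendsto_const_nhds.div_atTop Filter.tendsto_id
    refine ge_of_tendsto h1 ?_
    filter_upwards [Filter.eventually_ge_atTop 1] with n hn
    exact key n hn
  simpa using norm_le_zero_iff.1 h0

end Cutoff

end Nash

/-! ### Polynomials on `3 × 3` matrices that vanish on singular matrices -/

namespace MatrixPolynomial

open MvPolynomial

/-! ### Division by polynomials that are linear in one variable -/

section Division

variable {σ τ : Type*}

lemma eval_update_of_mem_supported [DecidableEq σ] {i : σ} {p : MvPolynomial σ ℝ}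
    (hp : p ∈ supported ℝ ({i}ᶜ : Set σ)) (v : σ → ℝ) (t : ℝ) :
    eval (Function.update v i t) p = eval v p := by
  refine eval₂Hom_congr' rfl (fun j hj _ => ?_) rfl
  have : j ≠ i := mem_supported.1 hp hj
  rw [Function.update_of_ne this]

lemma exists_eval_ne_zero {p : MvPolynomial σ ℝ} (hp : p ≠ 0) : ∃ v, eval v p ≠ 0 := by
  by_contra! h
  exact hp (MvPolynomial.funext fun v => by simp [h v])

/-- A polynomial that vanishes on the real zeros of a prime polynomial `A Xᵢ + B`, where `A` and `B`
do not involve `Xᵢ`, is divisible by it. -/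
lemma dvd_of_eval_eq_zero [DecidableEq σ] {i : σ} {A B : MvPolynomial σ ℝ}
    (hA : A ∈ supported ℝ ({i}ᶜ : Set σ)) (hB : B ∈ supported ℝ ({i}ᶜ : Set σ)) (hA0 : A ≠ 0)
    (hp : Prime (A * X i + B)) {Φ : MvPolynomial σ ℝ}
    (h : ∀ v, eval v (A * X i + B) = 0 → eval v Φ = 0) : A * X i + B ∣ Φ := by
  have hroot : ∀ v, eval v A ≠ 0 →
      eval (Function.update v i (-(eval v B / eval v A))) (A * X i + B) = 0 := fun v hv => by
    rw [map_add, map_mul, eval_update_of_mem_supported hA, eval_update_of_mem_supported hB, eval_X,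
      Function.update_self]
    field_simp
    ring
  -- Pseudo-division: a power of the leading coefficient `A` makes division with a remainder free of
  -- `Xᵢ` possible.
  have div : ∀ Φ : MvPolynomial σ ℝ, ∃ n : ℕ, ∃ Q R : MvPolynomial σ ℝ,
      A ^ n * Φ = (A * X i + B) * Q + R ∧ R ∈ supported ℝ ({i}ᶜ : Set σ) := by
    intro Φ
    induction Φ using MvPolynomial.induction_on with
    | C a => exact ⟨0, 0, C a, by simp, (supported ℝ _).algebraMap_mem a⟩
    | add p q hp hq =>
      obtain ⟨n, Q, R, h, hR⟩ := hp
      obtain ⟨n', Q', R', h', hR'⟩ := hq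
      refine ⟨n + n', A ^ n' * Q + A ^ n * Q', A ^ n' * R + A ^ n * R', ?_,
        add_mem (mul_mem (pow_mem hA _) hR) (mul_mem (pow_mem hA _) hR')⟩
      linear_combination A ^ n' * h + A ^ n * h'
    | mul_X p j hp =>
      obtain ⟨n, Q, R, h, hR⟩ := hp
      by_cases hj : j = i
      · subst hj
        refine ⟨n + 1, Q * (A * X j) + R, -(R * B), ?_, neg_mem (mul_mem hR hB)⟩
        linear_combination A * X j * h
      · refine ⟨n, Q * X j, R * X j, ?_, mul_mem hR (X_mem_supported.2 hj)⟩
        linear_combination X j * h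
  obtain ⟨n, Q, R, hd, hR⟩ := div Φ
  have hR0 : R = 0 := by
    -- Where `A ≠ 0` one can solve for `Xᵢ` to reach a zero of the divisor without changing `R`, so
    -- `R` vanishes there.
    have : A * R = 0 := MvPolynomial.funext fun v => by
      rw [map_mul, map_zero]
      by_cases hv : eval v A = 0
      · simp [hv]
      · have h1 := congrArg (eval (Function.update v i (-(eval v B / eval v A)))) hd
        rw [map_mul, h _ (hroot v hv), map_add, map_mul, hroot v hv,
          eval_update_of_mem_supported hR] at h1
        simp only [mul_zero, zero_mul, zero_add] at h1
        rw [← h1, mul_zero]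
    exact (mul_eq_zero.1 this).resolve_left hA0
  rw [hR0, add_zero] at hd
  rcases hp.dvd_or_dvd (Dvd.intro _ hd.symm) with h1 | h1
  · exfalso
    -- The prime cannot divide `A`: moving the `i`-th coordinate to a root of the prime leaves a
    -- nonzero value of `A` unchanged.
    obtain ⟨q, hq⟩ := hp.dvd_of_dvd_pow h1
    obtain ⟨v, hv⟩ := exists_eval_ne_zero hA0
    have h2 := congrArg (eval (Function.update v i (-(eval v B / eval v A)))) hq
    rw [map_mul, hroot v hv, eval_update_of_mem_supported hA, zero_mul] at h2
    exact hv h2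
  · exact h1

lemma totalDegree_aeval_le {f : σ → MvPolynomial τ ℝ} (hf : ∀ i, (f i).totalDegree ≤ 1)
    (p : MvPolynomial σ ℝ) : (aeval f p).totalDegree ≤ p.totalDegree := by
  rw [aeval_def, eval₂_eq]
  refine totalDegree_finsetSum_le fun m hm => ?_
  refine (totalDegree_mul _ _).trans ?_
  have h1 : (algebraMap ℝ (MvPolynomial τ ℝ) (coeff m p)).totalDegree = 0 := totalDegree_C _
  rw [h1, zero_add]
  refine (totalDegree_finsetProd _ _).trans ?_
  refine le_trans (Finset.sum_le_sum fun i _ => (totalDegree_pow _ _).trans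
    (Nat.mul_le_mul_left _ (hf i))) ?_
  simp only [mul_one]
  exact le_totalDegree hm

/-- The polynomial is linear in `X b`, and its leading coefficient `X a` is a prime that does not
divide the constant term. -/
lemma irreducible_two_by_two [DecidableEq σ] {a b c d : σ} (hab : a ≠ b) (hac : a ≠ c) (had : a ≠ d)
    (hbc : b ≠ c) (hbd : b ≠ d) :
    Irreducible (X a * X b + -(X c * X d) : MvPolynomial σ ℝ) := by
  refine irreducible_mul_X_add _ _ b (X_ne_zero a) ?_ ?_ ?_
  · simp [vars_X, hab.symm]
  · intro h
    have : -(X c * X d : MvPolynomial σ ℝ) ∈ supported ℝ ({b}ᶜ : Set σ) :=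
      neg_mem (mul_mem (X_mem_supported.2 hbc.symm) (X_mem_supported.2 hbd.symm))
    exact mem_supported.1 this h rfl
  · rw [(X_prime (i := a) (R := ℝ)).irreducible.isRelPrime_iff_not_dvd, dvd_neg]
    intro h
    rcases (X_prime (i := a) (R := ℝ)).dvd_or_dvd h with h | h
    · exact hac ((X_dvd_X).1 h)
    · exact had ((X_dvd_X).1 h)

end Division

/-! ### Divisibility by the determinant -/

section Determinant

/-- The value of a polynomial at a matrix. -/
noncomputable def evalMatrix {m n : Type*} (N : Matrix m n ℝ) :
    MvPolynomial (m × n) ℝ →ₐ[ℝ] ℝ :=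
  aeval fun p => N p.1 p.2

lemma evalMatrix_eq {m n : Type*} (N : Matrix m n ℝ) (Φ : MvPolynomial (m × n) ℝ) :
    evalMatrix N Φ = eval (fun p => N p.1 p.2) Φ := by
  rw [evalMatrix, aeval_eq_eval]

/-- Matrices that preserve the decomposition of `ℝ³` into the middle axis and its complement. -/
def IsBlock (N : Matrix (Fin 3) (Fin 3) ℝ) : Prop :=
  N 0 1 = 0 ∧ N 1 0 = 0 ∧ N 1 2 = 0 ∧ N 2 1 = 0

local notation "P3" => MvPolynomial (Fin 3 × Fin 3) ℝ

lemma isHomogeneous_two {σ : Type*} (a b c d : σ) :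
    (X a * X b + -(X c * X d) : MvPolynomial σ ℝ).IsHomogeneous 2 :=
  ((isHomogeneous_X ℝ a).mul (isHomogeneous_X ℝ b)).add
    ((isHomogeneous_X ℝ c).mul (isHomogeneous_X ℝ d)).neg

lemma degree_le_of_eq_mul {σ : Type*} {p q r : MvPolynomial σ ℝ} {n : ℕ} (hp : p.IsHomogeneous n)
    (hp0 : p ≠ 0) (h : r = p * q) : q = 0 ∨ q.totalDegree + n ≤ r.totalDegree := by
  by_cases hq : q = 0
  · exact Or.inl hq
  · right
    rw [h, totalDegree_mul_of_isDomain hp0 hq, hp.totalDegree hp0, add_comm]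

/-- The determinant is linear in the entry (0, 0), with an irreducible 2×2 minor as leading
coefficient. It is therefore prime as soon as that minor is coprime to the rest, and it has enough
real zeros for `dvd_of_eval_eq_zero`. -/
lemma exists_det_factor_full {Φ : P3} (h : ∀ N, N.det = 0 → evalMatrix N Φ = 0) :
    ∃ Q : P3, (Q = 0 ∨ Q.totalDegree + 3 ≤ Φ.totalDegree) ∧
      ∀ N, evalMatrix N Φ = N.det * evalMatrix N Q := by
  let A : P3 := X (1, 1) * X (2, 2) + -(X (1, 2) * X (2, 1))
  let B : P3 := X (0, 2) * (X (1, 0) * X (2, 1) + -(X (1, 1) * X (2, 0)))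
    + -(X (0, 1) * (X (1, 0) * X (2, 2) + -(X (1, 2) * X (2, 0))))
  have hX : ∀ q : Fin 3 × Fin 3, q ≠ (0, 0) →
      (X q : P3) ∈ supported ℝ ({(0, 0)}ᶜ : Set (Fin 3 × Fin 3)) := fun q hq => X_mem_supported.2 hq
  have hA : A ∈ supported ℝ ({(0, 0)}ᶜ : Set (Fin 3 × Fin 3)) :=
    add_mem (mul_mem (hX _ (by decide)) (hX _ (by decide)))
      (neg_mem (mul_mem (hX _ (by decide)) (hX _ (by decide))))
  have hB : B ∈ supported ℝ ({(0, 0)}ᶜ : Set (Fin 3 × Fin 3)) :=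
    add_mem (mul_mem (hX _ (by decide)) (add_mem (mul_mem (hX _ (by decide)) (hX _ (by decide)))
      (neg_mem (mul_mem (hX _ (by decide)) (hX _ (by decide))))))
      (neg_mem (mul_mem (hX _ (by decide)) (add_mem (mul_mem (hX _ (by decide)) (hX _ (by decide)))
      (neg_mem (mul_mem (hX _ (by decide)) (hX _ (by decide)))))))
  have hAirr : Irreducible A := irreducible_two_by_two (by decide) (by decide) (by decide)
    (by decide) (by decide)
  have hrel : IsRelPrime A B := by
    rw [hAirr.isRelPrime_iff_not_dvd]
    rintro ⟨q, hq⟩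
    -- At this matrix `A` vanishes and `B` equals 1.
    have := congrArg (evalMatrix !![0, 0, 1; 1, 0, 0; 0, 1, 1]) hq
    simp [A, B, evalMatrix] at this
  have hirr : Irreducible (A * X (0, 0) + B) :=
    irreducible_mul_X_add A B (0, 0) hAirr.ne_zero (fun h => mem_supported.1 hA h rfl)
      (fun h => mem_supported.1 hB h rfl) hrel
  have hdet : ∀ v : Fin 3 × Fin 3 → ℝ,
      eval v (A * X (0, 0) + B) = (Matrix.of fun i j => v (i, j)).det := fun v => by
    rw [Matrix.det_fin_three]
    simp [A, B]
    ring
  obtain ⟨Q, hQ⟩ := dvd_of_eval_eq_zero hA hB hAirr.ne_zero hirr.prime (Φ := Φ) fun v hv => by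
    rw [hdet] at hv
    have := h _ hv
    rwa [evalMatrix_eq] at this
  have hhom : (A * X (0, 0) + B).IsHomogeneous 3 :=
    ((isHomogeneous_two _ _ _ _).mul (isHomogeneous_X ℝ _)).add
      (((isHomogeneous_X ℝ _).mul (isHomogeneous_two _ _ _ _)).add
        ((isHomogeneous_X ℝ _).mul (isHomogeneous_two _ _ _ _)).neg)
  refine ⟨Q, degree_le_of_eq_mul hhom hirr.ne_zero hQ, fun N => ?_⟩
  rw [hQ, map_mul, evalMatrix_eq N (_ + _), hdet]
  rfl

/-- The form needed for `K = ℝ`, where only block matrices occur. On these the determinant is the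
middle entry times a 2×2 minor, two non-associated primes, each of which divides `Φ` after the
off-block variables are set to zero. -/
lemma exists_det_factor_block {Φ : P3}
    (h : ∀ N, IsBlock N → N.det = 0 → evalMatrix N Φ = 0) :
    ∃ Q : P3, (Q = 0 ∨ Q.totalDegree + 3 ≤ Φ.totalDegree) ∧
      ∀ N, IsBlock N → evalMatrix N Φ = N.det * evalMatrix N Q := by
  let f : Fin 3 × Fin 3 → P3 := fun q => if (q.1 = 1 ↔ q.2 = 1) then X q else 0
  let Ψ : P3 := aeval f Φ
  have hΨdeg : Ψ.totalDegree ≤ Φ.totalDegree := totalDegree_aeval_le (fun q => by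
    simp only [f]
    split_ifs
    · simp
    · simp) Φ
  have hΨ : ∀ N : Matrix (Fin 3) (Fin 3) ℝ, evalMatrix N Ψ =
      evalMatrix (Matrix.of fun i j => if (i = 1 ↔ j = 1) then N i j else 0) Φ := fun N => by
    simp only [evalMatrix, Ψ]
    rw [← AlgHom.comp_apply, comp_aeval]
    congr 2
    funext q
    simp only [f, Matrix.of_apply]
    split_ifs <;> simp
  have hΨ' : ∀ N, IsBlock N → evalMatrix N Ψ = evalMatrix N Φ := fun N hN => by
    rw [hΨ]
    obtain ⟨h1, h2, h3, h4⟩ := hN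
    have : (Matrix.of fun i j => if (i = 1 ↔ j = 1) then N i j else 0) = N := by
      refine Matrix.ext fun i j => ?_
      fin_cases i <;> fin_cases j <;> simp [h1, h2, h3, h4]
    rw [this]
  let D : P3 := X (0, 0) * X (2, 2) + -(X (0, 2) * X (2, 0))
  have hDirr : Irreducible D := irreducible_two_by_two (by decide) (by decide) (by decide)
    (by decide) (by decide)
  have hproj : ∀ v : Fin 3 × Fin 3 → ℝ,
      IsBlock (Matrix.of fun i j => if (i = 1 ↔ j = 1) then v (i, j) else 0) := fun v => by
    simp [IsBlock]
  have hz : ∀ v : Fin 3 × Fin 3 → ℝ,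
      (v (0, 0) * v (2, 2) - v (0, 2) * v (2, 0)) * v (1, 1) = 0 → eval v Ψ = 0 := fun v hv => by
    have h1 := hΨ (Matrix.of fun i j => v (i, j))
    simp only [Matrix.of_apply] at h1
    rw [h _ (hproj v) (by rw [Matrix.det_fin_three]; simp; linear_combination hv),
      evalMatrix_eq] at h1
    exact h1
  have hsupp : ∀ q r : Fin 3 × Fin 3, q ≠ r → (X q : P3) ∈ supported ℝ ({r}ᶜ : Set _) :=
    fun q r hq => X_mem_supported.2 hq
  obtain ⟨Q₁, hQ₁⟩ : D ∣ Ψ := by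
    refine dvd_of_eval_eq_zero (hsupp _ _ (by decide)) (neg_mem (mul_mem (hsupp _ _ (by decide))
      (hsupp _ _ (by decide)))) (X_ne_zero _) hDirr.prime fun v hv => hz v ?_
    simp only [map_add, map_mul, map_neg, eval_X] at hv
    rw [sub_eq_add_neg, hv, zero_mul]
  have hX1 : (X (1, 1) : P3) = 1 * X (1, 1) + 0 := by ring
  obtain ⟨Q₂, hQ₂⟩ : (X (1, 1) : P3) ∣ Ψ := by
    have hpr : Prime (1 * X (1, 1) + 0 : P3) := by rw [← hX1]; exact X_prime
    have := dvd_of_eval_eq_zero (one_mem _) (zero_mem _) one_ne_zero hpr (Φ := Ψ)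
      fun v hv => hz v (by
        simp only [one_mul, add_zero, eval_X] at hv
        rw [hv, mul_zero])
    rwa [← hX1] at this
  have hnd : ¬ D ∣ X (1, 1) := by
    rintro ⟨q, hq⟩
    -- At the matrix with all entries 1, `D` vanishes and `X (1, 1)` does not.
    have := congrArg (evalMatrix (Matrix.of fun _ _ => (1 : ℝ))) hq
    simp [D, evalMatrix] at this
  obtain ⟨Q, hQ⟩ : D ∣ Q₂ := (hDirr.prime.dvd_or_dvd (hQ₂ ▸ Dvd.intro _ hQ₁.symm)).resolve_left hnd
  have hfac : Ψ = (X (1, 1) * D) * Q := by rw [hQ₂, hQ]; ring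
  have hdeg := degree_le_of_eq_mul ((isHomogeneous_X ℝ (1, 1)).mul (isHomogeneous_two _ _ _ _))
    (mul_ne_zero (X_ne_zero _) hDirr.ne_zero) hfac
  refine ⟨Q, hdeg.imp_right fun h => le_trans h hΨdeg, fun N hN => ?_⟩
  rw [← hΨ' N hN, hfac, map_mul]
  obtain ⟨h1, h2, h3, h4⟩ := hN
  congr 1
  rw [Matrix.det_fin_three]
  simp [D, evalMatrix, h1, h2, h3, h4]
  ring

end Determinant

end MatrixPolynomial

/-! ### Averaging polynomials over a compact group -/

namespace MatrixPolynomial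

open MvPolynomial MeasureTheory

local notation "P3" => MvPolynomial (Fin 3 × Fin 3) ℝ

/-- Left translation of polynomials on `3 × 3` matrices: the polynomial `N ↦ φ (M N)`. -/
noncomputable def act (M : Matrix (Fin 3) (Fin 3) ℝ) : P3 →ₐ[ℝ] P3 :=
  aeval fun q => ∑ l, C (M q.1 l) * X (l, q.2)

lemma evalMatrix_act (M N : Matrix (Fin 3) (Fin 3) ℝ) (φ : P3) :
    evalMatrix N (act M φ) = evalMatrix (M * N) φ := by
  simp only [evalMatrix, act]
  rw [← AlgHom.comp_apply, comp_aeval]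
  congr 2
  funext q
  simp [Matrix.mul_apply]

variable {G : Type*} [TopologicalSpace G]

/-- The polynomial `N ↦ φ (r(g) N)`, with coefficients that are functions of `g`. -/
noncomputable def actFamily (r : G → Matrix (Fin 3) (Fin 3) ℝ) (hr : Continuous r) :
    P3 →ₐ[ℝ] MvPolynomial (Fin 3 × Fin 3) C(G, ℝ) :=
  aeval fun q => ∑ l, C (⟨fun g => r g q.1 l, hr.matrix_elem q.1 l⟩ : C(G, ℝ)) * X (l, q.2)

lemma map_actFamily (r : G → Matrix (Fin 3) (Fin 3) ℝ) (hr : Continuous r) (g : G) (φ : P3) :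
    map (ContinuousMap.evalAlgHom ℝ ℝ g : C(G, ℝ) →+* ℝ) (actFamily r hr φ) = act (r g) φ := by
  induction φ using MvPolynomial.induction_on with
  | C a =>
    rw [show (C a : P3) = algebraMap ℝ P3 a from rfl, AlgHom.commutes, AlgHom.commutes]
    rw [MvPolynomial.algebraMap_apply, map_C]
    rfl
  | add p q hp hq => simp only [map_add, hp, hq]
  | mul_X p i hp =>
    rw [map_mul, map_mul, map_mul, hp]
    congr 1
    simp only [actFamily, act, aeval_X, map_sum, map_mul, map_C, map_X]
    rfl

lemma totalDegree_actFamily_le (r : G → Matrix (Fin 3) (Fin 3) ℝ) (hr : Continuous r) (φ : P3) :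
    (actFamily r hr φ).totalDegree ≤ φ.totalDegree := by
  rw [actFamily, aeval_def, eval₂_eq]
  refine totalDegree_finsetSum_le fun m hm => ?_
  refine (totalDegree_mul _ _).trans ?_
  rw [MvPolynomial.algebraMap_apply, totalDegree_C, zero_add]
  refine (totalDegree_finsetProd _ _).trans ?_
  refine le_trans (Finset.sum_le_sum fun i _ => (totalDegree_pow _ _).trans
    (Nat.mul_le_mul_left _ (?_ : _ ≤ 1))) ?_
  · refine totalDegree_finsetSum_le fun l _ => (totalDegree_mul _ _).trans ?_
    rw [totalDegree_C, zero_add]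
    exact (totalDegree_monomial_le (Finsupp.single (l, i.2) 1) (1 : C(G, ℝ))).trans (by simp)
  · simp only [mul_one]
    exact le_totalDegree hm

variable [CompactSpace G] [MeasurableSpace G] [BorelSpace G] (μ : Measure G) [IsFiniteMeasure μ]

/-- The translates of `φ` form one polynomial over `C(G, ℝ)`, so they share a finite support and can
be integrated coefficient by coefficient. The formula is needed both for `L` and for evaluation at a
matrix, hence the quantifier over `ℓ`. -/
lemma exists_average (r : G → Matrix (Fin 3) (Fin 3) ℝ) (hr : Continuous r) (φ : P3) :
    ∃ Φ : P3, Φ.totalDegree ≤ φ.totalDegree ∧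
      ∀ (ℓ : P3 →ₗ[ℝ] ℂ), ℓ Φ = ∫ g, ℓ (act (r g) φ) ∂μ := by
  let Ψ := actFamily r hr φ
  refine ⟨∑ m ∈ Ψ.support, monomial m (∫ g, coeff m Ψ g ∂μ), ?_, fun ℓ => ?_⟩
  · refine totalDegree_finsetSum_le fun m hm => (totalDegree_monomial_le _ _).trans ?_
    exact (le_totalDegree hm).trans (totalDegree_actFamily_le r hr φ)
  · have e : ∀ g, act (r g) φ = ∑ m ∈ Ψ.support, monomial m (coeff m Ψ g) := fun g => by
      rw [← map_actFamily r hr]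
      conv_lhs => rw [← support_sum_monomial_coeff (actFamily r hr φ), map_sum]
      simp only [map_monomial]
      rfl
    have e2 : ∀ (m : (Fin 3 × Fin 3) →₀ ℕ) (c : ℝ), ℓ (monomial m c) = c • ℓ (monomial m 1) :=
      fun m c => by rw [← map_smul, smul_monomial, smul_eq_mul, mul_one]
    simp only [e, map_sum]
    rw [integral_finsetSum]
    · refine Finset.sum_congr rfl fun m _ => ?_
      rw [e2]
      simp only [e2 m (coeff m Ψ _)]
      rw [integral_smul_const]
    · intro m _
      simp only [e2 m (coeff m Ψ _)]
      have : Continuous fun g => (coeff m Ψ g) • ℓ (monomial m 1) :=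
        (map_continuous (coeff m Ψ)).smul continuous_const
      exact this.integrable_of_hasCompactSupport (HasCompactSupport.of_compactSpace _)

/-- A functional on polynomials on which a compact group acts trivially and an additional element
`t` acts by `-1` is determined by polynomials that vanish at all matrices fixed by an element of the
nontrivial coset. -/
lemma exists_odd_average {G : Type*} [Group G] [TopologicalSpace G] [IsTopologicalGroup G]
    [CompactSpace G] (ρ : G →* Matrix (Fin 3) (Fin 3) ℝ) (hρ : Continuous ρ)
    (t : Matrix (Fin 3) (Fin 3) ℝ) (L : P3 →ₗ[ℝ] ℂ) (hL : ∀ g φ, L (act (ρ g) φ) = L φ)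
    (hLt : ∀ φ, L (act t φ) = -L φ) (φ : P3) :
    ∃ Φ : P3, Φ.totalDegree ≤ φ.totalDegree ∧ L Φ = 2 * L φ ∧
      ∀ N : Matrix (Fin 3) (Fin 3) ℝ, (∃ g, ρ g * (t * N) = N) → evalMatrix N Φ = 0 := by
  let _ : MeasurableSpace G := borel G
  have : BorelSpace G := ⟨rfl⟩
  let μ : Measure G := Measure.haarMeasure ⊤
  have hμ : μ Set.univ = 1 := Measure.haarMeasure_self (K₀ := (⊤ : TopologicalSpace.PositiveCompacts G))
  have : IsProbabilityMeasure μ := ⟨hμ⟩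
  have hr : Continuous fun g : G => ρ g⁻¹ := hρ.comp continuous_inv
  obtain ⟨Ψ, hΨ, h⟩ := exists_average μ _ hr φ
  have hdeg : (act t Ψ).totalDegree ≤ Ψ.totalDegree := totalDegree_aeval_le (fun q => by
    refine totalDegree_finsetSum_le fun l _ => (totalDegree_mul _ _).trans ?_
    rw [totalDegree_C, zero_add, totalDegree_X]) Ψ
  -- `Ψ` is the average of `φ`, so it is constant on orbits. If `ρ g * (t * N) = N`, then `t * N`
  -- and `N` lie in one orbit and the difference vanishes at `N`. Oddness of `L` under `t` gives the
  -- factor 2.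
  refine ⟨Ψ - act t Ψ, ?_, ?_, fun N hN => ?_⟩
  · exact (totalDegree_sub _ _).trans (max_le hΨ (hdeg.trans hΨ))
  · have h1 : L Ψ = L φ := by rw [h L]; simp [hL]
    rw [map_sub, hLt, h1]; ring
  · obtain ⟨g, hg⟩ := hN
    have key : ∀ N, ((evalMatrix N Ψ : ℝ) : ℂ) = ∫ g, ((evalMatrix (ρ g⁻¹ * N) φ : ℝ) : ℂ) ∂μ :=
      fun N => by
        have := h (Complex.ofRealCLM.toLinearMap.comp (evalMatrix N).toLinearMap)
        simpa [evalMatrix_act] using this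
    rw [map_sub, evalMatrix_act, sub_eq_zero]
    apply Complex.ofReal_injective
    -- The average runs over `ρ k⁻¹`, so the left translation `k ↦ g⁻¹ k` inserts `ρ g` next to `t *
    -- N`.
    rw [key, key, ← integral_mul_left_eq_self (μ := μ)
      (fun k => ((evalMatrix (ρ k⁻¹ * (t * N)) φ : ℝ) : ℂ)) g⁻¹]
    congr 1
    funext k
    rw [mul_inv_rev, inv_inv, map_mul, mul_assoc, hg]

end MatrixPolynomial

/-! ### Pauli coordinates -/

namespace GL2Pair

open RCLike

variable {K : Type*} [RCLike K]

local notation "M₂" => Matrix (Fin 2) (Fin 2) K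

/-- The coordinates of the traceless parts of the hermitian and skew-hermitian parts of two matrices
with respect to the Pauli matrices. -/
noncomputable def pauli : Ambient K →ₗ[ℝ] Matrix (Fin 3) (Fin 4) ℝ where
  toFun p := !![
    (re (p.1 0 1) + re (p.1 1 0)) / 2, (im (p.1 0 1) + im (p.1 1 0)) / 2,
    (re (p.2 0 1) + re (p.2 1 0)) / 2, (im (p.2 0 1) + im (p.2 1 0)) / 2;
    (im (p.1 1 0) - im (p.1 0 1)) / 2, (re (p.1 0 1) - re (p.1 1 0)) / 2,
    (im (p.2 1 0) - im (p.2 0 1)) / 2, (re (p.2 0 1) - re (p.2 1 0)) / 2;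
    (re (p.1 0 0) - re (p.1 1 1)) / 2, (im (p.1 0 0) - im (p.1 1 1)) / 2,
    (re (p.2 0 0) - re (p.2 1 1)) / 2, (im (p.2 0 0) - im (p.2 1 1)) / 2]
  map_add' p q := by
    ext i j
    fin_cases i <;> fin_cases j <;> simp <;> ring
  map_smul' c p := by
    ext i j
    fin_cases i <;> fin_cases j <;> simp [RCLike.smul_re, RCLike.smul_im] <;> ring

lemma pauli_apply (p : Ambient K) : pauli p = !![
    (re (p.1 0 1) + re (p.1 1 0)) / 2, (im (p.1 0 1) + im (p.1 1 0)) / 2,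
    (re (p.2 0 1) + re (p.2 1 0)) / 2, (im (p.2 0 1) + im (p.2 1 0)) / 2;
    (im (p.1 1 0) - im (p.1 0 1)) / 2, (re (p.1 0 1) - re (p.1 1 0)) / 2,
    (im (p.2 1 0) - im (p.2 0 1)) / 2, (re (p.2 0 1) - re (p.2 1 0)) / 2;
    (re (p.1 0 0) - re (p.1 1 1)) / 2, (im (p.1 0 0) - im (p.1 1 1)) / 2,
    (re (p.2 0 0) - re (p.2 1 1)) / 2, (im (p.2 0 0) - im (p.2 1 1)) / 2] := rfl

/-- The action of `k` on hermitian matrices, `h ↦ k h k*`, in the basis of Pauli matrices. -/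
noncomputable def rho (k : M₂) : Matrix (Fin 3) (Fin 3) ℝ := !![
  re (k 1 0) * re (k 0 1) + im (k 1 0) * im (k 0 1) + (re (k 1 1) * re (k 0 0) + im (k 1 1) * im (k 0 0)),
  im (k 1 0) * re (k 0 1) - re (k 1 0) * im (k 0 1) - (im (k 1 1) * re (k 0 0) - re (k 1 1) * im (k 0 0)),
  re (k 1 0) * re (k 0 0) + im (k 1 0) * im (k 0 0) - (re (k 1 1) * re (k 0 1) + im (k 1 1) * im (k 0 1));
  im (k 1 0) * re (k 0 1) - re (k 1 0) * im (k 0 1) + (im (k 1 1) * re (k 0 0) - re (k 1 1) * im (k 0 0)),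
  re (k 1 1) * re (k 0 0) + im (k 1 1) * im (k 0 0) - (re (k 1 0) * re (k 0 1) + im (k 1 0) * im (k 0 1)),
  im (k 1 0) * re (k 0 0) - re (k 1 0) * im (k 0 0) - (im (k 1 1) * re (k 0 1) - re (k 1 1) * im (k 0 1));
  re (k 0 0) * re (k 0 1) + im (k 0 0) * im (k 0 1) - (re (k 1 0) * re (k 1 1) + im (k 1 0) * im (k 1 1)),
  im (k 0 0) * re (k 0 1) - re (k 0 0) * im (k 0 1) - (im (k 1 0) * re (k 1 1) - re (k 1 0) * im (k 1 1)),
  (re (k 0 0) ^ 2 + im (k 0 0) ^ 2 - re (k 0 1) ^ 2 - im (k 0 1) ^ 2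
    - re (k 1 0) ^ 2 - im (k 1 0) ^ 2 + re (k 1 1) ^ 2 + im (k 1 1) ^ 2) / 2]

/-- The action of transposition on hermitian matrices in the basis of Pauli matrices. -/
def tauMatrix : Matrix (Fin 3) (Fin 3) ℝ := !![1, 0, 0; 0, -1, 0; 0, 0, 1]

lemma continuous_rho : Continuous (rho : M₂ → Matrix (Fin 3) (Fin 3) ℝ) := by
  have h : ∀ i j, Continuous fun k : M₂ => re (k i j) := fun i j =>
    RCLike.continuous_re.comp (continuous_id.matrix_elem i j)
  have h' : ∀ i j, Continuous fun k : M₂ => im (k i j) := fun i j =>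
    RCLike.continuous_im.comp (continuous_id.matrix_elem i j)
  refine continuous_matrix fun i j => ?_
  fin_cases i <;> fin_cases j <;> simp [rho] <;> fun_prop

section Unitary

lemma unitary_rel {k : M₂} (hk : k * star k = 1) :
    (re (k 0 0) ^ 2 + im (k 0 0) ^ 2 + re (k 0 1) ^ 2 + im (k 0 1) ^ 2 = 1) ∧
    (re (k 1 0) ^ 2 + im (k 1 0) ^ 2 + re (k 1 1) ^ 2 + im (k 1 1) ^ 2 = 1) ∧
    (re (k 0 0) * re (k 1 0) + im (k 0 0) * im (k 1 0) + re (k 0 1) * re (k 1 1)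
      + im (k 0 1) * im (k 1 1) = 0) ∧
    (im (k 0 0) * re (k 1 0) - re (k 0 0) * im (k 1 0) + im (k 0 1) * re (k 1 1)
      - re (k 0 1) * im (k 1 1) = 0) := by
  have h := fun i j => congrFun (congrFun hk i) j
  simp only [Matrix.mul_apply, Fin.sum_univ_two, Matrix.star_apply] at h
  have h00 := congrArg re (h 0 0)
  have h11 := congrArg re (h 1 1)
  have h01 := congrArg re (h 0 1)
  have h01' := congrArg im (h 0 1)
  simp [mul_re, mul_im] at h00 h11 h01 h01'
  refine ⟨?_, ?_, ?_, ?_⟩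
  · linear_combination h00
  · linear_combination h11
  · linear_combination h01
  · linear_combination h01'

/-- `rho` records only the traceless part, so the two sides differ by the traces of `k' σⱼ k'*`
times the Pauli coordinates of `k k*`. These traces equal `tr(σⱼ k'* k')` and vanish when `k'` is
unitary; `h3`, `-h4` and `(h1 - h2) / 2` say exactly this. -/
lemma rho_mul (k k' : M₂) (hk' : star k' * k' = 1) : rho (k * k') = rho k * rho k' := by
  have h : star k' * star (star k') = 1 := by rwa [star_star]
  obtain ⟨h1, h2, h3, h4⟩ := unitary_rel h
  simp only [Matrix.star_apply, star_def, conj_re, conj_im] at h1 h2 h3 h4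
  ext i j
  fin_cases i <;> fin_cases j <;>
    simp [rho, Matrix.mul_apply, Fin.sum_univ_three, Fin.sum_univ_two, mul_re, mul_im]
  · linear_combination ((re (k 1 0) * re (k 0 0) + im (k 1 0) * im (k 0 0) + re (k 1 1) * re (k 0 1) + im (k 1 1) * im (k 0 1)))
      * h3
  · linear_combination ((re (k 1 0) * re (k 0 0) + im (k 1 0) * im (k 0 0) + re (k 1 1) * re (k 0 1) + im (k 1 1) * im (k 0 1)))
      * (-h4)
  · linear_combination ((re (k 1 0) * re (k 0 0) + im (k 1 0) * im (k 0 0) + re (k 1 1) * re (k 0 1) + im (k 1 1) * im (k 0 1)))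
      * ((h1 - h2) / 2)
  · linear_combination ((im (k 1 0) * re (k 0 0) - re (k 1 0) * im (k 0 0) + im (k 1 1) * re (k 0 1) - re (k 1 1) * im (k 0 1)))
      * h3
  · linear_combination ((im (k 1 0) * re (k 0 0) - re (k 1 0) * im (k 0 0) + im (k 1 1) * re (k 0 1) - re (k 1 1) * im (k 0 1)))
      * (-h4)
  · linear_combination ((im (k 1 0) * re (k 0 0) - re (k 1 0) * im (k 0 0) + im (k 1 1) * re (k 0 1) - re (k 1 1) * im (k 0 1)))
      * ((h1 - h2) / 2)
  · linear_combination ((re (k 0 0) ^ 2 + im (k 0 0) ^ 2 + re (k 0 1) ^ 2 + im (k 0 1) ^ 2 - re (k 1 0) ^ 2 - im (k 1 0) ^ 2 - re (k 1 1) ^ 2 - im (k 1 1) ^ 2) / 2)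
      * h3
  · linear_combination ((re (k 0 0) ^ 2 + im (k 0 0) ^ 2 + re (k 0 1) ^ 2 + im (k 0 1) ^ 2 - re (k 1 0) ^ 2 - im (k 1 0) ^ 2 - re (k 1 1) ^ 2 - im (k 1 1) ^ 2) / 2)
      * (-h4)
  · linear_combination ((re (k 0 0) ^ 2 + im (k 0 0) ^ 2 + re (k 0 1) ^ 2 + im (k 0 1) ^ 2 - re (k 1 0) ^ 2 - im (k 1 0) ^ 2 - re (k 1 1) ^ 2 - im (k 1 1) ^ 2) / 2)
      * ((h1 - h2) / 2)

end Unitary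

end GL2Pair

namespace GL2Pair

open RCLike

variable {K : Type*} [RCLike K]

local notation "M₂" => Matrix (Fin 2) (Fin 2) K

/-! ### Symmetries of the Pauli coordinates and of the norm -/

section PauliAction

/-- Conjugation by a unitary matrix respects the hermitian and skew-hermitian parts. The scalar part
of `x` contributes a multiple of `k k* = 1`, which the Pauli coordinates do not see; this accounts
for the multiples of the unitarity relations below. -/
lemma pauli_conj_aux {k : M₂} (hk : k * star k = 1) (x : M₂) (i : Fin 3) :
    pauli (k * x * star k, (0 : M₂)) i 0 = (rho k * pauli (x, (0 : M₂))) i 0 ∧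
    pauli (k * x * star k, (0 : M₂)) i 1 = (rho k * pauli (x, (0 : M₂))) i 1 := by
  obtain ⟨h1, h2, h3, h4⟩ := unitary_rel hk
  have hre : ∀ i j, re ((k * x * star k) i j) =
      (re (k i 0) * re (x 0 0) - im (k i 0) * im (x 0 0) + (re (k i 1) * re (x 1 0)
        - im (k i 1) * im (x 1 0))) * re (k j 0)
      + (re (k i 0) * im (x 0 0) + im (k i 0) * re (x 0 0) + (re (k i 1) * im (x 1 0)
        + im (k i 1) * re (x 1 0))) * im (k j 0)
      + ((re (k i 0) * re (x 0 1) - im (k i 0) * im (x 0 1) + (re (k i 1) * re (x 1 1)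
        - im (k i 1) * im (x 1 1))) * re (k j 1)
      + (re (k i 0) * im (x 0 1) + im (k i 0) * re (x 0 1) + (re (k i 1) * im (x 1 1)
        + im (k i 1) * re (x 1 1))) * im (k j 1)) := fun i j => by
    simp [Matrix.mul_apply, Fin.sum_univ_two, mul_re, mul_im]
  have him : ∀ i j, im ((k * x * star k) i j) =
      (re (k i 0) * im (x 0 0) + im (k i 0) * re (x 0 0) + (re (k i 1) * im (x 1 0)
        + im (k i 1) * re (x 1 0))) * re (k j 0)
      - (re (k i 0) * re (x 0 0) - im (k i 0) * im (x 0 0) + (re (k i 1) * re (x 1 0)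
        - im (k i 1) * im (x 1 0))) * im (k j 0)
      + ((re (k i 0) * im (x 0 1) + im (k i 0) * re (x 0 1) + (re (k i 1) * im (x 1 1)
        + im (k i 1) * re (x 1 1))) * re (k j 1)
      - (re (k i 0) * re (x 0 1) - im (k i 0) * im (x 0 1) + (re (k i 1) * re (x 1 1)
        - im (k i 1) * im (x 1 1))) * im (k j 1)) := fun i j => by
    simp [Matrix.mul_apply, Fin.sum_univ_two, mul_re, mul_im]
    ring
  rw [Matrix.mul_apply, Matrix.mul_apply, Fin.sum_univ_three, Fin.sum_univ_three]
  simp only [pauli_apply, hre, him, rho]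
  fin_cases i
  · constructor
    · simp
      linear_combination (re (x 0 0) + re (x 1 1)) / 2 * h3
    · simp
      linear_combination (im (x 0 0) + im (x 1 1)) / 2 * h3
  · constructor
    · simp
      linear_combination -(re (x 0 0) + re (x 1 1)) / 2 * h4
    · simp
      linear_combination -(im (x 0 0) + im (x 1 1)) / 2 * h4
  · constructor
    · simp
      linear_combination (re (x 0 0) + re (x 1 1)) / 4 * (h1 - h2)
    · simp
      linear_combination (im (x 0 0) + im (x 1 1)) / 4 * (h1 - h2)

lemma pauli_fst (p : Ambient K) (i : Fin 3) : pauli p i 0 = pauli (p.1, (0 : M₂)) i 0 ∧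
    pauli p i 1 = pauli (p.1, (0 : M₂)) i 1 := by
  fin_cases i <;> simp [pauli_apply]

lemma pauli_snd (p : Ambient K) (i : Fin 3) : pauli p i 2 = pauli (p.2, (0 : M₂)) i 0 ∧
    pauli p i 3 = pauli (p.2, (0 : M₂)) i 1 := by
  fin_cases i <;> simp [pauli_apply]

lemma pauli_conj {k : M₂} (hk : k * star k = 1) (p : Ambient K) :
    pauli (k * p.1 * star k, k * p.2 * star k) = rho k * pauli p := by
  have h1 := pauli_conj_aux hk p.1
  have h2 := pauli_conj_aux hk p.2
  simp only [Matrix.mul_apply] at h1 h2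
  ext i j
  have hj : ∀ j, (rho k * pauli p) i j = ∑ l, rho k i l * pauli p l j := fun j =>
    Matrix.mul_apply
  have e1 := fun l => (pauli_fst p l).1
  have e2 := fun l => (pauli_fst p l).2
  have e3 := fun l => (pauli_snd p l).1
  have e4 := fun l => (pauli_snd p l).2
  have e5 := pauli_fst (k * p.1 * star k, k * p.2 * star k) i
  have e6 := pauli_snd (k * p.1 * star k, k * p.2 * star k) i
  have g0 := e5.1.trans (h1 i).1
  have g1 := e5.2.trans (h1 i).2
  have g2 := e6.1.trans (h2 i).1
  have g3 := e6.2.trans (h2 i).2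
  rw [hj]
  revert j
  rw [Fin.forall_fin_succ, Fin.forall_fin_succ, Fin.forall_fin_succ, Fin.forall_fin_succ]
  refine ⟨?_, ?_, ?_, ?_, fun j => j.elim0⟩
  · simp only [e1]
    exact g0
  · simp only [Fin.succ_zero_eq_one, e2]
    exact g1
  · simp only [Fin.succ_zero_eq_one, Fin.succ_one_eq_two, e3]
    exact g2
  · simp only [Fin.succ_zero_eq_one, Fin.succ_one_eq_two, show Fin.succ (2 : Fin 3) = 3 from rfl, e4]
    exact g3

lemma pauli_transpose (p : Ambient K) : pauli (p.1ᵀ, p.2ᵀ) = tauMatrix * pauli p := by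
  ext i j
  fin_cases i <;> fin_cases j <;>
    simp [pauli_apply, tauMatrix, Matrix.mul_apply, Fin.sum_univ_three] <;> ring

lemma pauli_block (hI : (I : K) = 0) (p : Ambient K) : pauli p 0 1 = 0 ∧ pauli p 0 3 = 0 ∧
    pauli p 1 0 = 0 ∧ pauli p 1 2 = 0 ∧ pauli p 2 1 = 0 ∧ pauli p 2 3 = 0 := by
  have h : ∀ z : K, im z = 0 := fun z => im_eq_zero hI z
  simp [pauli_apply, h]

/-- The sum of the squares of the absolute values of the entries. -/
noncomputable def sqNorm (p : Ambient K) : ℝ :=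
  ∑ i, ∑ j, ((re (p.1 i j) ^ 2 + im (p.1 i j) ^ 2) + (re (p.2 i j) ^ 2 + im (p.2 i j) ^ 2))

lemma sqNorm_eq_trace (p : Ambient K) :
    sqNorm p = re (Matrix.trace (p.1 * star p.1)) + re (Matrix.trace (p.2 * star p.2)) := by
  simp [sqNorm, Matrix.trace, Matrix.mul_apply, Fin.sum_univ_two]
  ring

lemma sqNorm_conj {k : M₂} (hk : star k * k = 1) (p : Ambient K) :
    sqNorm (k * p.1 * star k, k * p.2 * star k) = sqNorm p := by
  have h : ∀ x : M₂, Matrix.trace ((k * x * star k) * star (k * x * star k))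
      = Matrix.trace (x * star x) := fun x => by
    rw [star_mul, star_mul, star_star]
    have : k * x * star k * (k * (star x * star k)) = k * (x * star x) * star k := by
      rw [mul_assoc (k * x), ← mul_assoc (star k), hk, one_mul]
      simp only [mul_assoc]
    rw [this, Matrix.trace_mul_comm, ← mul_assoc, hk, one_mul]
  rw [sqNorm_eq_trace, sqNorm_eq_trace, h, h]

lemma sqNorm_transpose (p : Ambient K) : sqNorm (p.1ᵀ, p.2ᵀ) = sqNorm p := by
  simp [sqNorm, Fin.sum_univ_two]
  ring

lemma contDiff_entry (i j : Fin 2) : ContDiff ℝ ∞ (fun p : Ambient K => p.1 i j) ∧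
    ContDiff ℝ ∞ (fun p : Ambient K => p.2 i j) := by
  have h : ContDiff ℝ ∞ (fun x : M₂ => x i j) :=
    ((ContinuousLinearMap.proj j).comp (ContinuousLinearMap.proj i :
      (Fin 2 → Fin 2 → K) →L[ℝ] (Fin 2 → K))).contDiff
  exact ⟨h.comp contDiff_fst, h.comp contDiff_snd⟩

lemma contDiff_sqNorm : ContDiff ℝ ∞ (sqNorm : Ambient K → ℝ) := by
  have hre : ContDiff ℝ ∞ (re : K → ℝ) := (RCLike.reCLM : K →L[ℝ] ℝ).contDiff
  have him : ContDiff ℝ ∞ (im : K → ℝ) := (RCLike.imCLM : K →L[ℝ] ℝ).contDiff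
  unfold sqNorm
  refine ContDiff.sum fun i _ => ContDiff.sum fun j _ => ?_
  have h := contDiff_entry (K := K) i j
  exact (((hre.comp h.1).pow 2).add ((him.comp h.1).pow 2)).add
    (((hre.comp h.2).pow 2).add ((him.comp h.2).pow 2))

lemma norm_le_of_sqNorm_le {p : Ambient K} {R : ℝ} (hR : 0 ≤ R) (h : sqNorm p ≤ R ^ 2) :
    ‖p‖ ≤ R := by
  have key : ∀ i j, ‖p.1 i j‖ ^ 2 + ‖p.2 i j‖ ^ 2 ≤ R ^ 2 := fun i j => by
    refine le_trans ?_ h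
    have e : ∀ z : K, ‖z‖ ^ 2 = re z ^ 2 + im z ^ 2 := fun z => by
      rw [← RCLike.normSq_eq_def', normSq_apply]; ring
    rw [e, e, sqNorm]
    refine le_trans ?_ (Finset.single_le_sum (f := fun i => ∑ j, ((re (p.1 i j) ^ 2
      + im (p.1 i j) ^ 2) + (re (p.2 i j) ^ 2 + im (p.2 i j) ^ 2)))
      (fun i _ => Finset.sum_nonneg fun j _ => by positivity) (Finset.mem_univ i))
    exact Finset.single_le_sum (f := fun j => ((re (p.1 i j) ^ 2
      + im (p.1 i j) ^ 2) + (re (p.2 i j) ^ 2 + im (p.2 i j) ^ 2)))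
      (fun j _ => by positivity) (Finset.mem_univ j)
  refine max_le ?_ ?_
  · refine (Matrix.norm_le_iff hR).2 fun i j => abs_le_of_sq_le_sq' ?_ hR |>.2
    linarith [key i j, sq_nonneg ‖p.2 i j‖]
  · refine (Matrix.norm_le_iff hR).2 fun i j => abs_le_of_sq_le_sq' ?_ hR |>.2
    linarith [key i j, sq_nonneg ‖p.1 i j‖]

end PauliAction

/-! ### Singular matrices are fixed by reflections -/

section Reflection

lemma exists_reflection {w : Fin 3 → ℝ} (hw : w 0 ^ 2 + w 1 ^ 2 + w 2 ^ 2 = 1)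
    (hI : (I : K) = 0 → w 1 = 0 ∨ (w 0 = 0 ∧ w 2 = 0)) :
    ∃ k ∈ Matrix.unitaryGroup (Fin 2) K,
      rho k * tauMatrix = Matrix.of fun i j => (1 : Matrix (Fin 3) (Fin 3) ℝ) i j - 2 * w i * w j := by
  by_cases h : (I : K) = 0 ∧ w 1 ≠ 0
  · obtain ⟨h0, h2⟩ := (hI h.1).resolve_left h.2
    -- Here `w` is plus or minus the middle basis vector, and the reflection along it is `tauMatrix`
    -- itself.
    refine ⟨1, one_mem _, ?_⟩
    rw [h0, h2] at hw
    ext i j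
    fin_cases i <;> fin_cases j <;>
      simp [rho, tauMatrix, Matrix.mul_apply, Fin.sum_univ_three, h0, h2]
    linarith
  · have hI' : im (I : K) * w 1 = w 1 := by
      rcases RCLike.I_eq_zero_or_im_I_eq_one (K := K) with h0 | h0
      · have : w 1 = 0 := by tauto
        simp [this]
      · rw [h0, one_mul]
    -- The reflection along `w` and `tauMatrix` are minus the half-turns about `w` and the middle
    -- axis, so their product is the rotation induced by `(w·σ) σ₂`, with `σ₂` the skew Pauli
    -- matrix. The matrix `k` is `i (w·σ) σ₂`; the phase makes it real when `w 1 = 0`, so one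
    -- formula serves both fields.
    let k : M₂ := !![-((w 0 : K) - (w 1 : K) * I), (w 2 : K); (w 2 : K), (w 0 : K) + (w 1 : K) * I]
    have e00 : re (k 0 0) = -w 0 ∧ im (k 0 0) = w 1 := by simp [k, hI', mul_comm]
    have e01 : re (k 0 1) = w 2 ∧ im (k 0 1) = 0 := by simp [k]
    have e10 : re (k 1 0) = w 2 ∧ im (k 1 0) = 0 := by simp [k]
    have e11 : re (k 1 1) = w 0 ∧ im (k 1 1) = w 1 := by simp [k, hI', mul_comm]
    refine ⟨k, ?_, ?_⟩
    · rw [Matrix.mem_unitaryGroup_iff]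
      ext i j
      rw [Matrix.mul_apply, Fin.sum_univ_two]
      simp only [Matrix.star_apply, star_def]
      apply RCLike.ext
      · fin_cases i <;> fin_cases j <;>
          simp [mul_re, e00, e01, e10, e11] <;>
          first | ring1 | linear_combination hw
      · fin_cases i <;> fin_cases j <;>
          simp [mul_im, e00, e01, e10, e11] <;>
          ring1
    · ext i j
      fin_cases i <;> fin_cases j <;>
        simp [rho, tauMatrix, Matrix.mul_apply, Fin.sum_univ_three, e00, e01, e10, e11] <;>
        first | ring1 | linear_combination hw

/-- A nonzero `w` with `w N = 0` is orthogonal to all columns of `N`, so the reflection along `w`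
fixes `N`. Over ℝ only reflections compatible with the block decomposition are available, and `w` is
replaced by one of its block components, again in the left kernel. -/
lemma exists_unitary_fixing {N : Matrix (Fin 3) (Fin 3) ℝ} (hN : N.det = 0)
    (hI : (I : K) = 0 → MatrixPolynomial.IsBlock N) :
    ∃ k ∈ Matrix.unitaryGroup (Fin 2) K, rho k * (tauMatrix * N) = N := by
  obtain ⟨w, hw0, hw⟩ := Matrix.exists_vecMul_eq_zero_iff.2 hN
  obtain ⟨w', hw0', hw', hI'⟩ : ∃ w' : Fin 3 → ℝ, w' ≠ 0 ∧ w' ᵥ* N = 0 ∧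
      ((I : K) = 0 → w' 1 = 0 ∨ (w' 0 = 0 ∧ w' 2 = 0)) := by
    by_cases h : (I : K) = 0
    · by_cases h02 : w 0 = 0 ∧ w 2 = 0
      · exact ⟨w, hw0, hw, fun _ => Or.inr h02⟩
      · refine ⟨![w 0, 0, w 2], fun h0 => h02 ⟨congrFun h0 0, congrFun h0 2⟩, ?_,
          fun _ => Or.inl rfl⟩
        obtain ⟨b1, b2, b3, b4⟩ := hI h
        ext j
        have := congrFun hw j
        fin_cases j <;>
          simp [Matrix.vecMul, dotProduct, Fin.sum_univ_three, b1, b2, b3, b4] at this ⊢ <;>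
          exact this
    · exact ⟨w, hw0, hw, fun h' => absurd h' h⟩
  have hs : 0 < w' 0 ^ 2 + w' 1 ^ 2 + w' 2 ^ 2 := by
    by_contra hle
    apply hw0'
    ext i
    have h0 := sq_nonneg (w' 0)
    have h1 := sq_nonneg (w' 1)
    have h2 := sq_nonneg (w' 2)
    have : w' i ^ 2 = 0 := by fin_cases i <;> simp <;> nlinarith
    simpa using this
  set s := Real.sqrt (w' 0 ^ 2 + w' 1 ^ 2 + w' 2 ^ 2) with hsdef
  have hs2 : s ^ 2 = w' 0 ^ 2 + w' 1 ^ 2 + w' 2 ^ 2 := Real.sq_sqrt hs.le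
  have hs0 : s ≠ 0 := (Real.sqrt_pos.2 hs).ne'
  obtain ⟨k, hk, hkr⟩ := exists_reflection (K := K) (w := fun i => w' i / s)
    (by rw [div_pow, div_pow, div_pow, ← add_div, ← add_div, ← hs2]; field_simp)
    (fun h => (hI' h).imp (fun h => by simp [h]) fun h => by simp [h.1, h.2])
  refine ⟨k, hk, ?_⟩
  rw [← Matrix.mul_assoc, hkr]
  ext i j
  have := congrFun hw' j
  simp only [Matrix.vecMul, dotProduct, Fin.sum_univ_three, Pi.zero_apply] at this
  have hsum : ∀ i, ∑ l, (1 : Matrix (Fin 3) (Fin 3) ℝ) i l * N l j = N i j := fun i => by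
    rw [← Matrix.mul_apply, one_mul]
  rw [Matrix.mul_apply]
  simp only [Matrix.of_apply, sub_mul, Finset.sum_sub_distrib, hsum]
  rw [Fin.sum_univ_three]
  have h2 : 2 * (w' i / s) * (w' 0 / s) * N 0 j + 2 * (w' i / s) * (w' 1 / s) * N 1 j
      + 2 * (w' i / s) * (w' 2 / s) * N 2 j
      = 2 * (w' i / s) / s * (w' 0 * N 0 j + w' 1 * N 1 j + w' 2 * N 2 j) := by ring
  rw [h2, this, mul_zero, sub_zero]

end Reflection

end GL2Pair

/-! ### Equivariance -/

namespace Nash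

variable {E : Type*} [NormedAddCommGroup E] [NormedSpace ℝ E] [FiniteDimensional ℝ E]
  {U : OpenSet E}

lemma IsTest.comp_linearEquiv {g : E → ℂ} (hg : IsTest U g) (L : E ≃ₗ[ℝ] E)
    (hL : ∀ x, L x ∈ U.carrier ↔ x ∈ U.carrier) : IsTest U (fun x => g (L x)) := by
  refine ⟨hg.contDiff.comp L.toContinuousLinearEquiv.contDiff,
    hg.compact.comp_homeomorph L.toContinuousLinearEquiv.toHomeomorph, fun x hx => ?_⟩
  rw [← hL]
  have h := tsupport_comp_eq_preimage g L.toContinuousLinearEquiv.toHomeomorph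
  have hx' : x ∈ tsupport (g ∘ L.toContinuousLinearEquiv.toHomeomorph) := hx
  rw [h] at hx'
  exact hg.subset hx'

/-- When the Jacobian has absolute value 1, equivariance on densities becomes equivariance on test
functions. It is applied to the density with function part `g ∘ ρ h`, whose push-forward is `g`. -/
lemma pair_comp_of_mem {H : Type*} [Group H] {ρ : H →* (E ≃ₗ[ℝ] E)}
    {hρ : ∀ h x, ρ h x ∈ U.carrier ↔ x ∈ U.carrier} {χ : H →* ℂˣ}
    {T : TemperedGeneralizedFunction U} (hT : T ∈ temperedEquivariant U ρ hρ χ) (h : H)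
    (hdet : |LinearMap.det (ρ h : E →ₗ[ℝ] E)| = 1) {g : E → ℂ} (hg : IsTest U g) :
    pair T g = χ h * pair T (fun x => g (ρ h x)) := by
  have hf := hg.comp_linearEquiv (ρ h) (hρ h)
  have := hT h hf.toSchwartz hf.compact hf.subset
  rw [pair_eq T hg, pair_eq T hf, ← this]
  congr 1
  apply Subtype.ext
  funext y
  change g y = ((|LinearMap.det (ρ h : E →ₗ[ℝ] E)|⁻¹ : ℝ) : ℂ) * g (ρ h ((ρ h).symm y))
  rw [hdet, LinearEquiv.apply_symm_apply]
  simp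

end Nash

/-! ### The action preserves Lebesgue measure -/

namespace GL2Pair

open RCLike Nash

variable {K : Type*} [RCLike K]

local notation "M₂" => Matrix (Fin 2) (Fin 2) K

/-- The real trace form. -/
noncomputable def traceForm : Ambient K →ₗ[ℝ] Module.Dual ℝ (Ambient K) :=
  LinearMap.mk₂ ℝ (fun p q => re (Matrix.trace (p.1 * q.1)) + re (Matrix.trace (p.2 * q.2)))
    (fun p p' q => by simp [add_mul]; ring)
    (fun c p q => by simp [mul_add, RCLike.smul_re])
    (fun p q q' => by simp [mul_add]; ring)
    (fun c p q => by simp [mul_add, RCLike.smul_re])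

lemma traceForm_injective : Function.Injective (traceForm : Ambient K →ₗ[ℝ] _) := by
  rw [injective_iff_map_eq_zero]
  intro p hp
  have h : sqNorm p = 0 := by
    rw [sqNorm_eq_trace]
    exact LinearMap.congr_fun hp (star p.1, star p.2)
  have := norm_le_of_sqNorm_le (p := p) le_rfl (by rw [h]; norm_num)
  exact norm_le_zero_iff.1 this

lemma traceForm_conj (g : GL (Fin 2) K) (p q : Ambient K) :
    traceForm (GL2Pair.conj K g⁻¹ p) q = traceForm p (GL2Pair.conj K g q) := by
  have h : ∀ x y : M₂, Matrix.trace ((g⁻¹).1 * x * (g⁻¹⁻¹).1 * y)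
      = Matrix.trace (x * (g.1 * y * (g⁻¹).1)) := fun x y => by
    rw [inv_inv, mul_assoc, mul_assoc, Matrix.trace_mul_comm]
    simp only [mul_assoc]
  change re _ + re _ = re _ + re _
  exact congrArg₂ (fun a b => re a + re b) (h _ _) (h _ _)

/-- Conjugation by `g⁻¹` is the adjoint of conjugation by `g` for the nondegenerate trace form, so
the two have the same determinant. As they are inverse to each other, its square is 1. -/
lemma abs_det_conj (g : GL (Fin 2) K) :
    |LinearMap.det (GL2Pair.conj K g : Ambient K →ₗ[ℝ] Ambient K)| = 1 := by
  let e : Ambient K ≃ₗ[ℝ] Module.Dual ℝ (Ambient K) :=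
    LinearMap.linearEquivOfInjective traceForm traceForm_injective
      (Subspace.dual_finrank_eq (K := ℝ) (V := Ambient K)).symm
  have h1 : (e : Ambient K →ₗ[ℝ] _) ∘ₗ
      (GL2Pair.conj K g⁻¹ : Ambient K →ₗ[ℝ] Ambient K) ∘ₗ (e.symm : _ →ₗ[ℝ] Ambient K)
      = Module.Dual.transpose (R := ℝ) (GL2Pair.conj K g : Ambient K →ₗ[ℝ] Ambient K) := by
    refine LinearMap.ext fun l => ?_
    obtain ⟨p, rfl⟩ := e.surjective l
    refine LinearMap.ext fun q => ?_
    simp only [LinearMap.comp_apply, LinearEquiv.coe_coe, LinearEquiv.symm_apply_apply]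
    exact traceForm_conj g p q
  have h2 := LinearMap.det_conj (GL2Pair.conj K g⁻¹ : Ambient K →ₗ[ℝ] Ambient K) e
  rw [h1] at h2
  have h3 : LinearMap.det (GL2Pair.conj K g : Ambient K →ₗ[ℝ] Ambient K)
      * LinearMap.det (GL2Pair.conj K g⁻¹ : Ambient K →ₗ[ℝ] Ambient K) = 1 := by
    rw [← LinearMap.det_comp, ← LinearEquiv.coe_trans]
    have : (GL2Pair.conj K g⁻¹).trans (GL2Pair.conj K g) = 1 := by
      rw [← LinearEquiv.mul_eq_trans, ← map_mul]; simp
    rw [this]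
    exact LinearMap.det_id
  rw [← LinearMap.dualMap_def, LinearMap.det_dualMap] at h2
  rw [← h2] at h3
  rcases mul_self_eq_one_iff.1 h3 with h | h <;> rw [h] <;> simp

lemma pair_conj {T : TemperedGeneralizedFunction (M2 K)}
    (hT : T ∈ temperedEquivariant (M2 K) (action K) (action_mem_M2_iff K) (chi K))
    (k : GL (Fin 2) K) {g : Ambient K → ℂ} (hg : IsTest (M2 K) g) :
    pair T (fun p => g (GL2Pair.conj K k p)) = pair T g := by
  have e : action K (SemidirectProduct.inl k) = GL2Pair.conj K k := by
    rw [action, SemidirectProduct.lift_inl]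
  have := pair_comp_of_mem hT (SemidirectProduct.inl k) (by rw [e]; exact abs_det_conj k) hg
  rw [chi_inl, e] at this
  simpa using this.symm

lemma pair_transpose {T : TemperedGeneralizedFunction (M2 K)}
    (hT : T ∈ temperedEquivariant (M2 K) (action K) (action_mem_M2_iff K) (chi K))
    {g : Ambient K → ℂ} (hg : IsTest (M2 K) g) :
    pair T (fun p => g (p.1ᵀ, p.2ᵀ)) = -pair T g := by
  have e : action K (tau K) = transpose K := LinearEquiv.ext fun p => action_tau K p
  have hd : |LinearMap.det (transpose K : Ambient K →ₗ[ℝ] Ambient K)| = 1 := by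
    have h3 : LinearMap.det (transpose K : Ambient K →ₗ[ℝ] Ambient K)
        * LinearMap.det (transpose K : Ambient K →ₗ[ℝ] Ambient K) = 1 := by
      rw [← LinearMap.det_comp]
      convert LinearMap.det_id using 2
      exact LinearMap.ext fun p => (transpose K).left_inv p
    rcases mul_self_eq_one_iff.1 h3 with h | h <;> rw [h] <;> simp
  have := pair_comp_of_mem hT (tau K) (by rw [e]; exact hd) hg
  rw [chi_tau, e] at this
  have h2 : pair T g = -pair T (fun p => g (p.1ᵀ, p.2ᵀ)) := by
    rw [Units.val_neg, Units.val_one, neg_one_mul] at this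
    exact this
  rw [h2, neg_neg]

end GL2Pair

/-! ### Infinitesimal invariance -/

namespace GL2Pair

open RCLike Nash

variable {K : Type*} [RCLike K]

local notation "M₂" => Matrix (Fin 2) (Fin 2) K

/-- Smooth invariant functions on `gl₂(𝕂) × gl₂(𝕂)` that vanish near the complement of `M2 K`. -/
structure IsWeight (h : Ambient K → ℂ) : Prop where
  contDiff : ContDiff ℝ ∞ h
  conj : ∀ g p, h (GL2Pair.conj K g p) = h p
  transpose : ∀ p : Ambient K, h (p.1ᵀ, p.2ᵀ) = h p
  vanish : ∃ ε : ℝ, 0 < ε ∧ ∀ p : Ambient K, normSq p.1.det < ε ∨ normSq p.2.det < ε → h p = 0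

/-- Smooth functions on the line that vanish near `∞`. -/
structure IsCutoff (ψ : ℝ → ℝ) : Prop where
  contDiff : ContDiff ℝ ∞ ψ
  vanish : ∃ c, ∀ s, c ≤ s → ψ s = 0

/-- Integrating from a point beyond which `ψ` vanishes gives a primitive with the same property.
Cutoffs are only required to vanish near `+∞`, since they are evaluated at `|p|² ≥ 0`; compact
support on the line would not pass to primitives. -/
lemma IsCutoff.exists_primitive {ψ : ℝ → ℝ} (hψ : IsCutoff ψ) :
    ∃ Ψ, IsCutoff Ψ ∧ ∀ s, HasDerivAt Ψ (ψ s) s := by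
  obtain ⟨c, hc⟩ := hψ.vanish
  have hd : ∀ s, HasDerivAt (fun s => ∫ t in c..s, ψ t) (ψ s) s := fun s =>
    intervalIntegral.integral_hasDerivAt_right (hψ.contDiff.continuous.intervalIntegrable _ _)
      hψ.contDiff.continuous.aestronglyMeasurable.stronglyMeasurableAtFilter
      hψ.contDiff.continuous.continuousAt
  refine ⟨_, ⟨?_, c, fun s hs => ?_⟩, hd⟩
  · rw [contDiff_infty_iff_deriv]
    refine ⟨fun s => (hd s).differentiableAt, ?_⟩
    rw [show deriv (fun s => ∫ t in c..s, ψ t) = ψ from funext fun s => (hd s).deriv]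
    exact hψ.contDiff
  · refine intervalIntegral.integral_zero_ae (Filter.Eventually.of_forall fun t ht => ?_)
    rw [Set.uIoc_of_le hs] at ht
    exact hc t ht.1.le

/-- The test function `ψ(|p|²) h(p)`. -/
noncomputable def localized (ψ : ℝ → ℝ) (h : Ambient K → ℂ) (p : Ambient K) : ℂ :=
  (ψ (sqNorm p) : ℂ) * h p

lemma isClosed_det_ge (ε : ℝ) :
    IsClosed {p : Ambient K | ε ≤ normSq p.1.det ∧ ε ≤ normSq p.2.det} :=
  (isClosed_le continuous_const (RCLike.continuous_normSq.comp
    (Continuous.matrix_det continuous_fst))).inter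
  (isClosed_le continuous_const (RCLike.continuous_normSq.comp
    (Continuous.matrix_det continuous_snd)))

lemma det_ge_subset {ε : ℝ} (hε : 0 < ε) :
    {p : Ambient K | ε ≤ normSq p.1.det ∧ ε ≤ normSq p.2.det} ⊆ (M2 K).carrier := by
  intro p hp
  refine ⟨fun h0 => ?_, fun h0 => ?_⟩
  · have := hp.1
    rw [h0, map_zero] at this
    exact hε.not_ge this
  · have := hp.2
    rw [h0, map_zero] at this
    exact hε.not_ge this

lemma isCompact_sqNorm_le (c : ℝ) : IsCompact {p : Ambient K | sqNorm p ≤ c} := by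
  refine (isCompact_closedBall (0 : Ambient K) (Real.sqrt |c|)).of_isClosed_subset
    (isClosed_le contDiff_sqNorm.continuous continuous_const) fun p hp => ?_
  rw [mem_closedBall_zero_iff]
  refine norm_le_of_sqNorm_le (Real.sqrt_nonneg _) ?_
  rw [Real.sq_sqrt (abs_nonneg c)]
  exact (hp : sqNorm p ≤ c).trans (le_abs_self c)

lemma isTest_localized {ψ : ℝ → ℝ} {h : Ambient K → ℂ} (hψ : IsCutoff ψ) (hh : IsWeight h) :
    IsTest (M2 K) (localized ψ h) := by
  obtain ⟨c, hc⟩ := hψ.vanish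
  obtain ⟨ε, hε, hv⟩ := hh.vanish
  refine IsTest.of_tsupport_subset ((Complex.ofRealCLM.contDiff.comp
    (hψ.contDiff.comp contDiff_sqNorm)).mul hh.contDiff)
    ((isCompact_sqNorm_le c).inter_right (isClosed_det_ge ε))
    (Set.inter_subset_right.trans (det_ge_subset hε))
    (closure_minimal (fun p hp => ?_) ((isCompact_sqNorm_le c).inter_right
      (isClosed_det_ge ε)).isClosed)
  have h1 : ψ (sqNorm p) ≠ 0 := fun h0 => hp (by simp [localized, h0])
  have h2 : h p ≠ 0 := fun h0 => hp (by simp [localized, h0])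
  refine ⟨?_, ?_, ?_⟩
  · by_contra hlt
    exact h1 (hc _ (not_le.1 hlt).le)
  · by_contra hlt
    exact h2 (hv p (Or.inl (not_le.1 hlt)))
  · by_contra hlt
    exact h2 (hv p (Or.inr (not_le.1 hlt)))

/-- The infinitesimal action `p ↦ ([A, x], [A, y])`. -/
noncomputable def bracket : M₂ →ₗ[ℝ] Ambient K →ₗ[ℝ] Ambient K :=
  LinearMap.mk₂ ℝ (fun A p => (A * p.1 - p.1 * A, A * p.2 - p.2 * A))
    (fun A B p => by ext <;> simp [add_mul, mul_add] <;> ring)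
    (fun c A p => by simp [smul_sub])
    (fun A p q => by ext <;> simp [add_mul, mul_add] <;> ring)
    (fun c A p => by simp [smul_sub])

lemma bracket_apply (A : M₂) (p : Ambient K) :
    bracket A p = (A * p.1 - p.1 * A, A * p.2 - p.2 * A) := rfl

/-- The linear map `p ↦ (n x n, n y n)`. -/
noncomputable def sandwich (n : M₂) : Ambient K →ₗ[ℝ] Ambient K where
  toFun p := (n * p.1 * n, n * p.2 * n)
  map_add' p q := by simp [mul_add, add_mul]
  map_smul' c p := by simp

/-- The element `1 + t n` for `n` with `n² = 0`. -/
noncomputable def unipotent (n : M₂) (hn : n * n = 0) (t : ℝ) : GL (Fin 2) K where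
  val := 1 + t • n
  inv := 1 - t • n
  val_inv := by simp [add_mul, mul_sub, hn]
  inv_val := by simp [sub_mul, mul_add, hn]

/-- For square-zero `n` the one-parameter group through `n` is polynomial in `t`, so the action can
be differentiated without the matrix exponential. -/
lemma conj_unipotent {n : M₂} (hn : n * n = 0) (t : ℝ) (p : Ambient K) :
    GL2Pair.conj K (unipotent n hn t) p = p + t • bracket n p - t ^ 2 • sandwich n p := by
  have h : ∀ x : M₂, (1 + t • n) * x * (1 - t • n)
      = x + t • (n * x - x * n) - t ^ 2 • (n * x * n) := fun x => by
    simp only [add_mul, mul_sub, one_mul, mul_one, smul_mul_assoc, mul_smul_comm, smul_sub, smul_add,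
      pow_two, mul_smul]
    abel
  exact Prod.ext (h p.1) (h p.2)

/-- The derivative of `sqNorm` along the vector field `p ↦ [A, p]`. -/
noncomputable def moment (A : M₂) (p : Ambient K) : ℝ :=
  ∑ i, ∑ j, ((2 * re (p.1 i j) * re ((bracket A p).1 i j)
    + 2 * im (p.1 i j) * im ((bracket A p).1 i j))
    + (2 * re (p.2 i j) * re ((bracket A p).2 i j)
    + 2 * im (p.2 i j) * im ((bracket A p).2 i j)))

lemma hasDerivAt_quadratic (a b c : ℝ) :
    HasDerivAt (fun t : ℝ => a + t * b - t ^ 2 * c) b 0 := by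
  refine (HasDerivAt.fun_sub (((hasDerivAt_id' (0 : ℝ)).mul_const b).const_add a)
    (((hasDerivAt_id' (0 : ℝ)).fun_pow 2).mul_const c)).congr_deriv ?_
  simp

lemma hasDerivAt_sqNorm (n : M₂) (p : Ambient K) :
    HasDerivAt (fun t : ℝ => sqNorm (p + t • bracket n p - t ^ 2 • sandwich n p))
      (moment n p) 0 := by
  have e : ∀ a b c : K, HasDerivAt (fun t : ℝ => re (a + t • b - t ^ 2 • c) ^ 2
      + im (a + t • b - t ^ 2 • c) ^ 2) (2 * re a * re b + 2 * im a * im b) 0 := fun a b c => by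
    have h1 := (hasDerivAt_quadratic (re a) (re b) (re c)).fun_pow 2
    have h2 := (hasDerivAt_quadratic (im a) (im b) (im c)).fun_pow 2
    simpa [RCLike.smul_re, RCLike.smul_im] using h1.fun_add h2
  exact HasDerivAt.fun_sum fun i _ => HasDerivAt.fun_sum fun j _ => (e _ _ _).add (e _ _ _)

lemma moment_add (A B : M₂) (p : Ambient K) : moment (A + B) p = moment A p + moment B p := by
  simp only [moment, map_add, LinearMap.add_apply, ← Finset.sum_add_distrib, Prod.fst_add,
    Prod.snd_add, Matrix.add_apply]
  exact Finset.sum_congr rfl fun i _ => Finset.sum_congr rfl fun j _ => by ring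

lemma moment_smul (c : ℝ) (A : M₂) (p : Ambient K) : moment (c • A) p = c * moment A p := by
  simp only [moment, map_smul, LinearMap.smul_apply, Finset.mul_sum, Prod.smul_fst,
    Prod.smul_snd, Matrix.smul_apply, RCLike.smul_re, RCLike.smul_im]
  exact Finset.sum_congr rfl fun i _ => Finset.sum_congr rfl fun j _ => by ring

lemma contDiff_moment (A : M₂) : ContDiff ℝ ∞ (moment A : Ambient K → ℝ) := by
  have hre : ContDiff ℝ ∞ (re : K → ℝ) := (RCLike.reCLM : K →L[ℝ] ℝ).contDiff
  have him : ContDiff ℝ ∞ (im : K → ℝ) := (RCLike.imCLM : K →L[ℝ] ℝ).contDiff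
  have hb : ContDiff ℝ ∞ (bracket A : Ambient K → Ambient K) :=
    (LinearMap.toContinuousLinearMap (bracket A)).contDiff
  unfold moment
  refine ContDiff.sum fun i _ => ContDiff.sum fun j _ => ?_
  have h := contDiff_entry (K := K) i j
  have h1 := h.1.comp hb
  have h2 := h.2.comp hb
  exact (((contDiff_const.mul (hre.comp h.1)).mul (hre.comp h1)).add
    ((contDiff_const.mul (him.comp h.1)).mul (him.comp h1))).add
    (((contDiff_const.mul (hre.comp h.2)).mul (hre.comp h2)).add
    ((contDiff_const.mul (him.comp h.2)).mul (him.comp h2)))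

variable {T : TemperedGeneralizedFunction (M2 K)}

/-- The function in the pairing is the derivative at `t = 0` of `l ^ k Ψ(|·|²) h` along conjugation
by `1 + t n`; by invariance of `T` the pairing does not depend on `t`. -/
lemma pair_nilpotent
    (hT : T ∈ temperedEquivariant (M2 K) (action K) (action_mem_M2_iff K) (chi K))
    {n : M₂} (hn : n * n = 0) (l : Module.Dual ℝ (Ambient K)) (k : ℕ) {Ψ ψ : ℝ → ℝ}
    (hΨ : IsCutoff Ψ) (hd : ∀ s, HasDerivAt Ψ (ψ s) s) {h : Ambient K → ℂ} (hh : IsWeight h) :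
    pair T (fun p => ((k * l p ^ (k - 1) * l (bracket n p) : ℝ) : ℂ) * localized Ψ h p
      + ((l p ^ k * moment n p : ℝ) : ℂ) * localized ψ h p) = 0 := by
  obtain ⟨c, hc⟩ := hΨ.vanish
  obtain ⟨ε, hε, hv⟩ := hh.vanish
  let γ : ℝ × Ambient K → Ambient K := fun q =>
    q.2 + q.1 • bracket n q.2 - q.1 ^ 2 • sandwich n q.2
  have hb : ContDiff ℝ ∞ (bracket n : Ambient K → Ambient K) :=
    (LinearMap.toContinuousLinearMap (bracket n)).contDiff
  have hs : ContDiff ℝ ∞ (sandwich n : Ambient K → Ambient K) :=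
    (LinearMap.toContinuousLinearMap (sandwich n)).contDiff
  have hγ : ContDiff ℝ ∞ γ :=
    (contDiff_snd.add (contDiff_fst.smul (hb.comp contDiff_snd))).sub
      ((contDiff_fst.pow 2).smul (hs.comp contDiff_snd))
  have hl : ContDiff ℝ ∞ l := (LinearMap.toContinuousLinearMap l).contDiff
  -- The weight is evaluated at `q.2` and not at `γ q`: it is invariant, so no derivative falls on
  -- it.
  let H : ℝ × Ambient K → ℂ := fun q =>
    ((l (γ q) ^ k * Ψ (sqNorm (γ q)) : ℝ) : ℂ) * h q.2
  have hH : ContDiff ℝ ∞ H := (Complex.ofRealCLM.contDiff.comp (((hl.comp hγ).pow k).mul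
    (hΨ.contDiff.comp (contDiff_sqNorm.comp hγ)))).mul (hh.contDiff.comp contDiff_snd)
  have hconj : ∀ t p, γ (t, p) = GL2Pair.conj K (unipotent n hn t) p := fun t p =>
    (conj_unipotent hn t p).symm
  have hH0 : ∀ t, (fun p => H (t, p)) = fun p => H (0, GL2Pair.conj K (unipotent n hn t) p) := by
    intro t
    funext p
    have h0 : γ (0, γ (t, p)) = γ (t, p) := by simp [γ]
    simp only [H]
    rw [← hconj, h0, hconj, hh.conj]
  have htest : IsTest (M2 K) (fun p => H (0, p)) := by
    have := (isTest_localized hΨ hh).mul_left (Complex.ofRealCLM.contDiff.comp (hl.pow k))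
    convert this using 2 with p
    simp [H, γ, localized, mul_assoc]
  -- One compact set must contain the supports for all `|t| ≤ 1`. If `H (t, p) ≠ 0`, then `γ (t, p)`
  -- has bounded norm and `p = γ (-t, γ (t, p))`.
  have hS : IsCompact (γ '' (Set.Icc (-1) 1 ×ˢ {p : Ambient K | sqNorm p ≤ c})
      ∩ {p : Ambient K | ε ≤ normSq p.1.det ∧ ε ≤ normSq p.2.det}) :=
    ((isCompact_Icc.prod (isCompact_sqNorm_le c)).image hγ.continuous).inter_right
      (isClosed_det_ge ε)
  have key := pair_deriv_eq_zero T hS (Set.inter_subset_right.trans (det_ge_subset hε)) hH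
    (fun t ht p hp => ?_) (fun t _ => ?_)
  · rw [← key]
    congr 1
    funext p
    have h1 : HasDerivAt (fun t : ℝ => H (t, p)) (fderiv ℝ H (0, p) (1, 0)) 0 :=
      HasFDerivAt.comp_hasDerivAt (f := fun t : ℝ => (t, p)) (0 : ℝ)
        (hH.differentiable (by simp)).differentiableAt.hasFDerivAt ((hasDerivAt_id (0 : ℝ)).prodMk (hasDerivAt_const (0 : ℝ) p))
    refine HasDerivAt.unique ?_ h1
    have hq : γ (0, p) = p := by simp [γ]
    have h2 : HasDerivAt (fun t : ℝ => l (γ (t, p))) (l (bracket n p)) 0 := by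
      simpa [γ] using hasDerivAt_quadratic (l p) (l (bracket n p)) (l (sandwich n p))
    have h3 : HasDerivAt (fun t : ℝ => Ψ (sqNorm (γ (t, p)))) (ψ (sqNorm p) * moment n p) 0 := by
      have := hasDerivAt_sqNorm n p
      refine HasDerivAt.comp (0 : ℝ) (h₂ := Ψ) ?_ this
      rw [hq]
      exact hd (sqNorm p)
    have h4 := ((h2.fun_pow k).fun_mul h3).ofReal_comp.mul_const (h p)
    refine h4.congr_deriv ?_
    rw [hq, localized, localized]
    push_cast
    ring
  · by_contra hne
    refine hp ⟨⟨(-t, γ (t, p)), ⟨⟨by linarith [(abs_le.1 ht).2], by linarith [(abs_le.1 ht).1]⟩, ?_⟩,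
      ?_⟩, ?_, ?_⟩
    · by_contra hlt
      exact hne (by simp [H, hc _ (not_le.1 hlt).le])
    · rw [hconj, hconj, ← LinearEquiv.mul_apply, ← map_mul]
      have : unipotent n hn (-t) * unipotent n hn t = 1 := by
        apply Units.ext
        simp [unipotent, add_mul, mul_add, hn]
      rw [this]
      simp
    · by_contra hlt
      exact hne (by simp [H, hv p (Or.inl (not_le.1 hlt))])
    · by_contra hlt
      exact hne (by simp [H, hv p (Or.inr (not_le.1 hlt))])
  · rw [hH0]
    exact pair_conj hT _ htest

/-- The real span of the nilpotent matrices. -/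
noncomputable def nilpotentSpan (K : Type*) [RCLike K] : Submodule ℝ (Matrix (Fin 2) (Fin 2) K) :=
  Submodule.span ℝ {n | n * n = 0}

lemma pair_infinitesimal
    (hT : T ∈ temperedEquivariant (M2 K) (action K) (action_mem_M2_iff K) (chi K))
    {A : M₂} (hA : A ∈ nilpotentSpan K) (l : Module.Dual ℝ (Ambient K)) (k : ℕ) {Ψ ψ : ℝ → ℝ}
    (hΨ : IsCutoff Ψ) (hψ : IsCutoff ψ) (hd : ∀ s, HasDerivAt Ψ (ψ s) s) {h : Ambient K → ℂ}
    (hh : IsWeight h) :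
    pair T (fun p => ((k * l p ^ (k - 1) * l (bracket A p) : ℝ) : ℂ) * localized Ψ h p
      + ((l p ^ k * moment A p : ℝ) : ℂ) * localized ψ h p) = 0 := by
  have hl : ContDiff ℝ ∞ l := (LinearMap.toContinuousLinearMap l).contDiff
  have hb : ∀ A, ContDiff ℝ ∞ (bracket A : Ambient K → Ambient K) := fun A =>
    (LinearMap.toContinuousLinearMap (bracket A)).contDiff
  have htest : ∀ A, IsTest (M2 K) (fun p => ((k * l p ^ (k - 1) * l (bracket A p) : ℝ) : ℂ)
      * localized Ψ h p + ((l p ^ k * moment A p : ℝ) : ℂ) * localized ψ h p) := fun A =>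
    ((isTest_localized hΨ hh).mul_left (Complex.ofRealCLM.contDiff.comp
      ((contDiff_const.mul (hl.pow _)).mul (hl.comp (hb A))))).add
    ((isTest_localized hψ hh).mul_left (Complex.ofRealCLM.contDiff.comp
      ((hl.pow _).mul (contDiff_moment A))))
  induction hA using Submodule.span_induction with
  | mem n hn => exact pair_nilpotent hT hn l k hΨ hd hh
  | zero =>
    have h0 : ∀ p : Ambient K, moment 0 p = 0 := fun p => by
      simpa using moment_smul (0 : ℝ) (0 : M₂) p
    simp only [map_zero, LinearMap.zero_apply, h0]
    simpa using pair_zero T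
  | add A B _ _ hA hB =>
    have := pair_add T (htest A) (htest B)
    rw [hA, hB, add_zero] at this
    rw [← this]
    congr 1
    funext p
    simp only [moment_add, map_add, LinearMap.add_apply]
    push_cast
    ring
  | smul c A _ hA =>
    have := pair_const_mul T (htest A) c
    rw [hA, mul_zero] at this
    rw [← this]
    congr 1
    funext p
    simp only [moment_smul, map_smul, LinearMap.smul_apply, smul_eq_mul]
    push_cast
    ring

end GL2Pair

/-! ### Powers of linear forms -/

namespace MatrixPolynomial

open MvPolynomial

/-- A linear functional that kills `W` but not `a k` would turn the curve into a nonzero real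
polynomial in `t` with every real number as a root. -/
lemma mem_of_forall_sum_pow_smul_mem {M : Type*} [AddCommGroup M] [Module ℝ M] (W : Submodule ℝ M)
    (a : ℕ → M) (N : ℕ) (h : ∀ t : ℝ, ∑ k ∈ Finset.range N, t ^ k • a k ∈ W) {k : ℕ} (hk : k < N) :
    a k ∈ W := by
  by_contra hW
  obtain ⟨f, hf, hfW⟩ := Submodule.exists_dual_map_eq_bot_of_notMem hW inferInstance
  have hp : ∑ k ∈ Finset.range N, Polynomial.C (f (a k)) * Polynomial.X ^ k = 0 := by
    refine Polynomial.funext fun t => ?_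
    have : f (∑ k ∈ Finset.range N, t ^ k • a k) = 0 := by
      have := Submodule.mem_map_of_mem (f := f) (h t)
      rwa [hfW, Submodule.mem_bot] at this
    simp only [map_sum, map_smul, smul_eq_mul] at this
    rw [Polynomial.eval_finsetSum, Polynomial.eval_zero, ← this]
    exact Finset.sum_congr rfl fun k _ => by
      rw [Polynomial.eval_mul, Polynomial.eval_C, Polynomial.eval_pow, Polynomial.eval_X, mul_comm]
  have := congrArg (fun p => p.coeff k) hp
  simp only [Polynomial.finsetSum_coeff, Polynomial.coeff_C_mul_X_pow, Polynomial.coeff_zero] at this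
  rw [Finset.sum_ite_eq (Finset.range N) k, if_pos (Finset.mem_range.2 hk)] at this
  exact hf this

variable {σ : Type*} [Fintype σ]

/-- The linear form with coefficients `c`. -/
noncomputable def linearForm (c : σ → ℝ) : MvPolynomial σ ℝ := ∑ q, C (c q) * X q

lemma linearForm_add_smul (c d : σ → ℝ) (t : ℝ) :
    linearForm (c + t • d) = t • linearForm d + linearForm c := by
  simp only [linearForm, Finset.smul_sum, ← Finset.sum_add_distrib, smul_eq_C_mul]
  refine Finset.sum_congr rfl fun q _ => ?_
  simp
  ring

lemma totalDegree_linearForm_le (c : σ → ℝ) : (linearForm c).totalDegree ≤ 1 :=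
  totalDegree_finsetSum_le fun q _ => (totalDegree_mul _ _).trans (by simp)

/-- The span of the `k`-th powers of linear forms. -/
noncomputable def powerSpan (σ : Type*) [Fintype σ] (k : ℕ) : Submodule ℝ (MvPolynomial σ ℝ) :=
  Submodule.span ℝ (Set.range fun c : σ → ℝ => linearForm c ^ k)

/-- Up to the factor `k + 1`, the product `c ^ k d` is the coefficient of `t` in `(c + t d) ^ (k +
1)`. -/
lemma mul_linearForm_mem {k : ℕ} {F : MvPolynomial σ ℝ} (hF : F ∈ powerSpan σ k) (d : σ → ℝ) :
    F * linearForm d ∈ powerSpan σ (k + 1) := by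
  induction hF using Submodule.span_induction with
  | mem F hF =>
    obtain ⟨c, rfl⟩ := hF
    have := mem_of_forall_sum_pow_smul_mem (powerSpan σ (k + 1))
      (fun m => linearForm d ^ m * linearForm c ^ (k + 1 - m) * ((k + 1).choose m : MvPolynomial σ ℝ))
      (k + 2) (fun t => ?_) (k := 1) (by omega)
    · have h2 := (powerSpan σ (k + 1)).smul_mem ((k + 1 : ℝ)⁻¹) this
      convert h2 using 1
      have hk : (k + 1 : ℝ) ≠ 0 := by positivity
      simp only [pow_one, Nat.add_sub_cancel, Nat.choose_one_right]
      rw [smul_eq_C_mul, show (((k + 1 : ℕ)) : MvPolynomial σ ℝ) = C (k + 1 : ℝ) by simp]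
      rw [mul_comm _ (C (k + 1 : ℝ)), ← mul_assoc, ← C_mul, inv_mul_cancel₀ hk]
      simp [mul_comm]
    · refine Submodule.subset_span ⟨c + t • d, ?_⟩
      simp only
      rw [linearForm_add_smul, add_pow]
      refine Finset.sum_congr rfl fun m _ => ?_
      rw [smul_pow, smul_mul_assoc, smul_mul_assoc]
  | zero => simp
  | add F G _ _ hF hG => rw [add_mul]; exact add_mem hF hG
  | smul a F _ hF => rw [smul_mul_assoc]; exact Submodule.smul_mem _ _ hF

lemma monomial_mem_powerSpan (k : ℕ) : ∀ s : σ →₀ ℕ, (s.sum fun _ e => e) = k →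
    (monomial s 1 : MvPolynomial σ ℝ) ∈ powerSpan σ k := by
  classical
  induction k with
  | zero =>
    intro s hs
    have : s = 0 := by
      ext i
      by_contra hi
      have := Finset.sum_eq_zero_iff.1 hs i (Finsupp.mem_support_iff.2 hi)
      exact hi this
    exact Submodule.subset_span ⟨0, by simp [this]⟩
  | succ k ih =>
    intro s hs
    obtain ⟨i, hi⟩ : ∃ i, s i ≠ 0 := by
      by_contra! h0
      have : s = 0 := Finsupp.ext h0
      simp [this] at hs
    have e : s - Finsupp.single i 1 + Finsupp.single i 1 = s := by
      ext j
      by_cases hj : i = j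
      · subst hj; simp; omega
      · simp [Finsupp.single_eq_of_ne' hj]
    have hdeg : ((s - Finsupp.single i 1).sum fun _ e => e) = k := by
      have h := Finsupp.sum_add_index' (f := s - Finsupp.single i 1) (g := Finsupp.single i 1)
        (h := fun _ e => e) (fun _ => rfl) (fun _ _ _ => rfl)
      rw [e, hs, Finsupp.sum_single_index rfl] at h
      omega
    rw [← e, monomial_add_single, pow_one]
    convert mul_linearForm_mem (ih _ hdeg) (Pi.single i 1) using 2
    rw [linearForm, Finset.sum_eq_single i]
    · simp
    · intro j _ hj
      simp [Pi.single_eq_of_ne hj]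
    · simp

/-- Polarization: a polynomial is a linear combination of powers of linear forms. -/
lemma eq_zero_of_linearForm_pow {M : Type*} [AddCommGroup M] [Module ℝ M]
    (Λ : MvPolynomial σ ℝ →ₗ[ℝ] M) {F : MvPolynomial σ ℝ}
    (h : ∀ c, ∀ k ≤ F.totalDegree, Λ (linearForm c ^ k) = 0) : Λ F = 0 := by
  rw [F.as_sum, map_sum]
  refine Finset.sum_eq_zero fun s hs => ?_
  have h1 : powerSpan σ (s.sum fun _ e => e) ≤ LinearMap.ker Λ := by
    refine Submodule.span_le.2 ?_
    rintro _ ⟨c, rfl⟩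
    exact h c _ (le_totalDegree hs)
  have h2 : monomial s (coeff s F) = coeff s F • (monomial s 1 : MvPolynomial σ ℝ) := by
    rw [smul_monomial, smul_eq_mul, mul_one]
  rw [h2, map_smul, LinearMap.mem_ker.1 (h1 (monomial_mem_powerSpan _ s rfl)), smul_zero]

variable {m n : Type*}

lemma evalMatrix_linearForm [Fintype m] [Fintype n] (c : m × n → ℝ) (V : Matrix m n ℝ) :
    evalMatrix V (linearForm c) = ∑ q, c q * V q.1 q.2 := by
  simp [linearForm, evalMatrix]

lemma exists_linearForm [Fintype m] [Fintype n] [DecidableEq m] [DecidableEq n] (l : Module.Dual ℝ (Matrix m n ℝ)) :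
    ∃ c : m × n → ℝ, ∀ V, l V = evalMatrix V (linearForm c) := by
  refine ⟨fun q => l (Matrix.single q.1 q.2 1), fun V => ?_⟩
  rw [evalMatrix_linearForm, Fintype.sum_prod_type]
  conv_lhs => rw [Matrix.matrix_eq_sum_single V]
  simp only [map_sum]
  refine Finset.sum_congr rfl fun i _ => Finset.sum_congr rfl fun j _ => ?_
  rw [show Matrix.single i j (V i j) = V i j • Matrix.single i j (1 : ℝ) by simp, map_smul,
    smul_eq_mul, mul_comm]

section Functional

open Nash

variable {E : Type*} [NormedAddCommGroup E] [NormedSpace ℝ E] [FiniteDimensional ℝ E]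
  {U : OpenSet E}

lemma contDiff_evalMatrix (V : E →ₗ[ℝ] Matrix m n ℝ) (F : MvPolynomial (m × n) ℝ) :
    ContDiff ℝ ∞ (fun p => (evalMatrix (V p) F : ℂ)) := by
  refine Complex.ofRealCLM.contDiff.comp (?_ : ContDiff ℝ ∞ fun p => evalMatrix (V p) F)
  induction F using MvPolynomial.induction_on with
  | C a => simpa [evalMatrix] using contDiff_const
  | add F G hF hG => simpa only [map_add] using hF.add hG
  | mul_X F q hF =>
    simp only [map_mul]
    refine hF.mul ?_
    have e : (fun p => evalMatrix (V p) (X q)) = (Matrix.entryLinearMap ℝ ℝ q.1 q.2).comp V := by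
      funext p
      simp [evalMatrix]
    rw [e]
    exact (LinearMap.toContinuousLinearMap ((Matrix.entryLinearMap ℝ ℝ q.1 q.2).comp V)).contDiff

/-- The functional `F ↦ ⟨T, F(V(p)) g(p)⟩`. -/
noncomputable def polynomialPair (T : TemperedGeneralizedFunction U) (V : E →ₗ[ℝ] Matrix m n ℝ)
    {g : E → ℂ} (hg : IsTest U g) : MvPolynomial (m × n) ℝ →ₗ[ℝ] ℂ where
  toFun F := pair T (fun p => (evalMatrix (V p) F : ℂ) * g p)
  map_add' F G := by
    rw [← pair_add T (hg.mul_left (contDiff_evalMatrix V F)) (hg.mul_left (contDiff_evalMatrix V G))]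
    congr 1
    funext p
    simp only [map_add]
    push_cast
    ring
  map_smul' a F := by
    rw [RingHom.id_apply, Complex.real_smul,
      ← pair_const_mul T (hg.mul_left (contDiff_evalMatrix V F))]
    congr 1
    funext p
    simp only [map_smul, smul_eq_mul]
    push_cast
    ring

lemma polynomialPair_apply (T : TemperedGeneralizedFunction U) (V : E →ₗ[ℝ] Matrix m n ℝ)
    {g : E → ℂ} (hg : IsTest U g) (F : MvPolynomial (m × n) ℝ) :
    polynomialPair T V hg F = pair T (fun p => (evalMatrix (V p) F : ℂ) * g p) := rfl

end Functional

section Lift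

/-- The polynomial `V ↦ φ (V Cᵀ)`. -/
noncomputable def liftRight {k : Type*} [Fintype n] (c : Matrix k n ℝ) :
    MvPolynomial (m × k) ℝ →ₐ[ℝ] MvPolynomial (m × n) ℝ :=
  aeval fun q => ∑ l, C (c q.2 l) * X (q.1, l)

lemma evalMatrix_liftRight {k : Type*} [Fintype n] (c : Matrix k n ℝ) (V : Matrix m n ℝ)
    (φ : MvPolynomial (m × k) ℝ) : evalMatrix V (liftRight c φ) = evalMatrix (V * cᵀ) φ := by
  simp only [evalMatrix, liftRight]
  rw [← AlgHom.comp_apply, comp_aeval]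
  congr 2
  funext q
  simp [Matrix.mul_apply, mul_comm]

lemma totalDegree_liftRight_le {k : Type*} [Fintype n] (c : Matrix k n ℝ) (φ : MvPolynomial (m × k) ℝ) :
    (liftRight (m := m) c φ).totalDegree ≤ φ.totalDegree :=
  totalDegree_aeval_le (fun q => totalDegree_finsetSum_le fun l _ =>
    (totalDegree_mul _ _).trans (by simp)) φ

end Lift

/-! ### Maximal minors of a 3×4 matrix -/

section CauchyBinet

/-- `v₁ × v₂ + v₃ × v₄`, where the `vᵢ` are the columns of `V`. -/
def crossSum (V : Matrix (Fin 3) (Fin 4) ℝ) : Fin 3 → ℝ :=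
  ![V 1 0 * V 2 1 - V 2 0 * V 1 1 + (V 1 2 * V 2 3 - V 2 2 * V 1 3),
    V 2 0 * V 0 1 - V 0 0 * V 2 1 + (V 2 2 * V 0 3 - V 0 2 * V 2 3),
    V 0 0 * V 1 1 - V 1 0 * V 0 1 + (V 0 2 * V 1 3 - V 1 2 * V 0 3)]

/-- The minor of `c` with columns `i`, `j`, `k`. -/
def minor (c : Matrix (Fin 3) (Fin 4) ℝ) (i j k : Fin 4) : ℝ :=
  c 0 i * (c 1 j * c 2 k - c 1 k * c 2 j) - c 0 j * (c 1 i * c 2 k - c 1 k * c 2 i)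
    + c 0 k * (c 1 i * c 2 j - c 1 j * c 2 i)

/-- Cauchy-Binet, together with the fact that each maximal minor of `V` is the scalar product of
`crossSum V` with a column: pairing `v₁ × v₂ + v₃ × v₄` with `v₃` leaves only `det (v₁, v₂, v₃)`,
and similarly for the other columns. This puts the determinant into the ideal of the components of
the moment map. -/
lemma det_mul_transpose (V c : Matrix (Fin 3) (Fin 4) ℝ) : (V * cᵀ).det = ∑ j, crossSum V j *
    evalMatrix V (linearForm fun q => if q.1 = j then
      (![minor c 0 2 3, minor c 1 2 3, minor c 0 1 2, minor c 0 1 3] : Fin 4 → ℝ) q.2 else 0) := by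
  simp only [evalMatrix_linearForm, Fintype.sum_prod_type, Fin.sum_univ_three, Fin.sum_univ_four,
    Matrix.det_fin_three, Matrix.mul_apply, Matrix.transpose_apply, crossSum, minor]
  simp
  ring

end CauchyBinet

end MatrixPolynomial

/-! ### The induction on the degree -/

namespace GL2Pair

open RCLike Nash MatrixPolynomial

variable {K : Type*} [RCLike K]

attribute [local irreducible] pauli sqNorm moment crossSum minor localized evalMatrix

local notation "M₂" => Matrix (Fin 2) (Fin 2) K

/-- The Pauli matrices. -/
noncomputable def sigma (K : Type*) [RCLike K] : Fin 3 → Matrix (Fin 2) (Fin 2) K :=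
  ![!![0, 1; 1, 0], !![0, -I; I, 0], !![1, 0; 0, -1]]

/-- The diagonal Pauli matrix is reached through the square-zero matrix `!![1, -1; 1, -1]`. -/
lemma sigma_mem (j : Fin 3) : sigma K j ∈ nilpotentSpan K := by
  have hm : ∀ n : M₂, n * n = 0 → n ∈ nilpotentSpan K := fun n hn => Submodule.subset_span hn
  have h0 : (!![0, 1; 0, 0] : M₂) ∈ nilpotentSpan K := hm _ (by
    ext i j; fin_cases i <;> fin_cases j <;> simp [Matrix.mul_apply])
  have h1 : (!![0, 0; 1, 0] : M₂) ∈ nilpotentSpan K := hm _ (by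
    ext i j; fin_cases i <;> fin_cases j <;> simp [Matrix.mul_apply])
  have h2 : (!![0, -I; 0, 0] : M₂) ∈ nilpotentSpan K := hm _ (by
    ext i j; fin_cases i <;> fin_cases j <;> simp [Matrix.mul_apply])
  have h3 : (!![0, 0; I, 0] : M₂) ∈ nilpotentSpan K := hm _ (by
    ext i j; fin_cases i <;> fin_cases j <;> simp [Matrix.mul_apply])
  have h4 : (!![1, -1; 1, -1] : M₂) ∈ nilpotentSpan K := hm _ (by
    ext i j; fin_cases i <;> fin_cases j <;> simp [Matrix.mul_apply])
  fin_cases j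
  · convert add_mem h0 h1 using 1
    ext i j; fin_cases i <;> fin_cases j <;> simp [sigma]
  · convert add_mem h2 h3 using 1
    ext i j; fin_cases i <;> fin_cases j <;> simp [sigma]
  · convert sub_mem (add_mem h4 h0) h1 using 1
    ext i j; fin_cases i <;> fin_cases j <;> simp [sigma]

/-- For hermitian `A` the derivative of `|x|²` along `[A, x]` is `2 tr(A [x, x*])`. If `u`, `v` are
the Pauli vectors of the hermitian part and of `-i` times the skew-hermitian part, then `[x, x*] = 4
(u × v)·σ`, and `tr(σⱼ²) = 2` gives the factor 16. -/
lemma moment_sigma (j : Fin 3) (p : Ambient K) :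
    moment (sigma K j) p = 16 * crossSum (pauli p) j := by
  rcases RCLike.I_eq_zero_or_im_I_eq_one (K := K) with h | h
  · have hz : ∀ z : K, im z = 0 := fun z => im_eq_zero h z
    fin_cases j <;>
      simp [moment, bracket_apply, sigma, Matrix.mul_apply, Fin.sum_univ_two, h, hz, crossSum,
        pauli_apply, Matrix.vecMul, dotProduct] <;> ring
  · fin_cases j <;>
      simp [moment, bracket_apply, sigma, Matrix.mul_apply, Fin.sum_univ_two, h, mul_re, mul_im,
        crossSum, pauli_apply, Matrix.vecMul, dotProduct] <;> ring

lemma bracket_eq_zero_of_pauli_eq_zero {p : Ambient K} (hp : pauli p = 0) (A : M₂) :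
    bracket A p = 0 := by
  have h := fun i j => congrFun (congrFun hp i) j
  have e := fun i => h i 0
  have e1 := fun i => h i 1
  have e2 := fun i => h i 2
  have e3 := fun i => h i 3
  simp only [Fin.forall_fin_succ, pauli_apply] at e e1 e2 e3
  simp at e e1 e2 e3
  have key : ∀ x : M₂, x 0 1 = 0 → x 1 0 = 0 → x 0 0 = x 1 1 → A * x - x * A = 0 := by
    intro x h1 h2 h3
    ext i j
    fin_cases i <;> fin_cases j <;> simp [Matrix.mul_apply, Fin.sum_univ_two, h1, h2, h3] <;> ring
  refine Prod.ext (key _ ?_ ?_ ?_) (key _ ?_ ?_ ?_) <;> refine RCLike.ext ?_ ?_ <;>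
    try simp only [map_zero]
  all_goals linarith [e.1, e.2.1, e.2.2, e1.1, e1.2.1, e1.2.2, e2.1, e2.2.1,
      e2.2.2, e3.1, e3.2.1, e3.2.2]

/-- Brackets do not see scalar parts, so they are linear in the Pauli coordinates. Differentiating
along `[A, p]` therefore does not raise the degree in these coordinates. -/
lemma exists_pauli_bracket (l : Module.Dual ℝ (Ambient K)) (A : M₂) :
    ∃ d : Fin 3 × Fin 4 → ℝ, ∀ p, l (bracket A p) = evalMatrix (pauli p) (linearForm d) := by
  have h : l.comp (bracket A) ∈ LinearMap.range (pauli (K := K)).dualMap := by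
    rw [LinearMap.range_dualMap_eq_dualAnnihilator_ker, Submodule.mem_dualAnnihilator]
    intro p hp
    rw [LinearMap.comp_apply, bracket_eq_zero_of_pauli_eq_zero hp, map_zero]
  obtain ⟨m, hm⟩ := h
  obtain ⟨d, hd⟩ := exists_linearForm m
  exact ⟨d, fun p => by rw [← hd, ← LinearMap.comp_apply, ← hm]; rfl⟩

/-- The functional `l` on `3 × 4` matrices with coefficients `c`. -/
lemma exists_dual_linearForm (c : Fin 3 × Fin 4 → ℝ) :
    ∃ l : Module.Dual ℝ (Ambient K), ∀ p, l p = evalMatrix (pauli p) (linearForm c) := by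
  refine ⟨∑ q, c q • (Matrix.entryLinearMap ℝ ℝ q.1 q.2).comp pauli, fun p => ?_⟩
  simp [evalMatrix_linearForm]

variable {T : TemperedGeneralizedFunction (M2 K)}

lemma isTest_crossSum {ψ : ℝ → ℝ} {h : Ambient K → ℂ} (hψ : IsCutoff ψ) (hh : IsWeight h)
    (j : Fin 3) :
    IsTest (M2 K) (fun p => (crossSum (pauli p) j : ℂ) * localized ψ h p) := by
  have : (fun p : Ambient K => crossSum (pauli p) j) = fun p => 16⁻¹ * moment (sigma K j) p := by
    funext p
    rw [moment_sigma]
    ring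
  have h2 : ContDiff ℝ ∞ (fun p : Ambient K => crossSum (pauli p) j) := by
    rw [this]
    exact contDiff_const.mul (contDiff_moment _)
  exact (isTest_localized hψ hh).mul_left (Complex.ofRealCLM.contDiff.comp h2)

/-- For `F = l ^ k`, infinitesimal invariance applied to `l ^ k Ψ h` with `Ψ' = ψ` gives 16 times
the wanted pairing plus the pairing with `k l ^ (k - 1) l([σⱼ, p]) Ψ h`. The latter has degree at
most `k < n` and vanishes by the induction hypothesis, which must therefore cover all cutoffs.
Polarization gives general `F`. -/
lemma pair_crossSum_eq_zero
    (hT : T ∈ temperedEquivariant (M2 K) (action K) (action_mem_M2_iff K) (chi K)) {n : ℕ}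
    (ih : ∀ F : MvPolynomial (Fin 3 × Fin 4) ℝ, F.totalDegree < n → ∀ ψ h, IsCutoff ψ →
      IsWeight h → pair T (fun p => (evalMatrix (pauli p) F : ℂ) * localized ψ h p) = 0)
    {F : MvPolynomial (Fin 3 × Fin 4) ℝ} (hF : F.totalDegree < n) {ψ : ℝ → ℝ}
    {h : Ambient K → ℂ} (hψ : IsCutoff ψ) (hh : IsWeight h) (j : Fin 3) :
    pair T (fun p => (evalMatrix (pauli p) F : ℂ) *
      ((crossSum (pauli p) j : ℂ) * localized ψ h p)) = 0 := by
  rw [← polynomialPair_apply T pauli (isTest_crossSum hψ hh j)]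
  refine eq_zero_of_linearForm_pow _ fun c k hk => ?_
  rw [polynomialPair_apply]
  obtain ⟨Ψ, hΨ, hd⟩ := hψ.exists_primitive
  obtain ⟨l, hl⟩ := exists_dual_linearForm (K := K) c
  obtain ⟨d, hld⟩ := exists_pauli_bracket l (sigma K j)
  have key := pair_infinitesimal hT (sigma_mem j) l k hΨ hψ hd hh
  let G : MvPolynomial (Fin 3 × Fin 4) ℝ := MvPolynomial.C (k : ℝ) * linearForm c ^ (k - 1) *
    linearForm d
  have hG : G.totalDegree < n := by
    rcases Nat.eq_zero_or_pos k with rfl | hk0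
    · simp only [G, Nat.cast_zero, map_zero, zero_mul, MvPolynomial.totalDegree_zero]
      omega
    · have h1 := MvPolynomial.totalDegree_mul (MvPolynomial.C (k : ℝ) * linearForm c ^ (k - 1))
        (linearForm d)
      have h2 := MvPolynomial.totalDegree_mul (MvPolynomial.C (k : ℝ)) (linearForm c ^ (k - 1))
      have h3 := MvPolynomial.totalDegree_pow (linearForm c) (k - 1)
      have h4 := Nat.mul_le_mul_left (k - 1) (totalDegree_linearForm_le c)
      have h5 := totalDegree_linearForm_le d
      rw [MvPolynomial.totalDegree_C] at h2
      simp only [G]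
      omega
  have h1 := ih G hG Ψ h hΨ hh
  have t1 : IsTest (M2 K) (fun p => (evalMatrix (pauli p) G : ℂ) * localized Ψ h p) :=
    (isTest_localized hΨ hh).mul_left (contDiff_evalMatrix (pauli (K := K)) G)
  have t2 := (isTest_crossSum hψ hh j).mul_left (contDiff_evalMatrix (pauli (K := K)) (linearForm c ^ k))
  have e : (fun p => ((k * l p ^ (k - 1) * l (bracket (sigma K j) p) : ℝ) : ℂ) * localized Ψ h p
      + ((l p ^ k * moment (sigma K j) p : ℝ) : ℂ) * localized ψ h p)
      = fun p => (evalMatrix (pauli p) G : ℂ) * localized Ψ h p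
        + 16 * ((evalMatrix (pauli p) (linearForm c ^ k) : ℂ) *
          ((crossSum (pauli p) j : ℂ) * localized ψ h p)) := by
    funext p
    rw [moment_sigma, hld, hl]
    have : evalMatrix (pauli p) G = k * evalMatrix (pauli p) (linearForm c) ^ (k - 1)
        * evalMatrix (pauli p) (linearForm d) := by
      simp [G, evalMatrix]
    rw [this, map_pow]
    push_cast
    ring
  rw [e, pair_add T t1 (t2.const_mul 16), h1, zero_add, pair_const_mul T t2] at key
  exact (mul_eq_zero.1 key).resolve_left (by norm_num)

lemma rho_one : rho (1 : M₂) = 1 := by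
  ext i j
  fin_cases i <;> fin_cases j <;> simp [rho]

/-- `rho` as a representation of the unitary group. -/
noncomputable def unitaryRho (K : Type*) [RCLike K] :
    Matrix.unitaryGroup (Fin 2) K →* Matrix (Fin 3) (Fin 3) ℝ where
  toFun k := rho k.1
  map_one' := rho_one
  map_mul' k k' := rho_mul k.1 k'.1 (Unitary.star_mul_self_of_mem k'.2)

instance compactSpace_unitaryGroup : CompactSpace (Matrix.unitaryGroup (Fin 2) K) := by
  refine isCompact_iff_compactSpace.1 ?_
  have hc : IsClosed (unitary M₂ : Set M₂) := isClosed_unitary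
  have : ProperSpace M₂ := FiniteDimensional.proper ℝ M₂
  refine (isCompact_closedBall (0 : M₂) 1).of_isClosed_subset (by exact hc) fun k hk => ?_
  rw [mem_closedBall_zero_iff, Matrix.norm_le_iff zero_le_one]
  exact entry_norm_bound_of_unitary hk

/-- A unitary matrix as an element of `GL₂(𝕂)`. -/
def unitaryUnit (k : Matrix.unitaryGroup (Fin 2) K) : GL (Fin 2) K where
  val := k.1
  inv := star k.1
  val_inv := Unitary.mul_star_self_of_mem k.2
  inv_val := Unitary.star_mul_self_of_mem k.2

lemma localized_unitary {ψ : ℝ → ℝ} {h : Ambient K → ℂ} (hh : IsWeight h)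
    (k : Matrix.unitaryGroup (Fin 2) K) (p : Ambient K) :
    localized ψ h (GL2Pair.conj K (unitaryUnit k) p) = localized ψ h p := by
  rw [localized, localized, hh.conj]
  have e : sqNorm (GL2Pair.conj K (unitaryUnit k) p) = sqNorm p :=
    sqNorm_conj (Unitary.star_mul_self_of_mem k.2) p
  rw [e]

lemma pauli_unitary (k : Matrix.unitaryGroup (Fin 2) K) (p : Ambient K) :
    pauli (GL2Pair.conj K (unitaryUnit k) p) = unitaryRho K k * pauli p :=
  GL2Pair.pauli_conj (Unitary.mul_star_self_of_mem k.2) p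

/-- Coefficient matrices of linear functionals of the Pauli coordinates. -/
def IsPatterned (K : Type*) [RCLike K] (c : Matrix (Fin 3) (Fin 4) ℝ) : Prop :=
  (I : K) = 0 → c 0 1 = 0 ∧ c 0 3 = 0 ∧ c 1 0 = 0 ∧ c 1 2 = 0 ∧ c 2 1 = 0 ∧ c 2 3 = 0

/-- Over ℝ half of the Pauli coordinates vanish identically, and the corresponding coefficients may
be erased. The product `V cᵀ` is then a block matrix, as required by `exists_det_factor_block`. -/
lemma exists_isPatterned (c : Fin 3 × Fin 4 → ℝ) :
    ∃ c' : Matrix (Fin 3) (Fin 4) ℝ, IsPatterned K c' ∧ ∀ p : Ambient K,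
      evalMatrix (pauli p) (linearForm c) = evalMatrix (pauli p) (linearForm fun q => c' q.1 q.2) := by
  by_cases hI : (I : K) = 0
  · refine ⟨!![c (0, 0), 0, c (0, 2), 0; 0, c (1, 1), 0, c (1, 3); c (2, 0), 0, c (2, 2), 0],
      fun _ => by simp, fun p => ?_⟩
    obtain ⟨h1, h2, h3, h4, h5, h6⟩ := pauli_block hI p
    simp [evalMatrix_linearForm, Fintype.sum_prod_type, Fin.sum_univ_three, Fin.sum_univ_four, h1,
      h2, h3, h4, h5, h6]
  · exact ⟨Matrix.of fun i j => c (i, j), fun h => absurd h hI, fun p => rfl⟩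

lemma isBlock_mul_transpose (hI : (I : K) = 0) {c : Matrix (Fin 3) (Fin 4) ℝ}
    (hc : IsPatterned K c) (p : Ambient K) : IsBlock (pauli p * cᵀ) := by
  obtain ⟨h1, h2, h3, h4, h5, h6⟩ := pauli_block hI p
  obtain ⟨g1, g2, g3, g4, g5, g6⟩ := hc hI
  simp only [IsBlock, Matrix.mul_apply, Fin.sum_univ_four, Matrix.transpose_apply]
  simp [h1, h2, h3, h4, h5, h6, g1, g2, g3, g4, g5, g6]

lemma exists_det_factor {Φ : MvPolynomial (Fin 3 × Fin 3) ℝ} (h : ∀ N : Matrix (Fin 3) (Fin 3) ℝ,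
      (∃ k, unitaryRho K k * (tauMatrix * N) = N) → evalMatrix N Φ = 0) :
    ∃ Q : MvPolynomial (Fin 3 × Fin 3) ℝ, (Q = 0 ∨ Q.totalDegree + 3 ≤ Φ.totalDegree) ∧
      ∀ c, IsPatterned K c → ∀ p : Ambient K, evalMatrix (pauli p * cᵀ) Φ
        = (pauli p * cᵀ).det * evalMatrix (pauli p * cᵀ) Q := by
  by_cases hI : (I : K) = 0
  · obtain ⟨Q, hQ, hQ'⟩ := exists_det_factor_block (Φ := Φ) fun N hN hd => by
      obtain ⟨k, hk, hkN⟩ := exists_unitary_fixing (K := K) hd fun _ => hN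
      exact h N ⟨⟨k, hk⟩, hkN⟩
    exact ⟨Q, hQ, fun c hc p => hQ' _ (isBlock_mul_transpose hI hc p)⟩
  · obtain ⟨Q, hQ, hQ'⟩ := exists_det_factor_full (Φ := Φ) fun N hd => by
      obtain ⟨k, hk, hkN⟩ := exists_unitary_fixing (K := K) hd fun h => absurd h hI
      exact h N ⟨⟨k, hk⟩, hkN⟩
    exact ⟨Q, hQ, fun c hc p => hQ' _⟩

/-- `T` vanishes on the test functions `F(v(p)) ψ(|p|²) h(p)` with `F` a polynomial. -/
theorem pair_polynomial_eq_zero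
    (hT : T ∈ temperedEquivariant (M2 K) (action K) (action_mem_M2_iff K) (chi K)) (n : ℕ) :
    ∀ F : MvPolynomial (Fin 3 × Fin 4) ℝ, F.totalDegree < n → ∀ ψ h, IsCutoff ψ →
      IsWeight h → pair T (fun p => (evalMatrix (pauli p) F : ℂ) * localized ψ h p) = 0 := by
  induction n with
  | zero => intro F hF; omega
  | succ n ih =>
    intro F hF ψ h hψ hh
    have htest := isTest_localized hψ hh
    rw [← polynomialPair_apply T pauli htest]
    refine eq_zero_of_linearForm_pow _ fun c₀ k hk => ?_
    rw [polynomialPair_apply]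
    obtain ⟨c, hc, hcc⟩ := exists_isPatterned (K := K) c₀
    let L : MvPolynomial (Fin 3 × Fin 3) ℝ →ₗ[ℝ] ℂ :=
      (polynomialPair T pauli htest).comp (liftRight c).toLinearMap
    have hL : ∀ φ, L φ = pair T (fun p => (evalMatrix (pauli p * cᵀ) φ : ℂ) * localized ψ h p) := by
      intro φ
      change polynomialPair T pauli htest (liftRight c φ) = _
      simp only [polynomialPair_apply, evalMatrix_liftRight]
    have hφtest : ∀ φ, IsTest (M2 K)
        (fun p => (evalMatrix (pauli p * cᵀ) φ : ℂ) * localized ψ h p) := fun φ => by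
      simp only [← evalMatrix_liftRight]
      exact htest.mul_left (contDiff_evalMatrix (pauli (K := K)) _)
    -- This is `(tr N) ^ k`. At `N = V cᵀ` the trace is the linear form with coefficients `c`, so
    -- the pairing in question is `L φ`.
    let φ : MvPolynomial (Fin 3 × Fin 3) ℝ :=
      (linearForm fun q => if q.1 = q.2 then 1 else 0) ^ k
    obtain ⟨Φ, hdeg, hLΦ, hΦ⟩ := exists_odd_average (unitaryRho K)
      (continuous_rho.comp continuous_subtype_val) tauMatrix L (fun k φ => by
        rw [hL, hL, ← GL2Pair.pair_conj hT (unitaryUnit k) (hφtest φ)]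
        congr 1
        funext p
        rw [evalMatrix_act, ← Matrix.mul_assoc, localized_unitary hh, pauli_unitary])
      (fun φ => by
        rw [hL, hL, ← pair_transpose hT (hφtest φ)]
        congr 1
        funext p
        rw [evalMatrix_act, ← Matrix.mul_assoc, pauli_transpose, localized, localized, hh.transpose,
          sqNorm_transpose]) φ
    obtain ⟨Q, hQ, hQΦ⟩ := exists_det_factor hΦ
    have hφdeg : φ.totalDegree ≤ n :=
      (MvPolynomial.totalDegree_pow _ _).trans
        ((Nat.mul_le_mul_left k (totalDegree_linearForm_le _)).trans (by omega))
    let w : Fin 3 → MvPolynomial (Fin 3 × Fin 4) ℝ := fun j => linearForm fun q => if q.1 = j then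
      (![minor c 0 2 3, minor c 1 2 3, minor c 0 1 2, minor c 0 1 3] : Fin 4 → ℝ) q.2 else 0
    have hΦ0 : L Φ = 0 := by
      have hj : ∀ j, pair T (fun p => (evalMatrix (pauli p) (w j * liftRight c Q) : ℂ) *
          ((crossSum (pauli p) j : ℂ) * localized ψ h p)) = 0 := by
        intro j
        rcases hQ with rfl | hQ
        · simp only [map_zero, mul_zero, Complex.ofReal_zero, zero_mul]
          exact pair_zero T
        -- `Q` has degree at most `n - 3` and `w j` at most 1, so the cofactor stays below `n`.
        · refine pair_crossSum_eq_zero hT ih ?_ hψ hh j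
          have h1 := MvPolynomial.totalDegree_mul (w j) (liftRight c Q)
          have h2 := totalDegree_linearForm_le (fun q : Fin 3 × Fin 4 => if q.1 = j then
            (![minor c 0 2 3, minor c 1 2 3, minor c 0 1 2, minor c 0 1 3] : Fin 4 → ℝ) q.2 else 0)
          have h3 := totalDegree_liftRight_le (m := Fin 3) c Q
          simp only [w] at h1 ⊢
          omega
      have hs := pair_sum T Finset.univ (f := fun j p =>
        (evalMatrix (pauli p) (w j * liftRight c Q) : ℂ) *
          ((crossSum (pauli p) j : ℂ) * localized ψ h p)) (fun j (_ : j ∈ Finset.univ) =>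
        (isTest_crossSum hψ hh j).mul_left (contDiff_evalMatrix (pauli (K := K)) (w j * liftRight c Q)))
      rw [Finset.sum_eq_zero fun j _ => hj j] at hs
      rw [hL, ← hs]
      congr 1
      funext p
      rw [hQΦ c hc p, det_mul_transpose]
      simp only [map_mul, evalMatrix_liftRight, w]
      push_cast
      rw [Finset.sum_mul, Finset.sum_mul]
      exact Finset.sum_congr rfl fun j _ => by ring
    rw [hΦ0] at hLΦ
    have hφ0 : L φ = 0 := (mul_eq_zero.1 hLΦ.symm).resolve_left two_ne_zero
    rw [hL] at hφ0
    rw [← hφ0]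
    congr 1
    funext p
    congr 2
    rw [map_pow, map_pow, hcc]
    congr 1
    simp only [evalMatrix_linearForm, Fintype.sum_prod_type, Fin.sum_univ_three, Fin.sum_univ_four,
      Matrix.mul_apply, Matrix.transpose_apply]
    simp
    ring

end GL2Pair

/-! ### Approximation of test functions -/

namespace GL2Pair

open RCLike Nash MatrixPolynomial

variable {K : Type*} [RCLike K]

attribute [local irreducible] pauli sqNorm localized evalMatrix

local notation "M₂" => Matrix (Fin 2) (Fin 2) K

/-- The projection to pairs of scalar matrices. -/
noncomputable def scalarPart : Ambient K →ₗ[ℝ] Ambient K where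
  toFun p := ((p.1.trace / 2) • (1 : M₂), (p.2.trace / 2) • (1 : M₂))
  map_add' p q := by simp [add_div, add_smul]
  map_smul' c p := by
    simp only [Prod.smul_fst, Prod.smul_snd, Matrix.trace_smul, RingHom.id_apply, Prod.smul_mk,
      smul_div_assoc, smul_assoc]

lemma scalarPart_conj (g : GL (Fin 2) K) (p : Ambient K) :
    scalarPart (GL2Pair.conj K g p) = scalarPart p := by
  have h : ∀ x : M₂, (g.1 * x * (g⁻¹).1).trace = x.trace := fun x => by
    rw [Matrix.trace_mul_comm, ← mul_assoc, Units.inv_mul, one_mul]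
  refine Prod.ext ?_ ?_
  · change ((g.1 * p.1 * (g⁻¹).1).trace / 2) • (1 : M₂) = (p.1.trace / 2) • (1 : M₂)
    rw [h]
  · change ((g.1 * p.2 * (g⁻¹).1).trace / 2) • (1 : M₂) = (p.2.trace / 2) • (1 : M₂)
    rw [h]

lemma scalarPart_transpose (p : Ambient K) : scalarPart (p.1ᵀ, p.2ᵀ) = scalarPart p := by
  simp [scalarPart]

lemma eq_scalarPart_of_pauli_eq_zero {p : Ambient K} (hp : pauli p = 0) : p = scalarPart p := by
  have h := fun i j => congrFun (congrFun hp i) j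
  have e := fun i => h i 0
  have e1 := fun i => h i 1
  have e2 := fun i => h i 2
  have e3 := fun i => h i 3
  simp only [Fin.forall_fin_succ, pauli_apply] at e e1 e2 e3
  simp at e e1 e2 e3
  have key : ∀ x : M₂, x 0 1 = 0 → x 1 0 = 0 → x 0 0 = x 1 1 → x = (x.trace / 2) • (1 : M₂) := by
    intro x h1 h2 h3
    ext i j
    fin_cases i <;> fin_cases j <;> simp [Matrix.trace, Fin.sum_univ_two, h1, h2, h3]
  refine Prod.ext (key _ ?_ ?_ ?_) (key _ ?_ ?_ ?_) <;> refine RCLike.ext ?_ ?_ <;>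
    try simp only [map_zero]
  all_goals linarith [e.1, e.2.1, e.2.2, e1.1, e1.2.1, e1.2.2, e2.1, e2.2.1,
      e2.2.2, e3.1, e3.2.1, e3.2.2]

/-- The kernel of the Pauli coordinates consists of pairs of scalar matrices, on which `l` and `l ∘
scalarPart` agree. -/
lemma exists_decomposition (l : Module.Dual ℝ (Ambient K)) : ∃ c : Fin 3 × Fin 4 → ℝ,
    ∀ p, l p = l (scalarPart p) + evalMatrix (pauli p) (linearForm c) := by
  have h : l.comp (LinearMap.id - scalarPart) ∈ LinearMap.range (pauli (K := K)).dualMap := by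
    rw [LinearMap.range_dualMap_eq_dualAnnihilator_ker, Submodule.mem_dualAnnihilator]
    intro p hp
    rw [LinearMap.comp_apply, LinearMap.sub_apply, LinearMap.id_apply,
      ← eq_scalarPart_of_pauli_eq_zero hp, sub_self, map_zero]
  obtain ⟨m, hm⟩ := h
  obtain ⟨c, hc⟩ := exists_linearForm m
  refine ⟨c, fun p => ?_⟩
  have e := LinearMap.congr_fun hm p
  rw [LinearMap.comp_apply, LinearMap.sub_apply, LinearMap.id_apply, map_sub] at e
  rw [← hc, ← sub_eq_iff_eq_add', ← e]
  rfl

lemma IsWeight.scalarPart_mul {h : Ambient K → ℂ} (hh : IsWeight h)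
    (l : Module.Dual ℝ (Ambient K)) (k : ℕ) :
    IsWeight (fun p => ((l (scalarPart p) : ℝ) : ℂ) ^ k * h p) where
  contDiff := ((Complex.ofRealCLM.contDiff.comp
    (LinearMap.toContinuousLinearMap (l.comp scalarPart)).contDiff).pow k).mul hh.contDiff
  conj g p := by rw [scalarPart_conj, hh.conj]
  transpose p := by rw [scalarPart_transpose, hh.transpose]
  vanish := by
    obtain ⟨ε, hε, hv⟩ := hh.vanish
    exact ⟨ε, hε, fun p hp => by rw [hv p hp, mul_zero]⟩

variable {T : TemperedGeneralizedFunction (M2 K)}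

lemma pair_complexPowers_eq_zero
    (hT : T ∈ temperedEquivariant (M2 K) (action K) (action_mem_M2_iff K) (chi K))
    {ψ : ℝ → ℝ} {h : Ambient K → ℂ} (hψ : IsCutoff ψ) (hh : IsWeight h) {P : Ambient K → ℂ}
    (hP : P ∈ complexPowers (Ambient K)) : pair T (fun p => P p * localized ψ h p) = 0 := by
  have htest := isTest_localized hψ hh
  have hmem : ∀ {P}, P ∈ Submodule.span ℂ (Set.range
      fun p : (Ambient K →L[ℝ] ℝ) × ℕ => fun x => ((p.1 x : ℝ) : ℂ) ^ p.2) →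
      IsTest (M2 K) (fun p => P p * localized ψ h p) := fun hP =>
    htest.mul_left (complexPowers.contDiff hP)
  induction hP using Submodule.span_induction with
  | mem P hP =>
    obtain ⟨⟨l, k⟩, rfl⟩ := hP
    obtain ⟨c, hc⟩ := exists_decomposition (l : Module.Dual ℝ (Ambient K))
    let F : ℕ → MvPolynomial (Fin 3 × Fin 4) ℝ := fun m =>
      MvPolynomial.C (k.choose m : ℝ) * linearForm c ^ m
    let h' : ℕ → Ambient K → ℂ := fun m p =>
      ((((l : Module.Dual ℝ (Ambient K)) (scalarPart p) : ℝ)) : ℂ) ^ (k - m) * h p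
    have hh' : ∀ m, IsWeight (h' m) := fun m => hh.scalarPart_mul _ _
    -- The binomial expansion separates the powers of the Pauli part from those of the invariant
    -- scalar part; the latter are absorbed into the weights `h' m`.
    have e : (fun p => ((l p : ℝ) : ℂ) ^ k * localized ψ h p) = fun p =>
        ∑ m ∈ Finset.range (k + 1), (evalMatrix (pauli p) (F m) : ℂ) * localized ψ (h' m) p := by
      funext p
      have hl : l p = evalMatrix (pauli p) (linearForm c)
          + (l : Module.Dual ℝ (Ambient K)) (scalarPart p) := by
        rw [add_comm, ← hc]
        rfl
      have hF : ∀ m, evalMatrix (pauli p) (F m)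
          = k.choose m * evalMatrix (pauli p) (linearForm c) ^ m := fun m => by
        simp only [F, map_mul, map_pow]
        congr 1
        exact (evalMatrix (pauli p)).commutes _
      rw [hl, Complex.ofReal_add, add_pow, Finset.sum_mul]
      refine Finset.sum_congr rfl fun m _ => ?_
      rw [hF]
      simp only [localized, h']
      push_cast
      ring
    simp only
    rw [e, pair_sum T _ fun m _ => (isTest_localized hψ (hh' m)).mul_left
      (contDiff_evalMatrix (pauli (K := K)) (F m))]
    exact Finset.sum_eq_zero fun m _ =>
      pair_polynomial_eq_zero hT _ (F m) (Nat.lt_succ_self _) ψ (h' m) hψ (hh' m)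
  | zero => simpa using pair_zero T
  | add P Q hP hQ iP iQ =>
    have := pair_add T (hmem hP) (hmem hQ)
    rw [iP, iQ, add_zero] at this
    rw [← this]
    congr 1
    funext p
    simp [add_mul]
  | smul c P hP iP =>
    have := pair_const_mul T (hmem hP) c
    rw [iP, mul_zero] at this
    rw [← this]
    congr 1
    funext p
    simp [mul_assoc]

lemma contDiff_normSq_det : ContDiff ℝ ∞ (fun p : Ambient K => normSq p.1.det) ∧
    ContDiff ℝ ∞ (fun p : Ambient K => normSq p.2.det) := by
  have hre : ContDiff ℝ ∞ (re : K → ℝ) := (RCLike.reCLM : K →L[ℝ] ℝ).contDiff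
  have him : ContDiff ℝ ∞ (im : K → ℝ) := (RCLike.imCLM : K →L[ℝ] ℝ).contDiff
  have h := contDiff_entry (K := K)
  have hn : ∀ {F : Ambient K → K}, ContDiff ℝ ∞ F → ContDiff ℝ ∞ (fun p => normSq (F p)) :=
    fun hF => by
      simp only [normSq_apply]
      exact ((hre.comp hF).mul (hre.comp hF)).add ((him.comp hF).mul (him.comp hF))
  simp only [Matrix.det_fin_two]
  exact ⟨hn (((h 0 0).1.mul (h 1 1).1).sub ((h 0 1).1.mul (h 1 0).1)),
    hn (((h 0 0).2.mul (h 1 1).2).sub ((h 0 1).2.mul (h 1 0).2))⟩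

/-- A smooth function of `|det x|²` and `|det y|²` is automatically invariant. Both are bounded
below by a positive `ε` on `S`, which leaves room for a transition between `ε / 2` and `ε`. -/
lemma exists_isWeight {S : Set (Ambient K)} (hS : IsCompact S) (hSU : S ⊆ (M2 K).carrier) :
    ∃ h : Ambient K → ℂ, IsWeight h ∧ ∀ p ∈ S, h p = 1 := by
  have hpos : ∀ p ∈ S, 0 < min (normSq p.1.det) (normSq p.2.det) := fun p hp =>
    lt_min ((normSq_nonneg _).lt_of_ne fun h => (hSU hp).1 (normSq_eq_zero.1 h.symm))
      ((normSq_nonneg _).lt_of_ne fun h => (hSU hp).2 (normSq_eq_zero.1 h.symm))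
  obtain ⟨ε, hε, hle⟩ := hS.exists_forall_le'
    (contDiff_normSq_det.1.continuous.min contDiff_normSq_det.2.continuous).continuousOn hpos
  let η : ℝ → ℝ := fun s => Real.smoothTransition (2 * s / ε - 1)
  have hη : ContDiff ℝ ∞ η := Real.smoothTransition.contDiff.comp
    (((contDiff_const.mul contDiff_id).div_const ε).sub contDiff_const)
  have hη0 : ∀ s, s < ε / 2 → η s = 0 := fun s hs => by
    refine Real.smoothTransition.zero_of_nonpos ?_
    rw [sub_nonpos, div_le_one hε]
    linarith
  have hη1 : ∀ s, ε ≤ s → η s = 1 := fun s hs => by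
    refine Real.smoothTransition.one_of_one_le ?_
    rw [le_sub_iff_add_le, le_div_iff₀ hε]
    linarith
  refine ⟨fun p => ((η (normSq p.1.det) * η (normSq p.2.det) : ℝ) : ℂ),
    ⟨Complex.ofRealCLM.contDiff.comp ((hη.comp contDiff_normSq_det.1).mul
      (hη.comp contDiff_normSq_det.2)), fun g p => ?_, fun p => ?_, ε / 2, by positivity,
      fun p hp => ?_⟩, fun p hp => ?_⟩
  · have key : ∀ x : M₂, (g.1 * x * (g⁻¹).1).det = x.det := fun x => Matrix.det_units_conj g x
    change ((η (normSq (g.1 * p.1 * (g⁻¹).1).det) * η (normSq (g.1 * p.2 * (g⁻¹).1).det) : ℝ) : ℂ)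
      = _
    rw [key, key]
  · simp only [Matrix.det_transpose]
  · rcases hp with hp | hp <;> simp [hη0 _ hp]
  · have := hle p hp
    simp [hη1 _ (this.trans (min_le_left _ _)), hη1 _ (this.trans (min_le_right _ _))]

lemma exists_isCutoff (R : ℝ) : ∃ ψ, IsCutoff ψ ∧ ∀ s ≤ R, ψ s = 1 := by
  refine ⟨fun s => 1 - Real.smoothTransition (s - R), ⟨contDiff_const.sub
    (Real.smoothTransition.contDiff.comp (contDiff_id.sub contDiff_const)), R + 1, fun s hs => ?_⟩,
    fun s hs => ?_⟩
  · rw [Real.smoothTransition.one_of_one_le (by linarith), sub_self]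
  · have h0 : Real.smoothTransition (s - R) = 0 :=
      Real.smoothTransition.zero_of_nonpos (by linarith)
    simp only [h0, sub_zero]

lemma exists_iteratedFDeriv_bound {E : Type*} [NormedAddCommGroup E] [NormedSpace ℝ E] {g : E → ℂ}
    (hg : ContDiff ℝ ∞ g) {S : Set E} (hS : IsCompact S) (m : ℕ) :
    ∃ B, 0 ≤ B ∧ ∀ j ≤ m, ∀ x ∈ S, ‖iteratedFDeriv ℝ j g x‖ ≤ B := by
  have h : ∀ j, ∃ B, ∀ x ∈ S, ‖iteratedFDeriv ℝ j g x‖ ≤ B := fun j =>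
    hS.exists_bound_of_continuousOn
      (hg.continuous_iteratedFDeriv (m := j) (by exact_mod_cast le_top)).continuousOn
  choose B hB using h
  refine ⟨∑ j ∈ Finset.range (m + 1), |B j|, by positivity, fun j hj x hx => ?_⟩
  exact (hB j x hx).trans ((le_abs_self _).trans (Finset.single_le_sum (f := fun j => |B j|)
    (fun _ _ => abs_nonneg _) (Finset.mem_range.2 (Nat.lt_succ_of_le hj))))

/-- An equivariant tempered generalized function vanishes on compactly supported functions. -/
theorem pair_eq_zero
    (hT : T ∈ temperedEquivariant (M2 K) (action K) (action_mem_M2_iff K) (chi K))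
    {f : Ambient K → ℂ} (hf : IsTest (M2 K) f) : pair T f = 0 := by
  obtain ⟨h, hh, hh1⟩ := exists_isWeight (hf.compact : IsCompact (tsupport f)) hf.subset
  obtain ⟨R, hR⟩ := (hf.compact : IsCompact (tsupport f)).exists_bound_of_continuousOn
    (contDiff_sqNorm (K := K)).continuous.continuousOn
  obtain ⟨ψ, hψ, hψ1⟩ := exists_isCutoff R
  have htest := isTest_localized hψ hh
  have hS : IsCompact (tsupport (localized ψ h)) := htest.compact
  obtain ⟨C, hC, m, hbound⟩ := exists_pair_bound T hS htest.subset
  obtain ⟨B, hB, hBle⟩ := exists_iteratedFDeriv_bound htest.contDiff hS m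
  obtain ⟨r, hr⟩ := hS.isBounded.exists_norm_le
  -- The fixed test function `localized ψ h` is 1 on the support of `f`. Approximating only the
  -- factor `f` by `P` keeps every test function supported in one compact set, where `T` has finite
  -- order.
  have hfloc : ∀ p, f p * localized ψ h p = f p := fun p => by
    by_cases hp : p ∈ tsupport f
    · have h1 : ψ (sqNorm p) = 1 := hψ1 _ ((le_abs_self _).trans (hR p hp))
      simp [localized, h1, hh1 p hp]
    · rw [image_eq_zero_of_notMem_tsupport hp, zero_mul]
  have key : ∀ ε : ℝ, 0 < ε → ‖pair T f‖ ≤ C * (2 ^ m * B) * ε := by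
    intro ε hε
    obtain ⟨P, hP, hPle⟩ := exists_complexPowers_approx hf.contDiff hf.compact m r hε
    have hPs := complexPowers.contDiff hP
    have hd : ContDiff ℝ ∞ (fun p => f p - P p) := hf.contDiff.sub hPs
    have e : pair T f = pair T (fun p => (f p - P p) * localized ψ h p) := by
      have h1 := pair_add T (htest.mul_left hd) (htest.mul_left hPs)
      rw [pair_complexPowers_eq_zero hT hψ hh hP, add_zero] at h1
      rw [← h1]
      congr 1
      funext p
      rw [← add_mul, sub_add_cancel, hfloc]
    rw [e, mul_assoc]
    refine (hbound _ (hd.mul htest.contDiff) (tsupport_mul_subset_right) (2 ^ m * B * ε)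
      (by positivity) fun j hj x hx => ?_)
    refine (norm_iteratedFDeriv_mul_le hd htest.contDiff x (n := j)
      (by exact_mod_cast le_top)).trans ?_
    -- The Leibniz rule; the binomial coefficients sum to `2 ^ j`.
    calc ∑ i ∈ Finset.range (j + 1), (j.choose i : ℝ) * ‖iteratedFDeriv ℝ i (fun p => f p - P p) x‖
          * ‖iteratedFDeriv ℝ (j - i) (localized ψ h) x‖
        ≤ ∑ i ∈ Finset.range (j + 1), (j.choose i : ℝ) * ε * B := by
          refine Finset.sum_le_sum fun i hi => ?_
          have hi' := Nat.lt_succ_iff.1 (Finset.mem_range.1 hi)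
          have h1 := hPle i (hi'.trans hj) x (hr x hx)
          have h2 := hBle (j - i) ((Nat.sub_le _ _).trans hj) x hx
          gcongr
      _ = 2 ^ j * B * ε := by
          rw [← Finset.sum_mul, ← Finset.sum_mul, ← Nat.cast_sum, Nat.sum_range_choose]
          push_cast
          ring
      _ ≤ 2 ^ m * B * ε := by
          gcongr
          norm_num
  have hlim : Filter.Tendsto (fun ε : ℝ => C * (2 ^ m * B) * ε) (nhdsWithin 0 (Set.Ioi 0))
      (nhds 0) := by
    have : Filter.Tendsto (fun ε : ℝ => C * (2 ^ m * B) * ε) (nhds 0)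
        (nhds (C * (2 ^ m * B) * 0)) := (continuous_const.mul continuous_id).tendsto 0
    rw [mul_zero] at this
    exact this.mono_left nhdsWithin_le_nhds
  exact norm_le_zero_iff.1 (ge_of_tendsto hlim
    (Filter.eventually_of_mem self_mem_nhdsWithin fun ε hε => key ε hε))

end GL2Pair

/-- For `𝕂 = ℝ` or `ℂ`, there are no nonzero tempered generalized functions on `GL₂(𝕂) × GL₂(𝕂)` that
are equivariant for the character of `{1, τ} ⋉ GL₂(𝕂)` that is `1` on `GL₂(𝕂)` and `-1` at `τ`. -/
theorem mainTheorem10 (K : Type*) [RCLike K] :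
    Nash.temperedEquivariant (GL2Pair.M2 K) (GL2Pair.action K) (GL2Pair.action_mem_M2_iff K)
      (GL2Pair.chi K) = ⊥ := by
  rw [eq_bot_iff]
  intro T hT
  rw [Submodule.mem_bot]
  -- The polynomial `d` is `|det x|² |det y|²`, which is positive exactly on `M2 K`.
  refine Nash.eq_zero_of_pair_eq_zero ((Nash.polynomialFunctions _).mul_mem
    (GL2Pair.polynomial_det K (LinearMap.fst ℝ _ _)) (GL2Pair.polynomial_det K (LinearMap.snd ℝ _ _)))
    (fun p => mul_nonneg (RCLike.normSq_nonneg _) (RCLike.normSq_nonneg _)) ?_ T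
    fun g hg => GL2Pair.pair_eq_zero hT hg
  ext p
  have h : ∀ z : K, 0 < RCLike.normSq z ↔ z ≠ 0 := fun z =>
    ⟨fun h h0 => by simp [h0] at h,
      fun h => (RCLike.normSq_nonneg z).lt_of_ne fun h0 => h (RCLike.normSq_eq_zero.1 h0.symm)⟩
  refine ⟨fun hp => mul_pos ((h _).2 hp.1) ((h _).2 hp.2), fun hp => ?_⟩
  have hp' : 0 < RCLike.normSq p.1.det * RCLike.normSq p.2.det := hp
  refine ⟨fun h0 => ?_, fun h0 => ?_⟩ <;> simp [h0] at hp'
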